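/- Let $\Gamma$ be a rooted metric tree with root $o$, in which every vertex $y$ has finite generation $\mathrm{gen}(y)$ (the number of vertices $x$ with $o\prec x\preceq y$), every edge is a segment of positive finite length, and the number $b(y)$ of edges emanating from a vertex $y$ satisfies $b(o)=1$ and $1<b(y)<\infty$ for $y\neq o$. Let $|x|$ be the distance of $x\in\Gamma$ from $o$ and $dx$ the measure on $\Gamma$ induced by Lebesgue measure on the edges. Suppose that $\Gamma$ is regular: all vertices of the same generation have equal branching numbers and all edges of the same generation (that of the initial vertex) have equal lengths; write $b(y)=b_{\mathrm{gen}(y)}$ and $|y|=t_{\mathrm{gen}(y)}$ for every vertex $y$, and $R=\lim_{k\to\infty}t_k\in(0,\infty]$. Let $V:[0,R)\to\mathbb R$ be measurable and bounded below. Let $\mathbf A_V$ be the self-adjoint operator in $L^2(\Gamma)$ associated with the quadratic form $$\mathbf a_V[f]=\int_\Gamma\bigl(|f'(x)|^2+V(|x|)|f(x)|^2\bigr)\,dx$$ whose domain consists of the continuous functions $f$ on $\Gamma$ with $f(o)=0$ whose restriction to each edge is in $H^1$ and for which $\int_\Gamma(|f'|^2+|f|^2+|V(|x|)||f|^2)\,dx<\infty$.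 For $k\ge0$ let $g_k(t)=b_{k+1}\cdots b_n$ for $t_n<t\le t_{n+1}$, $n\ge k$ (so $g_k=1$ on $(t_k,t_{k+1}]$), and let $\mathcal A_{V,k}$ be the self-adjoint operator in $L^2((t_k,R),g_k\,dt)$ associated with the quadratic form $$a_{V,k}[u]=\int_{t_k}^R\bigl(|u'(t)|^2+V(t)|u(t)|^2\bigr)g_k(t)\,dt$$ whose domain consists of the locally absolutely continuous functions $u$ on $[t_k,R)$ with $u(t_k)=0$ and $\int_{t_k}^R(|u'|^2+|u|^2+|V||u|^2)g_k\,dt<\infty$. (If a form domain is not dense, the operator is understood as acting in its closure.) The spectrum of a self-adjoint operator is called discrete if it consists of isolated eigenvalues of finite multiplicity; for such an operator $\mathcal A$, bounded below, let $N(\lambda;\mathcal A)$ be the number of its eigenvalues in $(-\infty,\lambda)$, counted with multiplicities. Then the spectrum of $\mathbf A_V$ is discrete if and only if the spectrum of $\mathcal A_{V,0}$ is discrete. In that case the spectrum of every $\mathcal A_{V,k}$ is discrete, and for every $\lambda\in\mathbb R$ the number $N(\lambda;\mathbf A_V)$ is finite and $$N(\lambda;\mathbf A_V)=N(\lambda;\mathcal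 A_{V,0})+\sum_{k=1}^\infty b_1\cdots b_{k-1}(b_k-1)\,N(\lambda;\mathcal A_{V,k}).$$ -/

import Mathlib

open MeasureTheory Set
open scoped ENNReal ComplexConjugate Topology InnerProductSpace

noncomputable section

/-! ### Unbounded operators, given by their graphs -/

section Operators

variable {H : Type*} [NormedAddCommGroup H] [InnerProductSpace ℂ H]

/-- The resolvent set of the operator `A` with graph `G` (`(u, f) ∈ G` means `A u = f`):
the `z` for which `(A - z)⁻¹` is an everywhere defined bounded operator. -/
def graphResolventSet (G : Submodule ℂ (H × H)) : Set ℂ :=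
  {z | ∃ R : H →L[ℂ] H, ∀ u f : H, (u, f + z • u) ∈ G ↔ u = R f}

/-- The spectrum of the operator with graph `G`. -/
def graphSpectrum (G : Submodule ℂ (H × H)) : Set ℂ := (graphResolventSet G)ᶜ

/-- The eigenspace `ker (A - z)` of the operator `A` with graph `G`. -/
def graphEigenspace (G : Submodule ℂ (H × H)) (z : ℂ) : Submodule ℂ H :=
  G.comap (LinearMap.prod LinearMap.id (z • LinearMap.id))

/-- The spectrum is discrete: it consists of isolated eigenvalues of finite multiplicity. -/
def HasDiscreteSpectrum (G : Submodule ℂ (H × H)) : Prop :=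
  ∀ z ∈ graphSpectrum G,
    (∀ᶠ w in 𝓝[≠] z, w ∉ graphSpectrum G) ∧
      graphEigenspace G z ≠ ⊥ ∧ FiniteDimensional ℂ (graphEigenspace G z)

/-- `N(r; A)`: the number of eigenvalues in `(-∞, r)`, counted with multiplicities. -/
def eigenvalueCount (G : Submodule ℂ (H × H)) (r : ℝ) : ℕ∞ :=
  ∑' s : Iio r, Cardinal.toENat (Module.rank ℂ (graphEigenspace G ((s : ℝ) : ℂ)))

end Operators

/-! ### The operator associated with the form `∫ (|u'|² + q |u|²) dμ` -/

section Forms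

variable {X : Type*} [MeasurableSpace X] {μ : Measure X}

/-- The sesquilinear form `∫ (u' conj v' + q u conj v) dμ`, for `p = (v, v')` and `p' = (u, u')`. -/
def schrodingerForm (q : X → ℝ) (p p' : Lp ℂ 2 μ × Lp ℂ 2 μ) : ℂ :=
  ∫ x, (conj (p.2 x) * p'.2 x + (q x : ℂ) * (conj (p.1 x) * p'.1 x)) ∂μ

/-- `u` lies in the weighted space `L²_q`, that is `∫ |q| |u|² dμ < ∞`. -/
def MemWeightedL2 (q : X → ℝ) (u : Lp ℂ 2 μ) : Prop :=
  Integrable (fun x => q x * ‖u x‖ ^ 2) μ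

lemma MemWeightedL2.mul_integrable {q : X → ℝ} (hq : Measurable q) {u v : Lp ℂ 2 μ}
    (hu : MemWeightedL2 q u) (hv : MemWeightedL2 q v) :
    Integrable (fun x => (q x : ℂ) * (conj (v x) * u x)) μ := by
  refine (hu.norm.add hv.norm).mono' ?_ ?_
  · exact (Complex.measurable_ofReal.comp hq).aestronglyMeasurable.mul
      ((Complex.continuous_conj.comp_aestronglyMeasurable (Lp.aestronglyMeasurable v)).mul
        (Lp.aestronglyMeasurable u))
  · refine Filter.Eventually.of_forall fun x => ?_
    simp only [norm_mul, Complex.norm_real, RCLike.norm_conj, Pi.add_apply, norm_pow,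
      Real.norm_eq_abs, abs_norm]
    nlinarith [mul_nonneg (abs_nonneg (q x)) (sq_nonneg (‖u x‖ - ‖v x‖)),
      mul_nonneg (abs_nonneg (q x)) (mul_nonneg (norm_nonneg (u x)) (norm_nonneg (v x))),
      mul_nonneg (abs_nonneg (q x)) (sq_nonneg (‖u x‖ + ‖v x‖))]

lemma MemWeightedL2.add {q : X → ℝ} (hq : Measurable q) {u v : Lp ℂ 2 μ}
    (hu : MemWeightedL2 q u) (hv : MemWeightedL2 q v) : MemWeightedL2 q (u + v) := by
  refine ((hu.norm.const_mul 2).add (hv.norm.const_mul 2)).mono' ?_ ?_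
  · exact hq.aestronglyMeasurable.mul ((Lp.aestronglyMeasurable (u + v)).norm.pow 2)
  · filter_upwards [Lp.coeFn_add u v] with x hx
    simp only [hx, norm_mul, Pi.add_apply, norm_pow, Real.norm_eq_abs, abs_norm]
    have h1 : ‖u x + v x‖ ^ 2 ≤ 2 * (‖u x‖ ^ 2 + ‖v x‖ ^ 2) := by
      have h2 := norm_add_le (u x) (v x)
      nlinarith [norm_nonneg (u x + v x), sq_nonneg (‖u x‖ - ‖v x‖)]
    nlinarith [mul_le_mul_of_nonneg_left h1 (abs_nonneg (q x))]

lemma MemWeightedL2.smul {q : X → ℝ} (c : ℂ) {u : Lp ℂ 2 μ}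
    (hu : MemWeightedL2 q u) : MemWeightedL2 q (c • u) := by
  refine (hu.const_mul (‖c‖ ^ 2)).congr ?_
  filter_upwards [Lp.coeFn_smul c u] with x hx
  simp only [hx, Pi.smul_apply, norm_smul]
  ring

lemma MemWeightedL2.zero (q : X → ℝ) : MemWeightedL2 q (0 : Lp ℂ 2 μ) := by
  refine (integrable_zero X ℝ μ).congr ?_
  filter_upwards [Lp.coeFn_zero ℂ 2 μ] with x hx
  rw [hx]
  simp

/-- Let `W` be the graph of a derivation `u ↦ u'` in `L²(μ)`. The form domain consists of the
`u ∈ L²_q` in the domain of the derivation; we record `u` together with `u'`. -/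
def formDomain (W : Submodule ℂ (Lp ℂ 2 μ × Lp ℂ 2 μ)) (q : X → ℝ) (hq : Measurable q) :
    Submodule ℂ (Lp ℂ 2 μ × Lp ℂ 2 μ) where
  carrier := {p | p ∈ W ∧ MemWeightedL2 q p.1}
  add_mem' ha hb := ⟨W.add_mem ha.1 hb.1, ha.2.add hq hb.2⟩
  zero_mem' := ⟨W.zero_mem, MemWeightedL2.zero q⟩
  smul_mem' c _ ha := ⟨W.smul_mem c ha.1, ha.2.smul c⟩

lemma schrodingerForm_integrable {q : X → ℝ} (hq : Measurable q)
    {p p' : Lp ℂ 2 μ × Lp ℂ 2 μ} (hp : MemWeightedL2 q p.1) (hp' : MemWeightedL2 q p'.1) :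
    Integrable (fun x =>
      conj (p.2 x) * p'.2 x + (q x : ℂ) * (conj (p.1 x) * p'.1 x)) μ := by
  refine Integrable.add ?_ (hp'.mul_integrable hq hp)
  refine (L2.integrable_inner (𝕜 := ℂ) p.2 p'.2).congr (Filter.Eventually.of_forall fun x => ?_)
  simp [mul_comm]

lemma schrodingerForm_add {q : X → ℝ} (hq : Measurable q)
    {p a b : Lp ℂ 2 μ × Lp ℂ 2 μ} (hp : MemWeightedL2 q p.1) (ha : MemWeightedL2 q a.1)
    (hb : MemWeightedL2 q b.1) :
    schrodingerForm q p (a + b) = schrodingerForm q p a + schrodingerForm q p b := by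
  unfold schrodingerForm
  rw [← integral_add (schrodingerForm_integrable hq hp ha) (schrodingerForm_integrable hq hp hb)]
  refine integral_congr_ae ?_
  filter_upwards [Lp.coeFn_add a.1 b.1, Lp.coeFn_add a.2 b.2] with x h1 h2
  simp only [Prod.fst_add, Prod.snd_add, h1, h2, Pi.add_apply]
  ring

lemma schrodingerForm_smul (q : X → ℝ) (p a : Lp ℂ 2 μ × Lp ℂ 2 μ) (c : ℂ) :
    schrodingerForm q p (c • a) = c * schrodingerForm q p a := by
  unfold schrodingerForm
  rw [← integral_const_mul]
  refine integral_congr_ae ?_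
  filter_upwards [Lp.coeFn_smul c a.1, Lp.coeFn_smul c a.2] with x h1 h2
  simp only [Prod.smul_fst, Prod.smul_snd, h1, h2, Pi.smul_apply, smul_eq_mul]
  ring

/-- (The graph of) the self-adjoint operator `A` in `L²(μ)` associated with the form: `A u = f` iff
`u` is in the form domain and, for all `v` in the form domain, the value of the sesquilinear form at
`u, v` is the `L²`-inner product of `f` and `v`. If the form domain is not dense, this is
the self-adjoint linear relation whose operator part acts in the closure of the form domain; it has
the same resolvent set and the same eigenspaces as that operator part. -/
def formOperator (W : Submodule ℂ (Lp ℂ 2 μ × Lp ℂ 2 μ)) (q : X → ℝ) (hq : Measurable q) :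
    Submodule ℂ (Lp ℂ 2 μ × Lp ℂ 2 μ) where
  carrier := {r | ∃ u', (r.1, u') ∈ formDomain W q hq ∧
    ∀ p ∈ formDomain W q hq, schrodingerForm q p (r.1, u') = ⟪p.1, r.2⟫_ℂ}
  add_mem' := by
    rintro ⟨u, f⟩ ⟨v, g⟩ ⟨u', hu, hf⟩ ⟨v', hv, hg⟩
    refine ⟨u' + v', (formDomain W q hq).add_mem hu hv, fun p hp => ?_⟩
    have := schrodingerForm_add hq hp.2 hu.2 hv.2
    simp only [Prod.mk_add_mk] at this ⊢
    rw [this, hf p hp, hg p hp, inner_add_right]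
  zero_mem' := by
    refine ⟨0, (formDomain W q hq).zero_mem, fun p _ => ?_⟩
    have := schrodingerForm_smul q p 0 0
    rw [zero_smul, zero_mul] at this
    exact this.trans (inner_zero_right _).symm
  smul_mem' := by
    rintro c ⟨u, f⟩ ⟨u', hu, hf⟩
    refine ⟨c • u', (formDomain W q hq).smul_mem c hu, fun p hp => ?_⟩
    have := schrodingerForm_smul q p (u, u') c
    simp only [Prod.smul_mk] at this ⊢
    rw [this, hf p hp, inner_smul_right]

end Forms

/-! ### Absolutely continuous functions on a segment -/

/-- `f` is absolutely continuous on the segment `[a, b]` with derivative `g`. -/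
def IsPrimitiveOn (a b : ℝ) (f g : ℝ → ℂ) : Prop :=
  IntervalIntegrable g volume a b ∧ ∀ t ∈ Icc a b, f t = f a + ∫ s in a..t, g s

lemma IsPrimitiveOn.zero (a b : ℝ) : IsPrimitiveOn a b (fun _ => 0) (fun _ => 0) :=
  ⟨by simp, by simp⟩

lemma IsPrimitiveOn.add {a b : ℝ} {f g f' g' : ℝ → ℂ} (h : IsPrimitiveOn a b f g)
    (h' : IsPrimitiveOn a b f' g') :
    IsPrimitiveOn a b (fun t => f t + f' t) (fun t => g t + g' t) := by
  refine ⟨h.1.add h'.1, fun t ht => ?_⟩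
  have hsub : uIcc a t ⊆ uIcc a b := by
    rw [uIcc_of_le ht.1, uIcc_of_le (ht.1.trans ht.2)]
    exact Icc_subset_Icc_right ht.2
  rw [intervalIntegral.integral_add (h.1.mono_set hsub) (h'.1.mono_set hsub)]
  simp only [h.2 t ht, h'.2 t ht]
  ring

lemma IsPrimitiveOn.smul {a b : ℝ} {f g : ℝ → ℂ} (c : ℂ) (h : IsPrimitiveOn a b f g) :
    IsPrimitiveOn a b (fun t => c * f t) (fun t => c * g t) := by
  refine ⟨h.1.const_mul c, fun t ht => ?_⟩
  rw [intervalIntegral.integral_const_mul]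
  simp only [h.2 t ht]
  ring

/-! ### Rooted metric trees -/

/-- A rooted metric tree, given by the map that sends each vertex `y ≠ root` to the initial vertex
of the only edge `e_y⁻` that terminates at `y`. Every vertex has finite generation. -/
structure RootedMetricTree where
  /-- the vertices -/
  Vertex : Type*
  /-- the root -/
  root : Vertex
  /-- the initial vertex of the edge that terminates at a given vertex -/
  parent : Vertex → Vertex
  parent_root : parent root = root
  exists_iterate_parent : ∀ y, ∃ n : ℕ, parent^[n] y = root
  /-- `length y` is the length of the edge `e_y⁻` (of no meaning for `y = root`) -/
  length : Vertex → ℝ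
  length_pos : ∀ y, y ≠ root → 0 < length y

namespace RootedMetricTree

variable (T : RootedMetricTree)

/-- The generation of a vertex: the number of vertices `x` with `o ≺ x ≼ y`. -/
def gen (y : T.Vertex) : ℕ := sInf {n | T.parent^[n] y = T.root}

/-- The distance `|y|` of a vertex from the root. -/
def height (y : T.Vertex) : ℝ := ∑ i ∈ Finset.range (T.gen y), T.length (T.parent^[i] y)

/-- The branching number of a vertex: the number of edges emanating from it. -/
def branching (y : T.Vertex) : ℕ := {z | z ≠ T.root ∧ T.parent z = y}.ncard

/-- A tree is regular if all vertices of the same generation have equal branching numbers and all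
edges of the same generation (that of the initial vertex) have equal lengths. -/
def IsRegular : Prop :=
  (∀ y z, T.gen y = T.gen z → T.branching y = T.branching z) ∧
  (∀ y z, y ≠ T.root → z ≠ T.root → T.gen (T.parent y) = T.gen (T.parent z) →
    T.length y = T.length z)

instance : MeasurableSpace T.Vertex := ⊤

/-- The measure `dx` on the tree. A point `x` other than the root is given by the pair `(y, |x|)`
where `e_y⁻` is the edge with `x ∈ e_y⁻` and `|parent y| < |x| ≤ |y|`; on each edge, `dx` is the
Lebesgue measure. -/
def measure : Measure (T.Vertex × ℝ) :=
  Measure.sum fun y : {y : T.Vertex // y ≠ T.root} =>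
    (volume.restrict (Ioc (T.height (T.parent y)) (T.height y))).map (Prod.mk (y : T.Vertex))

/-- `F` (with `F y` the restriction to the closed edge `e_y⁻`, as a function of `|x|`) is a
continuous function on the tree that vanishes at the root and is absolutely continuous on each edge,
with derivative `G`. The values at the vertices are `c`. -/
def IsPrimitive (F G : T.Vertex → ℝ → ℂ) : Prop :=
  (∃ c : T.Vertex → ℂ, c T.root = 0 ∧ ∀ y, y ≠ T.root →
    F y (T.height (T.parent y)) = c (T.parent y) ∧ F y (T.height y) = c y) ∧
  ∀ y, y ≠ T.root → IsPrimitiveOn (T.height (T.parent y)) (T.height y) (F y) (G y)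

/-- The pairs `(f, f')` with `f` in the Sobolev space `H^{1,0}` of the tree: `f` is continuous,
`f(o) = 0`, the restriction of `f` to each edge is in `H¹`, and `f, f' ∈ L²`. -/
def sobolev : Submodule ℂ (Lp ℂ 2 T.measure × Lp ℂ 2 T.measure) where
  carrier := {p | ∃ F G : T.Vertex → ℝ → ℂ, T.IsPrimitive F G ∧
    (∀ᵐ x ∂T.measure, p.1 x = F x.1 x.2) ∧ ∀ᵐ x ∂T.measure, p.2 x = G x.1 x.2}
  add_mem' := by
    rintro p q ⟨F, G, ⟨⟨c, hc0, hc⟩, h⟩, hF, hG⟩ ⟨F', G', ⟨⟨c', hc0', hc'⟩, h'⟩, hF', hG'⟩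
    refine ⟨fun y t => F y t + F' y t, fun y t => G y t + G' y t,
      ⟨⟨fun y => c y + c' y, by simp [hc0, hc0'], fun y hy => ?_⟩,
        fun y hy => (h y hy).add (h' y hy)⟩, ?_, ?_⟩
    · simp only [(hc y hy).1, (hc y hy).2, (hc' y hy).1, (hc' y hy).2, and_self]
    · filter_upwards [hF, hF', Lp.coeFn_add p.1 q.1] with x h1 h2 h3
      exact h3.trans (by rw [Pi.add_apply, h1, h2])
    · filter_upwards [hG, hG', Lp.coeFn_add p.2 q.2] with x h1 h2 h3
      exact h3.trans (by rw [Pi.add_apply, h1, h2])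
  zero_mem' := by
    refine ⟨fun _ _ => 0, fun _ _ => 0, ⟨⟨fun _ => 0, rfl, by simp⟩,
      fun y _ => IsPrimitiveOn.zero _ _⟩, ?_, ?_⟩ <;>
    · filter_upwards [Lp.coeFn_zero ℂ 2 T.measure] with x hx
      exact hx
  smul_mem' := by
    rintro a p ⟨F, G, ⟨⟨c, hc0, hc⟩, h⟩, hF, hG⟩
    refine ⟨fun y t => a * F y t, fun y t => a * G y t,
      ⟨⟨fun y => a * c y, by simp [hc0], fun y hy => ?_⟩, fun y hy => (h y hy).smul a⟩, ?_, ?_⟩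
    · simp only [(hc y hy).1, (hc y hy).2, and_self]
    · filter_upwards [hF, Lp.coeFn_smul a p.1] with x h1 h3
      exact h3.trans (by rw [Pi.smul_apply, h1, smul_eq_mul])
    · filter_upwards [hG, Lp.coeFn_smul a p.2] with x h1 h3
      exact h3.trans (by rw [Pi.smul_apply, h1, smul_eq_mul])

/-- The Schrödinger operator `A_V = -Δ + V(|x|)` on the tree, defined by the form
`∫ (|f'|² + V(|x|) |f|²) dx` on `H^{1,0} ∩ L²_V`. -/
def schrodinger (V : ℝ → ℝ) (hV : Measurable V) :
    Submodule ℂ (Lp ℂ 2 T.measure × Lp ℂ 2 T.measure) :=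
  formOperator T.sobolev (fun x => V x.2) (hV.comp measurable_snd)

end RootedMetricTree

/-! ### The operators on the half-open intervals `[t_k, R)`, `R = lim t_n` -/

namespace RegularTree

variable (b : ℕ → ℕ) (t : ℕ → ℝ) (k : ℕ)

/-- The branching function: `g_k(s) = b_{k+1} ⋯ b_n` for `t_n < s ≤ t_{n+1}`, `n ≥ k` (so it is `1`
for `n = k`), and `g_k = 0` outside `(t_k, R)`. -/
def branchingFunction (s : ℝ) : ℝ≥0∞ :=
  ∑' n : ℕ, (Ioc (t (k + n)) (t (k + n + 1))).indicator
    (fun _ => ∏ j ∈ Finset.Ioc k (k + n), (b j : ℝ≥0∞)) s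

/-- The measure `g_k(s) ds` on `(t_k, R)`. -/
def weightedMeasure : Measure ℝ := volume.withDensity (branchingFunction b t k)

/-- The pairs `(u, u')` such that `u` is locally absolutely continuous on `[t_k, R)`,
`u(t_k) = 0`, and `u, u' ∈ L²((t_k, R), g_k)`. -/
def sobolev : Submodule ℂ
    (Lp ℂ 2 (weightedMeasure b t k) × Lp ℂ 2 (weightedMeasure b t k)) where
  carrier := {p | ∃ F G : ℝ → ℂ, F (t k) = 0 ∧ (∀ n, k ≤ n → IsPrimitiveOn (t k) (t n) F G) ∧
    (∀ᵐ s ∂weightedMeasure b t k, p.1 s = F s) ∧ ∀ᵐ s ∂weightedMeasure b t k, p.2 s = G s}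
  add_mem' := by
    rintro p q ⟨F, G, h0, h, hF, hG⟩ ⟨F', G', h0', h', hF', hG'⟩
    refine ⟨fun s => F s + F' s, fun s => G s + G' s, by simp [h0, h0'],
      fun n hn => (h n hn).add (h' n hn), ?_, ?_⟩
    · filter_upwards [hF, hF', Lp.coeFn_add p.1 q.1] with x h1 h2 h3
      exact h3.trans (by rw [Pi.add_apply, h1, h2])
    · filter_upwards [hG, hG', Lp.coeFn_add p.2 q.2] with x h1 h2 h3
      exact h3.trans (by rw [Pi.add_apply, h1, h2])
  zero_mem' := by
    refine ⟨fun _ => 0, fun _ => 0, rfl, fun n _ => IsPrimitiveOn.zero _ _, ?_, ?_⟩ <;>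
    · filter_upwards [Lp.coeFn_zero ℂ 2 (weightedMeasure b t k)] with x hx
      exact hx
  smul_mem' := by
    rintro a p ⟨F, G, h0, h, hF, hG⟩
    refine ⟨fun s => a * F s, fun s => a * G s, by simp [h0], fun n hn => (h n hn).smul a, ?_, ?_⟩
    · filter_upwards [hF, Lp.coeFn_smul a p.1] with x h1 h3
      exact h3.trans (by rw [Pi.smul_apply, h1, smul_eq_mul])
    · filter_upwards [hG, Lp.coeFn_smul a p.2] with x h1 h3
      exact h3.trans (by rw [Pi.smul_apply, h1, smul_eq_mul])

/-- The operator `A_{V,k}` in `L²((t_k, R), g_k)`, defined by the form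
`∫ (|u'|² + V |u|²) g_k ds` on the functions `u` with `u(t_k) = 0`. -/
def schrodinger (V : ℝ → ℝ) (hV : Measurable V) :
    Submodule ℂ (Lp ℂ 2 (weightedMeasure b t k) × Lp ℂ 2 (weightedMeasure b t k)) :=
  formOperator (sobolev b t k) V hV

end RegularTree

end

/-!
Up to a shift, a Schrödinger operator is the inverse of `J ∘ J†`, where `J` embeds its form domain
into `L²`; so its spectrum is discrete if and only if `J` is compact, and its eigenvalues are then
counted by the eigenspaces of `J ∘ J†`.

Take a vertex `y` of generation `k` and numbers with sum zero on the edges emanating from `y`, any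
numbers if `y` is the root. Multiplying a radial function on `(t_k, R)` by these numbers, one on
each branch at `y`, and by a constant that makes it isometric embeds `L²((t_k, R), g_k)` in `L²(Γ)`
and is compatible with the forms. An orthonormal choice of the numbers, together with the radial
functions, exhausts `L²(Γ)`: a function on one level of the tree that is orthogonal to all zero sum
systems takes equal values on siblings, and so comes from the previous level. Hence the form on `Γ`
is the orthogonal sum of the forms on `(t_k, R)`, each with the multiplicity in the formula.

If `J` is compact then so is its restriction `J_0` to the form domain on `(t_0, R)`. For the
converse, extension by zero, rescaled, maps the form domain on `(t_k, R)` isometrically into that on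
`(t_0, R)` and intertwines `J_k` with `J_0`. So every `J_k` is compact, and `‖J_k‖ → 0` because the
adjoints of these extensions tend to zero strongly. An orthogonal sum of compact operators whose
norms tend to zero is compact.
-/

noncomputable section

/-! ### Compact operators -/

section Compact

variable {𝕜 E F F' : Type*} [RCLike 𝕜] [NormedAddCommGroup E] [NormedSpace 𝕜 E]
  [NormedAddCommGroup F] [NormedSpace 𝕜 F] [NormedAddCommGroup F'] [NormedSpace 𝕜 F']

lemma exists_norm_map_sub_map_lt_of_isCompactOperator {S : E →L[𝕜] F} (hS : IsCompactOperator S)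
    {x : ℕ → E} {C ε : ℝ} (hx : ∀ n, ‖x n‖ ≤ C) (hε : 0 < ε) :
    ∃ i j, i ≠ j ∧ ‖S (x i) - S (x j)‖ < ε := by
  obtain ⟨K, hK, hSK⟩ :=
    IsCompactOperator.image_closedBall_subset_compact (f := (S : E →ₗ[𝕜] F)) hS C
  obtain ⟨y, -, ψ, hψ, hy⟩ := hK.tendsto_subseq (x := fun n => S (x n))
    fun n => hSK ⟨x n, mem_closedBall_zero_iff.2 (hx n), rfl⟩
  obtain ⟨N, hN⟩ := Metric.cauchySeq_iff'.1 hy.cauchySeq ε hε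
  refine ⟨ψ (N + 1), ψ N, hψ.injective.ne N.succ_ne_self, ?_⟩
  simpa only [dist_eq_norm, Function.comp_apply] using hN (N + 1) N.le_succ

lemma isCompactOperator_of_norm_sq_le [CompleteSpace F'] {S : E →L[𝕜] F} {T : E →L[𝕜] F'}
    (hS : IsCompactOperator S) (h : ∀ x, ‖T x‖ ^ 2 ≤ ‖S x‖ * ‖x‖) : IsCompactOperator T := by
  refine (isCompactOperator_iff_isCompact_closure_image_closedBall (T : E →ₗ[𝕜] F')
    one_pos).2 (TotallyBounded.isCompact_of_isClosed (TotallyBounded.closure ?_) isClosed_closure)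
  have hS1 : TotallyBounded (S '' Metric.closedBall 0 1) :=
    (IsCompactOperator.isCompact_closure_image_closedBall (f := (S : E →ₗ[𝕜] F)) hS
      1).totallyBounded.subset subset_closure
  refine Metric.totallyBounded_iff.2 fun ε hε => ?_
  obtain ⟨t, htS, ht, hcover⟩ :=
    Metric.finite_approx_of_totallyBounded hS1 (ε ^ 2 / 2) (by positivity)
  choose! g hg using show ∀ y ∈ t, ∃ x ∈ Metric.closedBall (0 : E) 1, S x = y from fun y => @htS y
  refine ⟨(fun y => T (g y)) '' t, ht.image _, ?_⟩
  rintro _ ⟨x, hx, rfl⟩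
  obtain ⟨y, hy, hxy⟩ := mem_iUnion₂.1 (hcover ⟨x, hx, rfl⟩)
  refine mem_iUnion₂.2 ⟨_, ⟨y, hy, rfl⟩, ?_⟩
  rw [Metric.mem_ball, dist_eq_norm] at hxy ⊢
  have hgy := (hg y hy).1
  rw [mem_closedBall_zero_iff] at hgy hx
  have hdiam : ‖x - g y‖ ≤ 2 := by linarith [norm_sub_le x (g y)]
  have hsq := h (x - g y)
  rw [map_sub, map_sub, (hg y hy).2] at hsq
  have hlt : ‖T x - T (g y)‖ ^ 2 < ε ^ 2 := by
    nlinarith [norm_nonneg (S x - y), norm_nonneg (x - g y)]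
  exact lt_of_pow_lt_pow_left₀ 2 hε.le hlt

lemma isCompactOperator_of_forall_mem {T : E →L[𝕜] F} (V : Submodule 𝕜 F) [FiniteDimensional 𝕜 V]
    (h : ∀ x, T x ∈ V) : IsCompactOperator T :=
  have : ProperSpace V := FiniteDimensional.proper 𝕜 V
  IsCompactOperator.clm_comp (f := T.codRestrict V h)
    (isCompactOperator_of_locallyCompactSpace_dom _) V.subtypeL

lemma isCompactOperator_finsetSum {ι : Type*} (s : Finset ι) {T : ι → E →L[𝕜] F}
    (h : ∀ i ∈ s, IsCompactOperator (T i)) : IsCompactOperator (∑ i ∈ s, T i : E →L[𝕜] F) :=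
  (compactOperator (RingHom.id 𝕜) E F).sum_mem h

lemma isCompactOperator_of_forall_norm_sub_le [CompleteSpace F] {T : E →L[𝕜] F}
    (h : ∀ ε > 0, ∃ S : E →L[𝕜] F, IsCompactOperator S ∧ ‖T - S‖ ≤ ε) : IsCompactOperator T := by
  suffices T ∈ closure {S : E →L[𝕜] F | IsCompactOperator S} by
    rwa [(isClosed_setOfPred_isCompactOperator (σ₁₂ := RingHom.id 𝕜)).closure_eq] at this
  refine Metric.mem_closure_iff.2 fun ε hε => ?_
  obtain ⟨S, hS, hTS⟩ := h (ε / 2) (by positivity)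
  exact ⟨S, hS, by rw [dist_eq_norm]; linarith⟩

lemma tendsto_norm_comp_of_isCompactOperator {ι : Type*} {l : Filter ι} {G : ι → Type*}
    [∀ i, NormedAddCommGroup (G i)] [∀ i, NormedSpace 𝕜 (G i)] {S : ∀ i, F →L[𝕜] G i} {C : ℝ}
    (hC : ∀ i, ‖S i‖ ≤ C) (hS : ∀ y, Filter.Tendsto (fun i => ‖S i y‖) l (𝓝 0)) {T : E →L[𝕜] F}
    (hT : IsCompactOperator T) : Filter.Tendsto (fun i => ‖S i ∘L T‖) l (𝓝 0) := by
  refine Metric.tendsto_nhds.2 fun ε hε => ?_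
  have htb : TotallyBounded (T '' Metric.closedBall 0 1) :=
    (IsCompactOperator.isCompact_closure_image_closedBall (f := (T : E →ₗ[𝕜] F)) hT
      1).totallyBounded.subset subset_closure
  obtain ⟨t, ht, hcover⟩ := Metric.totallyBounded_iff.1 htb (ε / (4 * (|C| + 1))) (by positivity)
  have hnet : ∀ᶠ i in l, ∀ y ∈ t, ‖S i y‖ < ε / 4 :=
    (Filter.eventually_all_finite ht).2 fun y _ => (hS y).eventually_lt_const (by positivity)
  filter_upwards [hnet] with i hi
  rw [Real.dist_eq, sub_zero, abs_norm]
  refine lt_of_le_of_lt (b := ε / 2) ?_ (by linarith)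
  refine ContinuousLinearMap.opNorm_le_of_unit_norm (by positivity) fun x hx => ?_
  obtain ⟨y, hy, hxy⟩ := mem_iUnion₂.1 (hcover ⟨x, by simp [hx], rfl⟩)
  rw [Metric.mem_ball, dist_eq_norm] at hxy
  have hsub : ‖S i (T x - y)‖ ≤ ε / 4 := calc
    ‖S i (T x - y)‖ ≤ (|C| + 1) * ‖T x - y‖ :=
      (S i).le_of_opNorm_le (by linarith [hC i, le_abs_self C]) _
    _ ≤ (|C| + 1) * (ε / (4 * (|C| + 1))) := by gcongr
    _ = ε / 4 := by field_simp
  have hsplit : (S i ∘L T) x = S i (T x - y) + S i y := by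
    rw [map_sub, sub_add_cancel, ContinuousLinearMap.comp_apply]
  rw [hsplit]
  linarith [norm_add_le (S i (T x - y)) (S i y), hi y hy]

variable {H K : Type*} [NormedAddCommGroup H] [InnerProductSpace 𝕜 H]
  [NormedAddCommGroup K] [InnerProductSpace 𝕜 K]

lemma isCompactOperator_of_adjoint_comp [CompleteSpace H] [CompleteSpace K] {J : K →L[𝕜] H}
    (h : IsCompactOperator (J.adjoint ∘L J)) : IsCompactOperator J := by
  refine isCompactOperator_of_norm_sq_le h fun x => ?_
  calc ‖J x‖ ^ 2 = RCLike.re (inner 𝕜 ((J.adjoint ∘L J) x) x) :=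
        J.apply_norm_sq_eq_inner_adjoint_left x
    _ ≤ ‖(J.adjoint ∘L J) x‖ * ‖x‖ := re_inner_le_norm _ _

lemma isCompactOperator_comp_adjoint_iff [CompleteSpace H] [CompleteSpace K] (J : K →L[𝕜] H) :
    IsCompactOperator (J ∘L J.adjoint) ↔ IsCompactOperator J := by
  refine ⟨fun h => isCompactOperator_of_adjoint_comp ?_, fun h => h.comp_clm _⟩
  have hadj : IsCompactOperator J.adjoint :=
    isCompactOperator_of_adjoint_comp (by rwa [ContinuousLinearMap.adjoint_adjoint])
  exact hadj.comp_clm J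

lemma finite_setOf_hasEigenvalue_of_isCompactOperator {B : H →L[𝕜] H} (hB : IsCompactOperator B)
    (hsymm : (B : H →ₗ[𝕜] H).IsSymmetric) {ε : ℝ} (hε : 0 < ε) :
    {μ : 𝕜 | ε ≤ ‖μ‖ ∧ Module.End.HasEigenvalue (B : Module.End 𝕜 H) μ}.Finite := by
  by_contra hinf
  let μ := Set.Infinite.natEmbedding _ hinf
  choose u hu using fun n => (μ n).2.2.exists_hasEigenvector
  let e : ℕ → H := fun n => ((‖u n‖⁻¹ : ℝ) : 𝕜) • u n
  have he : ∀ n, e n ∈ Module.End.eigenspace (B : Module.End 𝕜 H) (μ n) := fun n =>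
    Submodule.smul_mem _ _ (hu n).1
  have he1 : ∀ n, ‖e n‖ = 1 := fun n => by
    rw [norm_smul, RCLike.norm_ofReal, abs_inv, abs_norm,
      inv_mul_cancel₀ (norm_ne_zero_iff.2 (hu n).2)]
  have hμ : ∀ n, (μ n : 𝕜) ≠ 0 := fun n => norm_pos_iff.1 (hε.trans_le (μ n).2.1)
  have hBe : ∀ n, B ((μ n : 𝕜)⁻¹ • e n) = e n := fun n => by
    rw [map_smul, show B (e n) = (μ n : 𝕜) • e n from Module.End.mem_eigenspace_iff.1 (he n),
      inv_smul_smul₀ (hμ n)]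
  obtain ⟨i, j, hij, hlt⟩ := exists_norm_map_sub_map_lt_of_isCompactOperator hB
    (x := fun n => (μ n : 𝕜)⁻¹ • e n) (C := ε⁻¹) (fun n => by
      rw [norm_smul, he1, mul_one, norm_inv]
      exact inv_anti₀ hε (μ n).2.1) one_pos
  have hne : (μ i : 𝕜) ≠ μ j := fun h => hij (μ.injective (Subtype.ext h))
  have horth : inner 𝕜 (e i) (e j) = 0 :=
    hsymm.orthogonalFamily_eigenspaces hne ⟨e i, he i⟩ ⟨e j, he j⟩
  have hsq : ‖e i - e j‖ ^ 2 = 2 := by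
    rw [@norm_sub_sq 𝕜, horth, he1, he1, map_zero]
    norm_num
  rw [hBe, hBe] at hlt
  nlinarith [norm_nonneg (e i - e j)]

end Compact

/-! ### Operators with a self-adjoint resolvent -/

section Resolvent

variable {H : Type*} [NormedAddCommGroup H] [InnerProductSpace ℂ H]

/-- `B` is the resolvent `(A + m)⁻¹` of the operator `A` with graph `G`. For a linear relation `G`
the operator `B` need not be injective. -/
def IsResolventAt (B : H →L[ℂ] H) (m : ℝ) (G : Submodule ℂ (H × H)) : Prop :=
  ∀ u g, (u, g) ∈ G ↔ u = B (g + (m : ℂ) • u)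

namespace IsResolventAt

variable {B : H →L[ℂ] H} {m : ℝ} {G : Submodule ℂ (H × H)}

lemma mem_iff (h : IsResolventAt B m G) (z : ℂ) (u f : H) :
    (u, f + z • u) ∈ G ↔ (1 - (z + m) • B) u = B f := by
  have hshift : f + z • u + (m : ℂ) • u = f + (z + m) • u := by module
  rw [h, hshift, map_add, map_smul, sub_apply, one_apply_eq_self, smul_apply, sub_eq_iff_eq_add]

lemma mem_graphResolventSet_iff (h : IsResolventAt B m G) (z : ℂ) :
    z ∈ graphResolventSet G ↔ IsUnit (1 - (z + m) • B) := by
  constructor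
  · rintro ⟨R, hR⟩
    have hBR : ∀ f, (1 - (z + m) • B) (R f) = B f := fun f => (h.mem_iff _ _ _).1 ((hR _ _).2 rfl)
    have hinj : ∀ u, (1 - (z + m) • B) u = 0 → u = 0 := fun u hu => by
      simpa only [map_zero] using (hR u 0).1 ((h.mem_iff _ _ _).2 (by rw [hu, map_zero]))
    have hright : (1 - (z + m) • B) * (1 + (z + m) • R) = 1 := by
      ext u
      simp only [mul_apply_eq_comp, add_apply, map_add, smul_apply, map_smul, hBR,
        one_apply_eq_self, sub_apply, sub_add_cancel]
    have hleft : (1 + (z + m) • R) * (1 - (z + m) • B) = 1 := by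
      ext u
      rw [← sub_eq_zero, one_apply_eq_self]
      apply hinj
      rw [map_sub, ← mul_apply_eq_comp, ← mul_assoc, hright, one_mul, sub_self]
    exact ⟨⟨_, _, hright, hleft⟩, rfl⟩
  · rintro ⟨S, hS⟩
    refine ⟨(↑S⁻¹ : H →L[ℂ] H) * B, fun u f => ?_⟩
    rw [h.mem_iff, ← hS]
    constructor
    · intro hu
      rw [mul_apply_eq_comp, ← hu, ← mul_apply_eq_comp, S.inv_mul, one_apply_eq_self]
    · rintro rfl
      rw [← mul_apply_eq_comp, ← mul_assoc, S.mul_inv, one_mul]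

lemma mem_graphEigenspace_iff (h : IsResolventAt B m G) {z : ℂ} {u : H} :
    u ∈ graphEigenspace G z ↔ u = (z + m) • B u := by
  have hmem : u ∈ graphEigenspace G z ↔ (u, z • u) ∈ G := Iff.rfl
  rw [hmem, h, ← add_smul, map_smul]

lemma add_ne_zero (h : IsResolventAt B m G) {z : ℂ} (hz : z ∈ graphSpectrum G) : z + m ≠ 0 :=
  fun h0 => hz <| (h.mem_graphResolventSet_iff z).2 <| by
    rw [h0, zero_smul, sub_zero]
    exact isUnit_one

lemma mem_graphSpectrum_iff (h : IsResolventAt B m G) {z : ℂ} (hz : z + m ≠ 0) :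
    z ∈ graphSpectrum G ↔ (z + m)⁻¹ ∈ spectrum ℂ B := by
  have hscale : algebraMap ℂ (H →L[ℂ] H) (z + m)⁻¹ - B
      = (Units.mk0 _ hz)⁻¹ • (1 - (z + m) • B) := by
    ext u
    simp [Algebra.algebraMap_eq_smul_one, Units.smul_def, smul_sub, smul_smul, hz]
  rw [spectrum.mem_iff, hscale, graphSpectrum, mem_compl_iff, h.mem_graphResolventSet_iff,
    isUnit_smul_iff]

lemma graphEigenspace_eq (h : IsResolventAt B m G) {z : ℂ} (hz : z + m ≠ 0) :
    graphEigenspace G z = Module.End.eigenspace (B : Module.End ℂ H) (z + m)⁻¹ := by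
  ext u
  rw [h.mem_graphEigenspace_iff, Module.End.mem_eigenspace_iff, ContinuousLinearMap.coe_coe,
    eq_inv_smul_iff₀ hz, eq_comm]

lemma graphEigenspace_eq_bot (h : IsResolventAt B m G) {z : ℂ} (hz : z + m = 0) :
    graphEigenspace G z = ⊥ := by
  refine (Submodule.eq_bot_iff _).2 fun u hu => ?_
  rwa [h.mem_graphEigenspace_iff, hz, zero_smul] at hu

lemma finiteDimensional_graphEigenspace [CompleteSpace H] (h : IsResolventAt B m G)
    (hB : IsCompactOperator B) (z : ℂ) : FiniteDimensional ℂ (graphEigenspace G z) := by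
  by_cases hz : z + m = 0
  · rw [h.graphEigenspace_eq_bot hz]
    infer_instance
  · rw [h.graphEigenspace_eq hz]
    exact ContinuousLinearMap.finite_dimensional_eigenspace hB _ (inv_ne_zero hz)

lemma finite_setOf_graphEigenspace_ne_bot (h : IsResolventAt B m G)
    (hB : IsCompactOperator B) (hsymm : (B : H →ₗ[ℂ] H).IsSymmetric) (C : ℝ) :
    {z : ℂ | ‖z‖ ≤ C ∧ graphEigenspace G z ≠ ⊥}.Finite := by
  have hsub : {z : ℂ | ‖z‖ ≤ C ∧ graphEigenspace G z ≠ ⊥} ⊆ (fun z : ℂ => (z + m)⁻¹) ⁻¹'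
      {μ | (|C| + |m| + 1)⁻¹ ≤ ‖μ‖ ∧ Module.End.HasEigenvalue (B : Module.End ℂ H) μ} := by
    rintro z ⟨hzC, hz⟩
    have hz0 : z + m ≠ 0 := fun h0 => hz (h.graphEigenspace_eq_bot h0)
    refine ⟨?_, by rwa [h.graphEigenspace_eq hz0] at hz⟩
    rw [norm_inv]
    refine inv_anti₀ (norm_pos_iff.2 hz0) ((norm_add_le _ _).trans ?_)
    rw [Complex.norm_real, Real.norm_eq_abs]
    linarith [le_abs_self C]
  refine ((finite_setOf_hasEigenvalue_of_isCompactOperator hB hsymm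
    (by positivity)).preimage ?_).subset hsub
  exact fun z _ w _ hzw => add_right_cancel (inv_injective hzw)

lemma graphEigenspace_ne_bot [CompleteSpace H] (h : IsResolventAt B m G)
    (hB : IsCompactOperator B) {z : ℂ} (hz : z ∈ graphSpectrum G) : graphEigenspace G z ≠ ⊥ := by
  have hz0 := h.add_ne_zero hz
  rw [h.mem_graphSpectrum_iff hz0, ← hB.hasEigenvalue_iff_mem_spectrum (inv_ne_zero hz0)] at hz
  rwa [h.graphEigenspace_eq hz0]

lemma hasDiscreteSpectrum [CompleteSpace H] (h : IsResolventAt B m G)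
    (hB : IsCompactOperator B) (hsymm : (B : H →ₗ[ℂ] H).IsSymmetric) :
    HasDiscreteSpectrum G := by
  intro z hz
  refine ⟨?_, h.graphEigenspace_ne_bot hB hz, h.finiteDimensional_graphEigenspace hB z⟩
  have hfin := h.finite_setOf_graphEigenspace_ne_bot hB hsymm (‖z‖ + 1)
  have hball : ∀ᶠ w in 𝓝 z, ‖w‖ < ‖z‖ + 1 :=
    continuous_norm.continuousAt.eventually_lt continuousAt_const (by simp)
  rw [eventually_nhdsWithin_iff]
  filter_upwards [(hfin.sdiff (t := {z})).isClosed.isOpen_compl.mem_nhds (by simp), hball]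
    with w hw hwball hwz hwspec
  exact hw ⟨⟨hwball.le, h.graphEigenspace_ne_bot hB hwspec⟩, hwz⟩

end IsResolventAt

end Resolvent

section SpectralProjection

variable {H : Type*} [NormedAddCommGroup H] [InnerProductSpace ℂ H] [CompleteSpace H]
  {B : H →L[ℂ] H}

/-- The spectral projection of the self-adjoint operator `B` onto the point `x`. It is given by the
continuous functional calculus, so it has this meaning only if `x` is not an accumulation point of
the spectrum. -/
def spectralProjection (B : H →L[ℂ] H) (x : ℝ) : H →L[ℂ] H := cfc (Pi.single x (1 : ℝ)) B

lemma continuousOn_piSingle_one {s : Set ℝ} {x : ℝ} (hx : ∀ᶠ y in 𝓝[≠] x, y ∉ s) :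
    ContinuousOn (Pi.single x (1 : ℝ) : ℝ → ℝ) s := by
  intro y _
  by_cases hyx : y = x
  · subst hyx
    have hconst : ∀ᶠ w in 𝓝[s] y, (Pi.single y (1 : ℝ) : ℝ → ℝ) w = 1 := by
      rw [eventually_nhdsWithin_iff] at hx ⊢
      filter_upwards [hx] with w hw hws
      by_cases hwy : w = y
      · rw [hwy, Pi.single_eq_same]
      · exact absurd hws (hw hwy)
    rw [ContinuousWithinAt, Pi.single_eq_same]
    exact Filter.Tendsto.congr' (hconst.mono fun _ => Eq.symm) tendsto_const_nhds
  · refine ((continuousAt_const (y := (0 : ℝ))).congr ?_).continuousWithinAt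
    filter_upwards [isOpen_ne.mem_nhds hyx] with w hw
    rw [Pi.single_eq_of_ne hw]

lemma spectralProjection_mem_eigenspace (hB : IsSelfAdjoint B) {x : ℝ}
    (hx : ∀ᶠ y in 𝓝[≠] x, y ∉ spectrum ℝ B) (u : H) :
    spectralProjection B x u ∈ Module.End.eigenspace (B : Module.End ℂ H) (x : ℂ) := by
  have hcont := continuousOn_piSingle_one hx
  have hmul : B * spectralProjection B x = x • spectralProjection B x := by
    rw [spectralProjection]
    conv_lhs => enter [1]; rw [← cfc_id' ℝ B]
    rw [← cfc_mul (fun y : ℝ => y) _ B continuousOn_id hcont, ← cfc_smul x _ B hcont]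
    congr 1
    ext y
    by_cases h : y = x
    · rw [h, Pi.single_eq_same, smul_eq_mul]
    · rw [Pi.single_eq_of_ne h, smul_zero, mul_zero]
  rw [Module.End.mem_eigenspace_iff]
  simpa using congrArg (fun S : H →L[ℂ] H => S u) hmul

lemma sum_smul_spectralProjection {s : Finset ℝ}
    (hs : ∀ x ∈ s, ∀ᶠ y in 𝓝[≠] x, y ∉ spectrum ℝ B) :
    ContinuousOn (fun y => if y ∈ s then y else 0) (spectrum ℝ B) ∧
      ∑ x ∈ s, x • spectralProjection B x = cfc (fun y : ℝ => if y ∈ s then y else 0) B := by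
  have hcont : ∀ x ∈ s, ContinuousOn (x • (Pi.single x (1 : ℝ) : ℝ → ℝ)) (spectrum ℝ B) :=
    fun x hx => (continuousOn_piSingle_one (hs x hx)).const_smul x
  have hsum : ∑ x ∈ s, x • (Pi.single x (1 : ℝ) : ℝ → ℝ) = fun y => if y ∈ s then y else 0 := by
    ext y
    simp [Pi.single_apply]
  rw [← hsum, cfc_sum _ B s hcont]
  refine ⟨?_, Finset.sum_congr rfl fun x hx => ?_⟩
  · rw [Finset.sum_fn]
    exact continuousOn_finsetSum s hcont
  · rw [spectralProjection, ← cfc_smul x _ B (continuousOn_piSingle_one (hs x hx))]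
    rfl

lemma finite_setOf_le_abs_of_isolated {s : Set ℝ} (hs : IsCompact s)
    (hiso : ∀ x ∈ s, x ≠ 0 → ∀ᶠ y in 𝓝[≠] x, y ∉ s) {ε : ℝ} (hε : 0 < ε) :
    {x ∈ s | ε ≤ |x|}.Finite := by
  by_contra hinf
  obtain ⟨x, ⟨hxs, hxε⟩, hacc⟩ := Set.Infinite.exists_accPt_of_subset_isCompact hinf
    (hs.inter_right (isClosed_le continuous_const continuous_abs)) subset_rfl
  rw [accPt_iff_frequently_nhdsNE] at hacc
  exact hacc ((hiso x hxs (abs_pos.1 (hε.trans_le hxε))).mono fun y hy hy' => hy hy'.1)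

/-- `B` is approximated by its truncations `∑ x • spectralProjection B x` over `ε ≤ |x|`, which have
finite rank. -/
lemma isCompactOperator_of_isolated_of_finiteDimensional (hB : IsSelfAdjoint B)
    (hiso : ∀ x ∈ spectrum ℝ B, x ≠ 0 → ∀ᶠ y in 𝓝[≠] x, y ∉ spectrum ℝ B)
    (hfin : ∀ x ∈ spectrum ℝ B, x ≠ 0 →
      FiniteDimensional ℂ (Module.End.eigenspace (B : Module.End ℂ H) (x : ℂ))) :
    IsCompactOperator B := by
  refine isCompactOperator_of_forall_norm_sub_le fun ε hε => ?_
  have hlarge := finite_setOf_le_abs_of_isolated (spectrum.isCompact B) hiso hε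
  let s := hlarge.toFinset
  have hs : ∀ x ∈ s, x ∈ spectrum ℝ B ∧ x ≠ 0 := fun x hx =>
    have hx := hlarge.mem_toFinset.1 hx
    ⟨hx.1, abs_pos.1 (hε.trans_le hx.2)⟩
  have hisos : ∀ x ∈ s, ∀ᶠ y in 𝓝[≠] x, y ∉ spectrum ℝ B := fun x hx =>
    hiso x (hs x hx).1 (hs x hx).2
  refine ⟨∑ x ∈ s, x • spectralProjection B x, isCompactOperator_finsetSum s fun x hx => ?_, ?_⟩
  · have := hfin x (hs x hx).1 (hs x hx).2
    exact (isCompactOperator_of_forall_mem _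
      (spectralProjection_mem_eigenspace hB (hisos x hx))).smul x
  · obtain ⟨hcont, hsum⟩ := sum_smul_spectralProjection hisos
    rw [hsum]
    conv_lhs => enter [1, 1]; rw [← cfc_id' ℝ B]
    rw [← cfc_sub (fun y : ℝ => y) _ B continuousOn_id hcont]
    refine norm_cfc_le hε.le fun y hy => ?_
    split_ifs with hys
    · rw [sub_self, norm_zero]
      exact hε.le
    · rw [sub_zero, Real.norm_eq_abs]
      by_contra! hlt
      exact hys (hlarge.mem_toFinset.2 ⟨hy, hlt.le⟩)

end SpectralProjection

section Resolvent

variable {H : Type*} [NormedAddCommGroup H] [InnerProductSpace ℂ H] {B : H →L[ℂ] H} {m : ℝ}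
  {G : Submodule ℂ (H × H)}

namespace IsResolventAt

lemma mem_spectrum_real_iff (h : IsResolventAt B m G) {x : ℝ} (hx : x ≠ 0) :
    x ∈ spectrum ℝ B ↔ ((x⁻¹ - m : ℝ) : ℂ) ∈ graphSpectrum G := by
  have hshift : ((x⁻¹ - m : ℝ) : ℂ) + m = (x : ℂ)⁻¹ := by push_cast; ring
  rw [h.mem_graphSpectrum_iff (by rw [hshift]; exact_mod_cast inv_ne_zero hx), hshift, inv_inv,
    ← spectrum.preimage_algebraMap (R := ℝ) ℂ]
  rfl

lemma eigenspace_eq (h : IsResolventAt B m G) {x : ℝ} (hx : x ≠ 0) :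
    Module.End.eigenspace (B : Module.End ℂ H) (x : ℂ)
      = graphEigenspace G ((x⁻¹ - m : ℝ) : ℂ) := by
  have hshift : ((x⁻¹ - m : ℝ) : ℂ) + m = (x : ℂ)⁻¹ := by push_cast; ring
  rw [h.graphEigenspace_eq (by rw [hshift]; exact_mod_cast inv_ne_zero hx), hshift, inv_inv]

lemma eventually_notMem_spectrum (h : IsResolventAt B m G) (hd : HasDiscreteSpectrum G) {x : ℝ}
    (hx : x ∈ spectrum ℝ B) (hx0 : x ≠ 0) : ∀ᶠ y in 𝓝[≠] x, y ∉ spectrum ℝ B := by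
  have hcont : ContinuousAt (fun y : ℝ => ((y⁻¹ - m : ℝ) : ℂ)) x :=
    Complex.continuous_ofReal.continuousAt.comp ((continuousAt_inv₀ hx0).sub continuousAt_const)
  have hinj : Function.Injective fun y : ℝ => ((y⁻¹ - m : ℝ) : ℂ) := fun y w hyw =>
    inv_injective (sub_left_injective (Complex.ofReal_injective hyw))
  have hlim := hcont.continuousWithinAt.tendsto_nhdsWithin (s := {x}ᶜ)
    (t := {((x⁻¹ - m : ℝ) : ℂ)}ᶜ) fun y hy => hinj.ne hy
  have hne : ∀ᶠ y in 𝓝[≠] x, y ≠ 0 := (isOpen_ne.eventually_mem hx0).filter_mono nhdsWithin_le_nhds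
  filter_upwards [hlim.eventually (hd _ ((h.mem_spectrum_real_iff hx0).1 hx)).1, hne]
    with y hy hy0 hys
  exact hy ((h.mem_spectrum_real_iff hy0).1 hys)

variable [CompleteSpace H]

lemma isCompactOperator (h : IsResolventAt B m G) (hB : IsSelfAdjoint B)
    (hd : HasDiscreteSpectrum G) : IsCompactOperator B := by
  refine isCompactOperator_of_isolated_of_finiteDimensional hB
    (fun x hx hx0 => h.eventually_notMem_spectrum hd hx hx0) fun x hx hx0 => ?_
  rw [h.eigenspace_eq hx0]
  exact (hd _ ((h.mem_spectrum_real_iff hx0).1 hx)).2.2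

end IsResolventAt

variable [CompleteSpace H] {K : Type*} [NormedAddCommGroup K] [InnerProductSpace ℂ K]
  [CompleteSpace K]

lemma isSelfAdjoint_comp_adjoint (J : K →L[ℂ] H) : IsSelfAdjoint (J ∘L J.adjoint) := by
  rw [ContinuousLinearMap.isSelfAdjoint_iff', ContinuousLinearMap.adjoint_comp,
    ContinuousLinearMap.adjoint_adjoint]

namespace IsResolventAt

variable {J : K →L[ℂ] H}

lemma hasDiscreteSpectrum_iff (h : IsResolventAt (J ∘L J.adjoint) m G) :
    HasDiscreteSpectrum G ↔ IsCompactOperator J := by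
  rw [← isCompactOperator_comp_adjoint_iff]
  have hself := isSelfAdjoint_comp_adjoint J
  exact ⟨h.isCompactOperator hself, fun hJ => h.hasDiscreteSpectrum hJ hself.isSymmetric⟩

lemma add_pos_of_graphEigenspace_ne_bot (h : IsResolventAt (J ∘L J.adjoint) m G) {s : ℝ}
    (hs : graphEigenspace G (s : ℂ) ≠ ⊥) : 0 < s + m := by
  obtain ⟨u, hu, hu0⟩ := (Submodule.ne_bot_iff _).1 hs
  rw [h.mem_graphEigenspace_iff] at hu
  have hnorm : ‖u‖ ^ 2 = (s + m) * ‖J.adjoint u‖ ^ 2 := by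
    have hinner : ⟪u, u⟫_ℂ = ((s : ℝ) + m : ℂ) * ⟪J.adjoint u, J.adjoint u⟫_ℂ := by
      conv_lhs => enter [3]; rw [hu]
      rw [inner_smul_right, ContinuousLinearMap.comp_apply,
        ← ContinuousLinearMap.adjoint_inner_left]
    rw [inner_self_eq_norm_sq_to_K, inner_self_eq_norm_sq_to_K] at hinner
    rw [← Complex.ofReal_inj]
    push_cast
    exact hinner
  have hpos : 0 < ‖u‖ ^ 2 := by positivity
  exact pos_of_mul_pos_left (hnorm ▸ hpos) (sq_nonneg _)

lemma finite_setOf_graphEigenspace_ne_bot_of_lt (h : IsResolventAt (J ∘L J.adjoint) m G)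
    (hJ : IsCompactOperator J) (r : ℝ) :
    {s : Iio r | graphEigenspace G ((s : ℝ) : ℂ) ≠ ⊥}.Finite := by
  have hfin := h.finite_setOf_graphEigenspace_ne_bot ((isCompactOperator_comp_adjoint_iff J).2 hJ)
    (isSelfAdjoint_comp_adjoint J).isSymmetric (max r m)
  refine (hfin.preimage fun s _ w _ hsw => Subtype.ext (Complex.ofReal_injective hsw)).subset
    fun s hs => ⟨?_, hs⟩
  have hlower := h.add_pos_of_graphEigenspace_ne_bot hs
  have hupper : (s : ℝ) < r := s.2
  rw [Complex.norm_real, Real.norm_eq_abs, abs_le]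
  constructor
  · linarith [le_max_right r m]
  · exact hupper.le.trans (le_max_left r m)

lemma eigenvalueCount_ne_top (h : IsResolventAt (J ∘L J.adjoint) m G) (hJ : IsCompactOperator J)
    (r : ℝ) : eigenvalueCount G r ≠ ⊤ := by
  have hfin := h.finite_setOf_graphEigenspace_ne_bot_of_lt hJ r
  rw [eigenvalueCount, tsum_eq_sum (s := hfin.toFinset)]
  · refine WithTop.sum_ne_top.2 fun s _ => Cardinal.toENat_ne_top.2 ?_
    have := h.finiteDimensional_graphEigenspace ((isCompactOperator_comp_adjoint_iff J).2 hJ) s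
    exact Module.rank_lt_aleph0 ℂ _
  · intro s hs
    rw [show graphEigenspace G ((s : ℝ) : ℂ) = ⊥ by simpa using hs, rank_bot, map_zero]

end IsResolventAt

end Resolvent

section ENatSums

variable {ι κ : Type*}

lemma hasSum_enat (f : ι → ℕ∞) : HasSum f (⨆ s : Finset ι, ∑ i ∈ s, f i) :=
  tendsto_atTop_iSup fun _ _ h => Finset.sum_le_sum_of_subset h

lemma summable_enat (f : ι → ℕ∞) : Summable f := (hasSum_enat f).summable

lemma enat_tsum_comm (f : ι → κ → ℕ∞) : ∑' j, ∑' i, f i j = ∑' i, ∑' j, f i j :=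
  Summable.tsum_comm' (summable_enat _) (fun _ => summable_enat _) fun _ => summable_enat _

lemma enat_tsum_eq_top_of_infinite {f : ι → ℕ∞} (h : {i | f i ≠ 0}.Infinite) :
    ∑' i, f i = ⊤ := by
  rw [(hasSum_enat f).tsum_eq, ENat.eq_top_iff_forall_ge]
  intro n
  obtain ⟨s, hs, hn⟩ := h.exists_subset_card_eq n
  refine le_iSup_of_le s ?_
  calc (n : ℕ∞) = ∑ _i ∈ s, 1 := by simp [hn]
    _ ≤ ∑ i ∈ s, f i := Finset.sum_le_sum fun i hi => Order.one_le_iff_ne_zero.2 (hs hi)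

end ENatSums

section Rank

variable {𝕜 : Type*} [Field 𝕜]

lemma toENat_rank_eq_top_iff {E : Type*} [AddCommGroup E] [Module 𝕜 E] :
    Cardinal.toENat (Module.rank 𝕜 E) = ⊤ ↔ ¬ Module.Finite 𝕜 E := by
  rw [Cardinal.toENat_eq_top, ← not_lt, Module.rank_lt_aleph0_iff]

lemma toENat_rank_le_of_injective {E F : Type*} [AddCommGroup E] [AddCommGroup F] [Module 𝕜 E]
    [Module 𝕜 F] (f : E →ₗ[𝕜] F) (hf : Function.Injective f) :
    Cardinal.toENat (Module.rank 𝕜 E) ≤ Cardinal.toENat (Module.rank 𝕜 F) := by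
  have := OrderHomClass.mono Cardinal.toENat (LinearMap.lift_rank_le_of_injective f hf)
  rwa [Cardinal.toENat_lift, Cardinal.toENat_lift] at this

lemma toENat_rank_pi {ι : Type*} [Fintype ι] {E : ι → Type*} [∀ i, AddCommGroup (E i)]
    [∀ i, Module 𝕜 (E i)] :
    Cardinal.toENat (Module.rank 𝕜 (∀ i, E i)) = ∑ i, Cardinal.toENat (Module.rank 𝕜 (E i)) := by
  by_cases h : ∀ i, Module.Finite 𝕜 (E i)
  · simp only [← Module.finrank_eq_rank, Module.finrank_pi_fintype, Cardinal.toENat_nat]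
    exact Nat.cast_sum _ _
  · push Not at h
    obtain ⟨i, hi⟩ := h
    have hpi : ¬ Module.Finite 𝕜 (∀ i, E i) := fun _ =>
      hi (Module.Finite.of_surjective (LinearMap.proj i : (∀ i, E i) →ₗ[𝕜] E i)
        (LinearMap.proj_surjective i))
    rw [toENat_rank_eq_top_iff.2 hpi, eq_comm, eq_top_iff, ← toENat_rank_eq_top_iff.2 hi]
    exact Finset.single_le_sum (f := fun i => Cardinal.toENat (Module.rank 𝕜 (E i)))
      (fun _ _ => zero_le) (Finset.mem_univ i)

end Rank

/-! ### Orthogonal sums of operators -/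

section Coisometry

variable {𝕜 : Type*} [RCLike 𝕜] {H E : Type*} [NormedAddCommGroup H] [InnerProductSpace 𝕜 H]
  [CompleteSpace H] [NormedAddCommGroup E] [InnerProductSpace 𝕜 E] [CompleteSpace E]

/-- The adjoint of an isometry `U : E → H`. If `E` is regarded as a subspace of `H`, this is the
orthogonal projection onto it. -/
abbrev coisometry (U : E →ₗᵢ[𝕜] H) : H →L[𝕜] E := U.toContinuousLinearMap.adjoint

lemma inner_coisometry_right (U : E →ₗᵢ[𝕜] H) (x : E) (y : H) :
    ⟪x, coisometry U y⟫_𝕜 = ⟪U x, y⟫_𝕜 :=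
  ContinuousLinearMap.adjoint_inner_right _ x y

lemma inner_coisometry_left (U : E →ₗᵢ[𝕜] H) (x : E) (y : H) :
    ⟪coisometry U y, x⟫_𝕜 = ⟪y, U x⟫_𝕜 :=
  ContinuousLinearMap.adjoint_inner_left _ x y

lemma coisometry_apply_self (U : E →ₗᵢ[𝕜] H) (x : E) : coisometry U (U x) = x :=
  congrArg (fun S : E →L[𝕜] E => S x) U.adjoint_comp_self

lemma norm_coisometry_le_one (U : E →ₗᵢ[𝕜] H) : ‖coisometry U‖ ≤ 1 := by
  rw [LinearIsometryEquiv.norm_map]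
  exact U.norm_toContinuousLinearMap_le

end Coisometry

section HilbertSum

variable {𝕜 : Type*} [RCLike 𝕜] {ι : Type*} {H : Type*} [NormedAddCommGroup H]
  [InnerProductSpace 𝕜 H] [CompleteSpace H] {E : ι → Type*} [∀ i, NormedAddCommGroup (E i)]
  [∀ i, InnerProductSpace 𝕜 (E i)] [∀ i, CompleteSpace (E i)] {U : ∀ i, E i →ₗᵢ[𝕜] H}

lemma coisometry_apply_of_ne (hU : OrthogonalFamily 𝕜 E U) {i k : ι} (hik : i ≠ k) (x : E k) :
    coisometry (U i) (U k x) = 0 := by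
  refine ext_inner_left 𝕜 fun y => ?_
  rw [inner_coisometry_right, inner_zero_right]
  exact hU hik y x

lemma isHilbertSum_of_forall_coisometry_eq_zero (hU : OrthogonalFamily 𝕜 E U)
    (htot : ∀ x, (∀ i, coisometry (U i) x = 0) → x = 0) : IsHilbertSum 𝕜 E U := by
  refine IsHilbertSum.mk hU ?_
  rw [top_le_iff, Submodule.topologicalClosure_eq_top_iff, Submodule.eq_bot_iff]
  refine fun x hx => htot x fun i => ext_inner_left 𝕜 fun y => ?_
  rw [inner_coisometry_right, inner_zero_right]
  exact hx _ (Submodule.mem_iSup_of_mem i ⟨y, rfl⟩)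

lemma linearIsometryEquiv_apply (hU : IsHilbertSum 𝕜 E U) (x : H) (i : ι) :
    hU.linearIsometryEquiv x i = coisometry (U i) x := by
  have hsum := (hU.hasSum_linearIsometryEquiv_symm (hU.linearIsometryEquiv x)).mapL
    (coisometry (U i))
  rw [LinearIsometryEquiv.symm_apply_apply] at hsum
  refine HasSum.unique ?_ hsum
  convert hasSum_single i fun k hk => ?_
  · exact (coisometry_apply_self _ _).symm
  · exact coisometry_apply_of_ne hU.OrthogonalFamily hk.symm _

lemma hasSum_coisometry (hU : IsHilbertSum 𝕜 E U) (x : H) :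
    HasSum (fun i => U i (coisometry (U i) x)) x := by
  have hsum := hU.hasSum_linearIsometryEquiv_symm (hU.linearIsometryEquiv x)
  simpa only [LinearIsometryEquiv.symm_apply_apply, linearIsometryEquiv_apply hU] using hsum

lemma hasSum_norm_sq_coisometry (hU : IsHilbertSum 𝕜 E U) (x : H) :
    HasSum (fun i => ‖coisometry (U i) x‖ ^ 2) (‖x‖ ^ 2) := by
  have hsum := lp.hasSum_norm (p := 2) (by simp) (hU.linearIsometryEquiv x)
  simpa only [linearIsometryEquiv_apply hU, LinearIsometryEquiv.norm_map, ENNReal.toReal_ofNat,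
    Real.rpow_ofNat] using hsum

lemma eq_zero_of_forall_coisometry_eq_zero (hU : IsHilbertSum 𝕜 E U) {x : H}
    (hx : ∀ i, coisometry (U i) x = 0) : x = 0 := by
  have hsum := hasSum_coisometry hU x
  simp only [hx, map_zero] at hsum
  exact hsum.unique hasSum_zero

variable {M : Submodule 𝕜 H} {N : ∀ i, Submodule 𝕜 (E i)}

lemma toENat_rank_le_tsum (hU : IsHilbertSum 𝕜 E U)
    (hM : ∀ i, ∀ x ∈ M, coisometry (U i) x ∈ N i) :
    Cardinal.toENat (Module.rank 𝕜 M) ≤ ∑' i, Cardinal.toENat (Module.rank 𝕜 (N i)) := by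
  by_cases hfin : {i | Cardinal.toENat (Module.rank 𝕜 (N i)) ≠ 0}.Finite
  · rw [tsum_eq_sum (s := hfin.toFinset) (by simp), ← Finset.sum_coe_sort, ← toENat_rank_pi]
    let coordinates : M →ₗ[𝕜] ∀ i : hfin.toFinset, N i := LinearMap.pi fun i =>
      (coisometry (U i) : H →ₗ[𝕜] E i).restrict (hM i)
    refine toENat_rank_le_of_injective coordinates ((injective_iff_map_eq_zero _).2 fun x hx =>
      Subtype.ext (eq_zero_of_forall_coisometry_eq_zero hU fun i => ?_))
    by_cases hi : i ∈ hfin.toFinset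
    · exact congrArg Subtype.val (congrFun hx ⟨i, hi⟩)
    · have hrank : Cardinal.toENat (Module.rank 𝕜 (N i)) = 0 := by simpa using hi
      rw [Cardinal.toENat_eq_zero, rank_zero_iff] at hrank
      exact congrArg Subtype.val (Subsingleton.elim (⟨_, hM i x x.2⟩ : N i) 0)
  · rw [enat_tsum_eq_top_of_infinite hfin]
    exact le_top

lemma tsum_le_toENat_rank (hU : OrthogonalFamily 𝕜 E U) (hN : ∀ i, ∀ x ∈ N i, U i x ∈ M) :
    ∑' i, Cardinal.toENat (Module.rank 𝕜 (N i)) ≤ Cardinal.toENat (Module.rank 𝕜 M) := by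
  classical
  rw [(hasSum_enat _).tsum_eq]
  refine iSup_le fun s => ?_
  rw [← Finset.sum_coe_sort, ← toENat_rank_pi]
  let total : (∀ i : s, N i) →ₗ[𝕜] M :=
    ∑ i : s, ((U i).toLinearMap.restrict (hN i)) ∘ₗ LinearMap.proj i
  refine toENat_rank_le_of_injective total ((injective_iff_map_eq_zero _).2 fun x hx => ?_)
  have htotal : ∑ i : s, U i (x i) = 0 := by simpa [total] using congrArg Subtype.val hx
  ext i
  calc (x i : E i) = coisometry (U i) (∑ k : s, U k (x k)) := by
        rw [map_sum, Finset.sum_eq_single i, coisometry_apply_self]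
        · exact fun k _ hk => coisometry_apply_of_ne hU (fun h => hk (Subtype.ext h.symm)) _
        · exact fun h => absurd (Finset.mem_univ i) h
    _ = ((0 : ∀ i : s, N i) i : E i) := by rw [htotal, map_zero]; rfl

end HilbertSum

section DiagonalOperator

variable {𝕜 : Type*} [RCLike 𝕜] {ι : Type*} {H K : Type*} [NormedAddCommGroup H]
  [InnerProductSpace 𝕜 H] [CompleteSpace H] [NormedAddCommGroup K] [InnerProductSpace 𝕜 K]
  [CompleteSpace K] {E F : ι → Type*} [∀ i, NormedAddCommGroup (E i)]
  [∀ i, InnerProductSpace 𝕜 (E i)] [∀ i, CompleteSpace (E i)] [∀ i, NormedAddCommGroup (F i)]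
  [∀ i, InnerProductSpace 𝕜 (F i)] [∀ i, CompleteSpace (F i)] {U : ∀ i, E i →ₗᵢ[𝕜] H}
  {UK : ∀ i, F i →ₗᵢ[𝕜] K} {J : K →L[𝕜] H} {j : ∀ i, F i →L[𝕜] E i}

lemma coisometry_intertwine (hU : OrthogonalFamily 𝕜 E U) (hUK : IsHilbertSum 𝕜 F UK)
    (hmap : ∀ i x, J (UK i x) = U i (j i x)) (i : ι) (x : K) :
    coisometry (U i) (J x) = j i (coisometry (UK i) x) := by
  refine HasSum.unique ((hasSum_coisometry hUK x).mapL (coisometry (U i) ∘L J)) ?_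
  convert hasSum_single i fun k hk => ?_
  · rw [ContinuousLinearMap.comp_apply, hmap, coisometry_apply_self]
  · rw [ContinuousLinearMap.comp_apply, hmap, coisometry_apply_of_ne hU hk.symm]

lemma adjoint_intertwine (hU : OrthogonalFamily 𝕜 E U) (hUK : IsHilbertSum 𝕜 F UK)
    (hmap : ∀ i x, J (UK i x) = U i (j i x)) (i : ι) (x : E i) :
    J.adjoint (U i x) = UK i ((j i).adjoint x) := by
  refine ext_inner_left 𝕜 fun y => ?_
  rw [ContinuousLinearMap.adjoint_inner_right, ← inner_coisometry_left,
    coisometry_intertwine hU hUK hmap, ← ContinuousLinearMap.adjoint_inner_right,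
    inner_coisometry_left]

lemma opNorm_le_of_intertwine (hU : IsHilbertSum 𝕜 E U) (hUK : IsHilbertSum 𝕜 F UK) {C : ℝ}
    (hC : 0 ≤ C) (hj : ∀ i x, ‖coisometry (U i) (J x)‖ ≤ C * ‖coisometry (UK i) x‖) :
    ‖J‖ ≤ C := by
  refine J.opNorm_le_bound hC fun x => ?_
  rw [← pow_le_pow_iff_left₀ (norm_nonneg _) (by positivity) two_ne_zero, mul_pow]
  refine hasSum_le (fun i => ?_) (hasSum_norm_sq_coisometry hU (J x))
    ((hasSum_norm_sq_coisometry hUK x).mul_left (C ^ 2))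
  rw [← mul_pow]
  gcongr
  exact hj i x

lemma isCompactOperator_of_intertwine (hU : IsHilbertSum 𝕜 E U) (hUK : IsHilbertSum 𝕜 F UK)
    (hmap : ∀ i x, J (UK i x) = U i (j i x)) (hj : ∀ i, IsCompactOperator (j i))
    (hfin : ∀ ε > 0, {i | ε < ‖j i‖}.Finite) : IsCompactOperator J := by
  classical
  refine isCompactOperator_of_forall_norm_sub_le fun ε hε => ?_
  let s := (hfin ε hε).toFinset
  let P : ι → K →L[𝕜] H := fun i => (U i).toContinuousLinearMap ∘L j i ∘L coisometry (UK i)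
  have hP : ∀ i k x, coisometry (U i) (P k x) = if k = i then j i (coisometry (UK i) x) else 0 := by
    intro i k x
    split_ifs with hki
    · subst hki
      exact coisometry_apply_self _ _
    · exact coisometry_apply_of_ne hU.OrthogonalFamily (Ne.symm hki) _
  refine ⟨∑ i ∈ s, P i, isCompactOperator_finsetSum _ fun i _ => ((hj i).comp_clm _).clm_comp _,
    opNorm_le_of_intertwine hU hUK hε.le fun i x => ?_⟩
  rw [sub_apply, map_sub, sum_apply, map_sum, coisometry_intertwine hU.OrthogonalFamily hUK hmap]
  simp only [hP, Finset.sum_ite_eq']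
  split_ifs with hi
  · rw [sub_self, norm_zero]
    positivity
  · rw [sub_zero]
    exact (j i).le_of_opNorm_le (by simpa [s] using hi) _

end DiagonalOperator

lemma eigenvalueCount_eq_tsum {ι : Type*} {H : Type*} [NormedAddCommGroup H]
    [InnerProductSpace ℂ H] [CompleteSpace H] {E : ι → Type*} [∀ i, NormedAddCommGroup (E i)]
    [∀ i, InnerProductSpace ℂ (E i)] [∀ i, CompleteSpace (E i)] {U : ∀ i, E i →ₗᵢ[ℂ] H}
    {B : H →L[ℂ] H} {β : ∀ i, E i →L[ℂ] E i} {m : ℝ} {G : Submodule ℂ (H × H)}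
    {g : ∀ i, Submodule ℂ (E i × E i)} (hU : IsHilbertSum ℂ E U)
    (hmap : ∀ i x, B (U i x) = U i (β i x)) (hG : IsResolventAt B m G)
    (hg : ∀ i, IsResolventAt (β i) m (g i)) (r : ℝ) :
    eigenvalueCount G r = ∑' i, eigenvalueCount (g i) r := by
  simp only [eigenvalueCount]
  rw [enat_tsum_comm]
  refine tsum_congr fun s => le_antisymm (toENat_rank_le_tsum hU fun i x hx => ?_)
    (tsum_le_toENat_rank hU.OrthogonalFamily fun i x hx => ?_)
  · rw [hG.mem_graphEigenspace_iff] at hx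
    rw [(hg i).mem_graphEigenspace_iff, ← coisometry_intertwine hU.OrthogonalFamily hU hmap,
      ← map_smul]
    exact congrArg (coisometry (U i)) hx
  · rw [(hg i).mem_graphEigenspace_iff] at hx
    rw [hG.mem_graphEigenspace_iff, hmap, ← map_smul]
    exact congrArg (U i) hx

section Compression

variable {𝕜 : Type*} [RCLike 𝕜] {H K : Type*} [NormedAddCommGroup H] [InnerProductSpace 𝕜 H]
  [NormedAddCommGroup K] [InnerProductSpace 𝕜 K] {J : K →L[𝕜] H}

variable [CompleteSpace H] {E F : Type*} [NormedAddCommGroup E] [InnerProductSpace 𝕜 E]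
  [CompleteSpace E] [NormedAddCommGroup F] [InnerProductSpace 𝕜 F] {U : E →ₗᵢ[𝕜] H}
  {UK : F →ₗᵢ[𝕜] K} {j : F →L[𝕜] E}

lemma eq_coisometry_comp (hmap : ∀ x, J (UK x) = U (j x)) :
    j = coisometry U ∘L J ∘L UK.toContinuousLinearMap := by
  ext x
  exact ((congrArg (coisometry U) (hmap x)).trans (coisometry_apply_self U _)).symm

lemma isCompactOperator_compression (hmap : ∀ x, J (UK x) = U (j x)) (hJ : IsCompactOperator J) :
    IsCompactOperator j := by
  rw [eq_coisometry_comp hmap]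
  exact (hJ.comp_clm UK.toContinuousLinearMap).clm_comp (coisometry U)

lemma norm_le_norm_coisometry_comp (hmap : ∀ x, J (UK x) = U (j x)) :
    ‖j‖ ≤ ‖coisometry U ∘L J‖ := by
  rw [eq_coisometry_comp hmap, ← ContinuousLinearMap.comp_assoc]
  exact (ContinuousLinearMap.opNorm_comp_le _ _).trans
    (mul_le_of_le_one_right (norm_nonneg _) UK.norm_toContinuousLinearMap_le)

end Compression

/-! ### Weighted compositions between `L²` spaces -/

section WeightedComp

variable {X Y : Type*} [MeasurableSpace X] [MeasurableSpace Y] {μ : Measure X} {ν : Measure Y}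
  {A : Y → ℂ} {π : Y → X}

lemma ae_comp_of_measurePreserving_withDensity (hA : Measurable A)
    (hπ : MeasurePreserving π (ν.withDensity fun y => ‖A y‖ₑ ^ 2) μ) {Q : X → Prop}
    (hQ : ∀ᵐ x ∂μ, Q x) : ∀ᵐ y ∂ν, A y ≠ 0 → Q (π y) := by
  have hcomp := (ae_withDensity_iff (hA.enorm.pow_const 2)).1 (hπ.quasiMeasurePreserving.ae hQ)
  filter_upwards [hcomp] with y hy hAy
  exact hy (by simpa using hAy)

lemma eLpNorm_mul_comp (hA : Measurable A)
    (hπ : MeasurePreserving π (ν.withDensity fun y => ‖A y‖ₑ ^ 2) μ) {u : X → ℂ}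
    (hu : Measurable u) : eLpNorm (fun y => A y * u (π y)) 2 ν = eLpNorm u 2 μ := by
  have hπ' := hπ.measurable
  rw [eLpNorm_eq_lintegral_rpow_enorm_toReal two_ne_zero ENNReal.ofNat_ne_top,
    eLpNorm_eq_lintegral_rpow_enorm_toReal two_ne_zero ENNReal.ofNat_ne_top,
    ← hπ.lintegral_comp (by fun_prop), lintegral_withDensity_eq_lintegral_mul _
      (hA.enorm.pow_const 2) (by fun_prop)]
  simp only [enorm_mul, ENNReal.toReal_ofNat, ENNReal.rpow_ofNat, Pi.mul_apply, mul_pow]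

lemma memLp_mul_comp (hA : Measurable A)
    (hπ : MeasurePreserving π (ν.withDensity fun y => ‖A y‖ₑ ^ 2) μ) (u : Lp ℂ 2 μ) :
    MemLp (fun y => A y * u (π y)) 2 ν := by
  have hu := (Lp.stronglyMeasurable u).measurable
  refine ⟨(hA.mul (hu.comp hπ.measurable)).aestronglyMeasurable, ?_⟩
  rw [eLpNorm_mul_comp hA hπ hu]
  exact (Lp.memLp u).2

lemma mul_comp_ae_eq (hA : Measurable A)
    (hπ : MeasurePreserving π (ν.withDensity fun y => ‖A y‖ₑ ^ 2) μ) {u v : X → ℂ}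
    (huv : u =ᵐ[μ] v) : (fun y => A y * u (π y)) =ᵐ[ν] fun y => A y * v (π y) := by
  filter_upwards [ae_comp_of_measurePreserving_withDensity hA hπ huv] with y hy
  by_cases hAy : A y = 0
  · rw [hAy, zero_mul, zero_mul]
  · rw [hy hAy]

/-- The isometry `u ↦ A · (u ∘ π)` between `L²` spaces. -/
def weightedComp (hA : Measurable A)
    (hπ : MeasurePreserving π (ν.withDensity fun y => ‖A y‖ₑ ^ 2) μ) :
    Lp ℂ 2 μ →ₗᵢ[ℂ] Lp ℂ 2 ν where
  toFun u := (memLp_mul_comp hA hπ u).toLp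
  map_add' u v := by
    rw [← MemLp.toLp_add]
    refine MemLp.toLp_congr _ _ ((mul_comp_ae_eq hA hπ (Lp.coeFn_add u v)).trans ?_)
    exact Filter.Eventually.of_forall fun y => mul_add _ _ _
  map_smul' c u := by
    rw [RingHom.id_apply, ← MemLp.toLp_const_smul]
    refine MemLp.toLp_congr _ _ ((mul_comp_ae_eq hA hπ (Lp.coeFn_smul c u)).trans ?_)
    exact Filter.Eventually.of_forall fun y => mul_left_comm _ _ _
  norm_map' u := by
    change ‖(memLp_mul_comp hA hπ u).toLp‖ = ‖u‖
    rw [Lp.norm_toLp, eLpNorm_mul_comp hA hπ (Lp.stronglyMeasurable u).measurable, Lp.norm_def]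

lemma coeFn_weightedComp (hA : Measurable A)
    (hπ : MeasurePreserving π (ν.withDensity fun y => ‖A y‖ₑ ^ 2) μ) {u : Lp ℂ 2 μ} {F : X → ℂ}
    (hF : u =ᵐ[μ] F) : weightedComp hA hπ u =ᵐ[ν] fun y => A y * F (π y) :=
  (MemLp.coeFn_toLp (memLp_mul_comp hA hπ u)).trans (mul_comp_ae_eq hA hπ hF)

end WeightedComp

/-! ### The form domain as a Hilbert space -/

section FormWeight

variable {X : Type*} {q : X → ℝ} {m : ℝ} {x : X}

/-- The function `(q + m)^{-1/2}`. It is only used where `1 ≤ q + m`; the maximum makes it bounded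
everywhere. -/
def formWeight (q : X → ℝ) (m : ℝ) (x : X) : ℂ := ((√(max 1 (q x + m)))⁻¹ : ℝ)

lemma measurable_formWeight [MeasurableSpace X] (hq : Measurable q) (m : ℝ) :
    Measurable (formWeight q m) := by
  unfold formWeight
  fun_prop

lemma norm_formWeight_le_one (q : X → ℝ) (m : ℝ) (x : X) : ‖formWeight q m x‖ ≤ 1 := by
  rw [formWeight, Complex.norm_real, Real.norm_eq_abs, abs_of_nonneg (by positivity)]
  exact inv_le_one_of_one_le₀ (Real.one_le_sqrt.2 (le_max_left _ _))

lemma conj_formWeight (q : X → ℝ) (m : ℝ) (x : X) :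
    conj (formWeight q m x) = formWeight q m x := Complex.conj_ofReal _

lemma formWeight_ne_zero (q : X → ℝ) (m : ℝ) (x : X) : formWeight q m x ≠ 0 := by
  have : 0 < √(max 1 (q x + m)) := Real.sqrt_pos.2 (lt_max_of_lt_left one_pos)
  rw [formWeight]
  exact_mod_cast (inv_pos.2 this).ne'

lemma add_mul_norm_formWeight_sq (h : 1 ≤ q x + m) : (q x + m) * ‖formWeight q m x‖ ^ 2 = 1 := by
  have hpos : 0 < q x + m := by linarith
  rw [formWeight, Complex.norm_real, Real.norm_eq_abs, sq_abs, inv_pow, max_eq_right h,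
    Real.sq_sqrt hpos.le, mul_inv_cancel₀ hpos.ne']

lemma add_mul_formWeight_mul_self (h : 1 ≤ q x + m) :
    ((q x : ℂ) + m) * (formWeight q m x * formWeight q m x) = 1 := by
  have hmul : formWeight q m x * formWeight q m x = ((‖formWeight q m x‖ ^ 2 : ℝ) : ℂ) := by
    conv_lhs => enter [1]; rw [← conj_formWeight]
    rw [Complex.conj_mul', Complex.ofReal_pow]
  rw [hmul]
  exact_mod_cast add_mul_norm_formWeight_sq h

end FormWeight

section FormSpace

variable {X : Type*} [MeasurableSpace X] {μ : Measure X} {q : X → ℝ}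

lemma memLp_formWeight (μ : Measure X) (hq : Measurable q) (m : ℝ) :
    MemLp (formWeight q m) ∞ μ :=
  memLp_top_of_bound (measurable_formWeight hq m).aestronglyMeasurable 1
    (Filter.Eventually.of_forall (norm_formWeight_le_one q m))

/-- Multiplication by `(q + m)^{-1/2}`. -/
def formMul (μ : Measure X) (hq : Measurable q) (m : ℝ) : Lp ℂ 2 μ →L[ℂ] Lp ℂ 2 μ :=
  (ContinuousLinearMap.mul ℂ ℂ).holderL μ ∞ 2 2 (memLp_formWeight μ hq m).toLp

lemma coeFn_formMul (hq : Measurable q) (m : ℝ) (u : Lp ℂ 2 μ) :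
    formMul μ hq m u =ᵐ[μ] fun x => formWeight q m x * u x := by
  filter_upwards [(ContinuousLinearMap.mul ℂ ℂ).coeFn_holder (r := 2)
    (memLp_formWeight μ hq m).toLp u, (memLp_formWeight μ hq m).coeFn_toLp] with x hmul hweight
  exact hmul.trans (congrArg (· * u x) hweight)

lemma inner_formMul_left (hq : Measurable q) (m : ℝ) (u v : Lp ℂ 2 μ) :
    ⟪formMul μ hq m u, v⟫_ℂ = ⟪u, formMul μ hq m v⟫_ℂ := by
  rw [L2.inner_def, L2.inner_def]
  refine integral_congr_ae ?_
  filter_upwards [coeFn_formMul hq m u, coeFn_formMul hq m v] with x hu hv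
  rw [hu, hv]
  simp only [RCLike.inner_apply, map_mul, conj_formWeight]
  ring

lemma weightedComp_formMul {Y : Type*} [MeasurableSpace Y] {ν : Measure Y} {A : Y → ℂ} {π : Y → X}
    (hA : Measurable A) (hπ : MeasurePreserving π (ν.withDensity fun y => ‖A y‖ₑ ^ 2) μ)
    (hq : Measurable q) (m : ℝ) (u : Lp ℂ 2 μ) :
    weightedComp hA hπ (formMul μ hq m u)
      = formMul ν (hq.comp hπ.measurable) m (weightedComp hA hπ u) := by
  refine Lp.ext ?_
  filter_upwards [coeFn_weightedComp hA hπ (coeFn_formMul hq m u),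
    coeFn_weightedComp hA hπ (Filter.EventuallyEq.refl _ u),
    coeFn_formMul (hq.comp hπ.measurable) m (weightedComp hA hπ u)] with y hleft hcomp hright
  rw [hleft, hright, hcomp]
  exact mul_left_comm _ _ _

lemma memWeightedL2_iff (hq : Measurable q) {m : ℝ} (hm : ∀ᵐ x ∂μ, 1 ≤ q x + m) (u : Lp ℂ 2 μ) :
    MemWeightedL2 q u ↔ ∃ w, formMul μ hq m w = u := by
  have hu : Integrable (fun x => ‖u x‖ ^ 2) μ := (Lp.memLp u).integrable_norm_pow two_ne_zero
  constructor
  · intro h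
    have hmeas : Measurable fun x => (formWeight q m x)⁻¹ * u x :=
      (measurable_formWeight hq m).inv.mul (Lp.stronglyMeasurable u).measurable
    have hmem : MemLp (fun x => (formWeight q m x)⁻¹ * u x) 2 μ := by
      refine (memLp_two_iff_integrable_sq_norm hmeas.aestronglyMeasurable).2
        ((Integrable.add h (hu.const_mul m)).congr ?_)
      filter_upwards [hm] with x hx
      rw [norm_mul, norm_inv, mul_pow, inv_pow,
        ← eq_inv_of_mul_eq_one_left (add_mul_norm_formWeight_sq hx), Pi.add_apply, add_mul]
    refine ⟨hmem.toLp, Lp.ext ?_⟩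
    filter_upwards [coeFn_formMul hq m hmem.toLp, hmem.coeFn_toLp] with x hmul hx
    rw [hmul, hx, mul_inv_cancel_left₀ (formWeight_ne_zero q m x)]
  · rintro ⟨w, rfl⟩
    have hw : Integrable (fun x => ‖w x‖ ^ 2) μ := (Lp.memLp w).integrable_norm_pow two_ne_zero
    refine (hw.sub (hu.const_mul m)).congr ?_
    filter_upwards [hm, coeFn_formMul hq m w] with x hx hmul
    simp only [Pi.sub_apply, hmul, norm_mul]
    linear_combination (-‖w x‖ ^ 2) * add_mul_norm_formWeight_sq hx

/-- The map `(w, v) ↦ ((q + m)^{-1/2} w, v)` from `L² ⊕ L²` to the pairs of functions in which form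
domains are recorded. -/
def formPair (μ : Measure X) (hq : Measurable q) (m : ℝ) :
    WithLp 2 (Lp ℂ 2 μ × Lp ℂ 2 μ) →L[ℂ] Lp ℂ 2 μ × Lp ℂ 2 μ :=
  (formMul μ hq m ∘L WithLp.fstL 2 ℂ _ _).prod (WithLp.sndL 2 ℂ _ _)

lemma schrodingerForm_formPair (hq : Measurable q) {m : ℝ} (hm : ∀ᵐ x ∂μ, 1 ≤ q x + m)
    (κ κ' : WithLp 2 (Lp ℂ 2 μ × Lp ℂ 2 μ)) :
    schrodingerForm q (formPair μ hq m κ) (formPair μ hq m κ')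
      + m * ⟪(formPair μ hq m κ).1, (formPair μ hq m κ').1⟫_ℂ = ⟪κ, κ'⟫_ℂ := by
  rw [schrodingerForm, WithLp.prod_inner_apply, L2.inner_def, L2.inner_def, L2.inner_def,
    ← integral_const_mul, ← integral_add,
    ← integral_add (L2.integrable_inner _ _) (L2.integrable_inner _ _)]
  · refine integral_congr_ae ?_
    filter_upwards [hm, coeFn_formMul hq m κ.fst, coeFn_formMul hq m κ'.fst] with x hx hκ hκ'
    change conj (κ.snd x) * κ'.snd x
        + q x * (conj (formMul μ hq m κ.fst x) * formMul μ hq m κ'.fst x)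
        + m * (formMul μ hq m κ'.fst x * conj (formMul μ hq m κ.fst x))
      = κ'.fst x * conj (κ.fst x) + κ'.snd x * conj (κ.snd x)
    rw [hκ, hκ', map_mul, conj_formWeight]
    linear_combination (conj (κ.fst x) * κ'.fst x) * add_mul_formWeight_mul_self hx
  · exact schrodingerForm_integrable hq ((memWeightedL2_iff hq hm _).2 ⟨_, rfl⟩)
      ((memWeightedL2_iff hq hm _).2 ⟨_, rfl⟩)
  · exact (L2.integrable_inner _ _).const_mul _

variable {W : Submodule ℂ (Lp ℂ 2 μ × Lp ℂ 2 μ)}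

/-- The form domain as a Hilbert space: the pairs `((q + m)^{1/2} u, u')` of `L² ⊕ L²`. Its squared
norm is the form shifted by `m`. -/
def formSpace (W : Submodule ℂ (Lp ℂ 2 μ × Lp ℂ 2 μ)) (hq : Measurable q) (m : ℝ) :
    Submodule ℂ (WithLp 2 (Lp ℂ 2 μ × Lp ℂ 2 μ)) :=
  W.comap (formPair μ hq m : WithLp 2 (Lp ℂ 2 μ × Lp ℂ 2 μ) →ₗ[ℂ] Lp ℂ 2 μ × Lp ℂ 2 μ)

lemma isClosed_formSpace (hW : IsClosed (W : Set (Lp ℂ 2 μ × Lp ℂ 2 μ))) (hq : Measurable q)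
    (m : ℝ) : IsClosed (formSpace W hq m : Set (WithLp 2 (Lp ℂ 2 μ × Lp ℂ 2 μ))) :=
  hW.preimage (formPair μ hq m).continuous

/-- The embedding of the form domain into `L²`. -/
def formEmbedding (W : Submodule ℂ (Lp ℂ 2 μ × Lp ℂ 2 μ)) (hq : Measurable q) (m : ℝ) :
    formSpace W hq m →L[ℂ] Lp ℂ 2 μ :=
  ContinuousLinearMap.fst ℂ _ _ ∘L formPair μ hq m ∘L (formSpace W hq m).subtypeL

lemma mem_formDomain_iff (hq : Measurable q) {m : ℝ} (hm : ∀ᵐ x ∂μ, 1 ≤ q x + m)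
    (p : Lp ℂ 2 μ × Lp ℂ 2 μ) :
    p ∈ formDomain W q hq ↔ ∃ κ : formSpace W hq m, formPair μ hq m κ = p := by
  constructor
  · rintro ⟨hpW, hp⟩
    obtain ⟨w, hw⟩ := (memWeightedL2_iff hq hm _).1 hp
    have hpair : formPair μ hq m (WithLp.toLp 2 (w, p.2)) = p := Prod.ext hw rfl
    exact ⟨⟨WithLp.toLp 2 (w, p.2), hpair.symm ▸ hpW⟩, hpair⟩
  · rintro ⟨κ, rfl⟩
    exact ⟨κ.2, (memWeightedL2_iff hq hm _).2 ⟨_, rfl⟩⟩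

lemma mem_formOperator_iff (hq : Measurable q) {m : ℝ} (hm : ∀ᵐ x ∂μ, 1 ≤ q x + m)
    (u g : Lp ℂ 2 μ) :
    (u, g) ∈ formOperator W q hq ↔ ∃ κ : formSpace W hq m, u = formEmbedding W hq m κ ∧
      ∀ κ' : formSpace W hq m, ⟪κ', κ⟫_ℂ = ⟪formEmbedding W hq m κ', g + (m : ℂ) • u⟫_ℂ := by
  have hform : ∀ κ' κ : formSpace W hq m,
      schrodingerForm q (formPair μ hq m κ') (formPair μ hq m κ) = ⟪formEmbedding W hq m κ', g⟫_ℂ ↔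
        ⟪κ', κ⟫_ℂ = ⟪formEmbedding W hq m κ', g + (m : ℂ) • formEmbedding W hq m κ⟫_ℂ := by
    intro κ' κ
    rw [inner_add_right, inner_smul_right, Submodule.coe_inner,
      ← schrodingerForm_formPair hq hm κ'.1 κ.1]
    exact add_left_inj _ |>.symm
  constructor
  · rintro ⟨u', hu', h⟩
    obtain ⟨κ, hκ⟩ := (mem_formDomain_iff hq hm _).1 hu'
    obtain rfl : formEmbedding W hq m κ = u := congrArg Prod.fst hκ
    refine ⟨κ, rfl, fun κ' => (hform κ' κ).1 ?_⟩
    rw [hκ]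
    exact h _ ((mem_formDomain_iff hq hm _).2 ⟨κ', rfl⟩)
  · rintro ⟨κ, rfl, h⟩
    refine ⟨(formPair μ hq m κ).2, (mem_formDomain_iff hq hm _).2 ⟨κ, rfl⟩, fun p hp => ?_⟩
    obtain ⟨κ', rfl⟩ := (mem_formDomain_iff hq hm _).1 hp
    exact (hform κ' κ).2 (h κ')

lemma isResolventAt_formOperator (hq : Measurable q) {m : ℝ} (hm : ∀ᵐ x ∂μ, 1 ≤ q x + m)
    [CompleteSpace (formSpace W hq m)] :
    IsResolventAt (formEmbedding W hq m ∘L (formEmbedding W hq m).adjoint) m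
      (formOperator W q hq) := by
  intro u g
  rw [mem_formOperator_iff hq hm, ContinuousLinearMap.comp_apply]
  constructor
  · rintro ⟨κ, hu, h⟩
    have hκ : κ = (formEmbedding W hq m).adjoint (g + (m : ℂ) • u) :=
      ext_inner_left ℂ fun κ' => by rw [h, ContinuousLinearMap.adjoint_inner_right]
    rw [← hκ, hu]
  · exact fun hu => ⟨_, hu, fun κ' => ContinuousLinearMap.adjoint_inner_right _ _ _⟩

end FormSpace

section FormTransport

variable {X Y : Type*} [MeasurableSpace X] [MeasurableSpace Y] {μ : Measure X} {ν : Measure Y}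
  {W : Submodule ℂ (Lp ℂ 2 μ × Lp ℂ 2 μ)} {W' : Submodule ℂ (Lp ℂ 2 ν × Lp ℂ 2 ν)}
  {q : X → ℝ} {hq : Measurable q} {q' : Y → ℝ} {hq' : Measurable q'} {m : ℝ}

/-- The isometry of form domains induced by an isometry of the `L²` spaces that commutes with the
derivations and with the weights. -/
def formTransport (U : Lp ℂ 2 μ →ₗᵢ[ℂ] Lp ℂ 2 ν)
    (hM : ∀ u, U (formMul μ hq m u) = formMul ν hq' m (U u))
    (hW : ∀ p ∈ W, (U p.1, U p.2) ∈ W') : formSpace W hq m →ₗᵢ[ℂ] formSpace W' hq' m where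
  toFun κ := ⟨WithLp.toLp 2 (U κ.1.fst, U κ.1.snd), by
    have hκ := hW _ κ.2
    change (U (formMul μ hq m κ.1.fst), U κ.1.snd) ∈ W' at hκ
    rw [hM] at hκ
    exact hκ⟩
  map_add' κ κ' := Subtype.ext <|
    congrArg (WithLp.toLp 2) (Prod.ext (map_add U _ _) (map_add U _ _))
  map_smul' c κ := Subtype.ext <|
    congrArg (WithLp.toLp 2) (Prod.ext (map_smul U c _) (map_smul U c _))
  norm_map' κ := by
    change ‖WithLp.toLp 2 (U κ.1.fst, U κ.1.snd)‖ = ‖κ.1‖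
    rw [WithLp.prod_norm_eq_of_L2, WithLp.prod_norm_eq_of_L2]
    change √(‖U _‖ ^ 2 + ‖U _‖ ^ 2) = _
    rw [U.norm_map, U.norm_map]

variable {U : Lp ℂ 2 μ →ₗᵢ[ℂ] Lp ℂ 2 ν} (hM : ∀ u, U (formMul μ hq m u) = formMul ν hq' m (U u))
  (hW : ∀ p ∈ W, (U p.1, U p.2) ∈ W')

lemma formEmbedding_formTransport (κ : formSpace W hq m) :
    formEmbedding W' hq' m (formTransport U hM hW κ) = U (formEmbedding W hq m κ) :=
  (hM _).symm

include hM in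
lemma coisometry_formMul (f : Lp ℂ 2 ν) :
    coisometry U (formMul ν hq' m f) = formMul μ hq m (coisometry U f) := by
  refine ext_inner_left ℂ fun y => ?_
  rw [inner_coisometry_right, ← inner_formMul_left, ← inner_formMul_left, inner_coisometry_right,
    hM]

lemma coisometry_formTransport [CompleteSpace (formSpace W hq m)]
    [CompleteSpace (formSpace W' hq' m)]
    (hW' : ∀ p ∈ W', (coisometry U p.1, coisometry U p.2) ∈ W) (κ : formSpace W' hq' m) :
    (coisometry (formTransport U hM hW) κ).1
      = WithLp.toLp 2 (coisometry U κ.1.fst, coisometry U κ.1.snd) := by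
  have hmem : WithLp.toLp 2 (coisometry U κ.1.fst, coisometry U κ.1.snd) ∈ formSpace W hq m := by
    have hκ := hW' _ κ.2
    change (coisometry U (formMul ν hq' m κ.1.fst), coisometry U κ.1.snd) ∈ W at hκ
    rw [coisometry_formMul hM] at hκ
    exact hκ
  suffices coisometry (formTransport U hM hW) κ = ⟨_, hmem⟩ from congrArg Subtype.val this
  refine ext_inner_left ℂ fun κ' => ?_
  rw [inner_coisometry_right]
  exact (congrArg₂ (· + ·) (inner_coisometry_right U κ'.1.fst κ.1.fst)
    (inner_coisometry_right U κ'.1.snd κ.1.snd)).symm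

lemma isHilbertSum_formTransport {ι : Type*} {Z : ι → Type*} [∀ i, MeasurableSpace (Z i)]
    {ρ : ∀ i, Measure (Z i)} {Wi : ∀ i, Submodule ℂ (Lp ℂ 2 (ρ i) × Lp ℂ 2 (ρ i))}
    {qi : ∀ i, Z i → ℝ} {hqi : ∀ i, Measurable (qi i)} {Ui : ∀ i, Lp ℂ 2 (ρ i) →ₗᵢ[ℂ] Lp ℂ 2 ν}
    [∀ i, CompleteSpace (formSpace (Wi i) (hqi i) m)] [CompleteSpace (formSpace W' hq' m)]
    (hMi : ∀ i u, Ui i (formMul (ρ i) (hqi i) m u) = formMul ν hq' m (Ui i u))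
    (hWi : ∀ i, ∀ p ∈ Wi i, (Ui i p.1, Ui i p.2) ∈ W')
    (hWi' : ∀ i, ∀ p ∈ W', (coisometry (Ui i) p.1, coisometry (Ui i) p.2) ∈ Wi i)
    (hU : IsHilbertSum ℂ (fun i => Lp ℂ 2 (ρ i)) Ui) :
    IsHilbertSum ℂ (fun i => formSpace (Wi i) (hqi i) m)
      fun i => formTransport (Ui i) (hMi i) (hWi i) := by
  refine isHilbertSum_of_forall_coisometry_eq_zero (fun i j hij κ κ' => ?_) fun κ hκ => ?_
  · exact (congrArg₂ (· + ·) (hU.OrthogonalFamily hij κ.1.fst κ'.1.fst)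
      (hU.OrthogonalFamily hij κ.1.snd κ'.1.snd)).trans (add_zero _)
  · have hcomp : ∀ i, WithLp.toLp 2 (coisometry (Ui i) κ.1.fst, coisometry (Ui i) κ.1.snd) = 0 :=
      fun i => by rw [← coisometry_formTransport (hMi i) (hWi i) (hWi' i), hκ]; rfl
    have hfst : κ.1.fst = 0 := eq_zero_of_forall_coisometry_eq_zero hU fun i =>
      congrArg WithLp.fst (hcomp i)
    have hsnd : κ.1.snd = 0 := eq_zero_of_forall_coisometry_eq_zero hU fun i =>
      congrArg WithLp.snd (hcomp i)
    exact Subtype.ext (congrArg (WithLp.toLp 2) (Prod.ext hfst hsnd))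

end FormTransport

/-! ### Combinatorics of regular trees -/

namespace RootedMetricTree

section Generation

variable (T : RootedMetricTree)

lemma iterate_parent_gen (y : T.Vertex) : T.parent^[T.gen y] y = T.root :=
  Nat.sInf_mem (T.exists_iterate_parent y)

lemma gen_root : T.gen T.root = 0 := Nat.sInf_eq_zero.2 (Or.inl rfl)

lemma gen_eq_zero_iff {y : T.Vertex} : T.gen y = 0 ↔ y = T.root := by
  refine ⟨fun h => ?_, fun h => h ▸ T.gen_root⟩
  have hiter := T.iterate_parent_gen y
  rwa [h] at hiter

lemma gen_parent {y : T.Vertex} (hy : y ≠ T.root) : T.gen (T.parent y) + 1 = T.gen y := by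
  obtain ⟨n, hn⟩ := Nat.exists_eq_succ_of_ne_zero (mt T.gen_eq_zero_iff.1 hy)
  have hiter := T.iterate_parent_gen y
  rw [hn] at hiter
  have hle : T.gen (T.parent y) ≤ n := Nat.sInf_le hiter
  have hge : T.gen y ≤ T.gen (T.parent y) + 1 := Nat.sInf_le (T.iterate_parent_gen (T.parent y))
  omega

lemma ne_root_of_gen_eq_succ {y : T.Vertex} {n : ℕ} (h : T.gen y = n + 1) : y ≠ T.root :=
  fun hy => by rw [hy, T.gen_root] at h; omega

lemma gen_parent_of_gen_eq_succ {y : T.Vertex} {n : ℕ} (h : T.gen y = n + 1) :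
    T.gen (T.parent y) = n := by
  have hgen := T.gen_parent (T.ne_root_of_gen_eq_succ h)
  omega

lemma height_root : T.height T.root = 0 := by
  rw [height, T.gen_root, Finset.sum_range_zero]

lemma height_parent {y : T.Vertex} (hy : y ≠ T.root) :
    T.height y = T.height (T.parent y) + T.length y := by
  rw [height, height, ← T.gen_parent hy, Finset.sum_range_succ']
  rfl

/-- The function that is constant, equal to `a v`, on the subtree of each vertex `v` of
generation `k + 1`, and vanishes on the vertices of generation at most `k`. -/
def amplitude (k : ℕ) (a : T.Vertex → ℂ) (z : T.Vertex) : ℂ :=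
  if k < T.gen z then a (T.parent^[T.gen z - (k + 1)] z) else 0

variable {T} {k : ℕ} {a : T.Vertex → ℂ} {z : T.Vertex}

lemma amplitude_of_le (h : T.gen z ≤ k) : T.amplitude k a z = 0 := if_neg h.not_gt

lemma amplitude_of_eq (h : T.gen z = k + 1) : T.amplitude k a z = a z := by
  rw [amplitude, if_pos (by omega), h, Nat.sub_self, Function.iterate_zero_apply]

lemma amplitude_of_lt (h : k + 1 < T.gen z) :
    T.amplitude k a z = T.amplitude k a (T.parent z) := by
  have hz : z ≠ T.root := fun hz => by rw [hz, T.gen_root] at h; omega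
  have hgen := T.gen_parent hz
  rw [amplitude, amplitude, if_pos (by omega), if_pos (by omega),
    show T.gen z - (k + 1) = T.gen (T.parent z) - (k + 1) + 1 by omega,
    Function.iterate_succ_apply]

end Generation

/-- The tree is regular and has no leaves. The branching numbers are `b` and the heights of the
vertices are `t`, both indexed by the generation. -/
structure IsRegularWith (T : RootedMetricTree) (b : ℕ → ℕ) (t : ℕ → ℝ) : Prop where
  branching_pos : ∀ y, 0 < T.branching y
  branching_eq : ∀ y, T.branching y = b (T.gen y)
  height_eq : ∀ y, T.height y = t (T.gen y)

namespace IsRegularWith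

variable {T : RootedMetricTree} {b : ℕ → ℕ} {t : ℕ → ℝ} (hT : T.IsRegularWith b t)

include hT

lemma finite_children (y : T.Vertex) : {z | z ≠ T.root ∧ T.parent z = y}.Finite :=
  Set.finite_of_ncard_pos (hT.branching_pos y)

lemma exists_child (y : T.Vertex) : ∃ z, z ≠ T.root ∧ T.parent z = y :=
  Set.nonempty_of_ncard_ne_zero (hT.branching_pos y).ne'

lemma exists_gen_eq (n : ℕ) : ∃ y, T.gen y = n := by
  induction n with
  | zero => exact ⟨_, T.gen_root⟩
  | succ n ih =>
    obtain ⟨y, hy⟩ := ih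
    obtain ⟨z, hz, hzy⟩ := hT.exists_child y
    exact ⟨z, by rw [← T.gen_parent hz, hzy, hy]⟩

lemma finite_gen_eq (n : ℕ) : {y | T.gen y = n}.Finite := by
  induction n with
  | zero => exact (Set.finite_singleton T.root).subset fun y hy => T.gen_eq_zero_iff.1 hy
  | succ n ih =>
    refine (ih.biUnion fun y _ => hT.finite_children y).subset fun z hz => ?_
    exact mem_biUnion (T.gen_parent_of_gen_eq_succ hz) ⟨T.ne_root_of_gen_eq_succ hz, rfl⟩

lemma b_pos (n : ℕ) : 0 < b n := by
  obtain ⟨y, rfl⟩ := hT.exists_gen_eq n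
  exact hT.branching_eq y ▸ hT.branching_pos y

lemma t_zero : t 0 = 0 := by rw [← T.gen_root, ← hT.height_eq, T.height_root]

lemma t_strictMono : StrictMono t := by
  refine strictMono_nat_of_lt_succ fun n => ?_
  obtain ⟨y, hy⟩ := hT.exists_gen_eq (n + 1)
  have hroot := T.ne_root_of_gen_eq_succ hy
  rw [← hy, ← T.gen_parent_of_gen_eq_succ hy, ← hT.height_eq, ← hT.height_eq,
    T.height_parent hroot]
  exact lt_add_of_pos_right _ (T.length_pos y hroot)

/-- The vertices of generation `n`. -/
def level (n : ℕ) : Finset T.Vertex := (hT.finite_gen_eq n).toFinset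

/-- The terminal vertices of the edges that emanate from `y`. -/
def children (y : T.Vertex) : Finset T.Vertex := (hT.finite_children y).toFinset

lemma mem_level {n : ℕ} {y : T.Vertex} : y ∈ hT.level n ↔ T.gen y = n := by
  simp only [level, Finite.mem_toFinset, mem_ofPred_eq]

lemma mem_children {y z : T.Vertex} : z ∈ hT.children y ↔ z ≠ T.root ∧ T.parent z = y := by
  simp only [children, Finite.mem_toFinset, mem_ofPred_eq]

lemma gen_of_mem_children {y z : T.Vertex} (hz : z ∈ hT.children y) : T.gen z = T.gen y + 1 := by
  obtain ⟨hroot, rfl⟩ := hT.mem_children.1 hz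
  exact (T.gen_parent hroot).symm

lemma mem_level_succ_of_mem_children {n : ℕ} {y z : T.Vertex} (hz : z ∈ hT.children y)
    (hy : T.gen y = n) : z ∈ hT.level (n + 1) :=
  hT.mem_level.2 (by rw [hT.gen_of_mem_children hz, hy])

lemma parent_mem_level {n : ℕ} {z : T.Vertex} (hz : z ∈ hT.level (n + 1)) :
    T.parent z ∈ hT.level n :=
  hT.mem_level.2 (T.gen_parent_of_gen_eq_succ (hT.mem_level.1 hz))

lemma card_children (y : T.Vertex) : (hT.children y).card = b (T.gen y) := by
  rw [← hT.branching_eq, branching, children, Set.ncard_eq_toFinset_card _ (hT.finite_children y)]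

lemma sum_level_succ {M : Type*} [AddCommMonoid M] (n : ℕ) (f : T.Vertex → M) :
    ∑ z ∈ hT.level (n + 1), f z = ∑ y ∈ hT.level n, ∑ z ∈ hT.children y, f z := by
  classical
  rw [← Finset.sum_fiberwise_of_maps_to fun z hz => hT.parent_mem_level hz]
  refine Finset.sum_congr rfl fun y hy => Finset.sum_congr (Finset.ext fun z => ?_) fun _ _ => rfl
  rw [Finset.mem_filter]
  constructor
  · rintro ⟨hz, hzy⟩
    exact hT.mem_children.2 ⟨T.ne_root_of_gen_eq_succ (hT.mem_level.1 hz), hzy⟩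
  · intro hz
    exact ⟨hT.mem_level_succ_of_mem_children hz (hT.mem_level.1 hy), (hT.mem_children.1 hz).2⟩

lemma sum_level_succ_comp_parent {M : Type*} [AddCommMonoid M] (n : ℕ) (f : T.Vertex → M) :
    ∑ z ∈ hT.level (n + 1), f (T.parent z) = b n • ∑ y ∈ hT.level n, f y := by
  rw [hT.sum_level_succ, Finset.smul_sum]
  refine Finset.sum_congr rfl fun y hy => ?_
  rw [Finset.sum_congr rfl fun z hz => by rw [(hT.mem_children.1 hz).2], Finset.sum_const,
    hT.card_children, hT.mem_level.1 hy]

lemma card_level_succ (n : ℕ) : (hT.level (n + 1)).card = b n * (hT.level n).card := by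
  simpa only [Finset.card_eq_sum_ones, smul_eq_mul]
    using hT.sum_level_succ_comp_parent n fun _ => (1 : ℕ)

lemma card_level (n : ℕ) : (hT.level (n + 1)).card = b 0 * ∏ j ∈ Finset.Icc 1 n, b j := by
  induction n with
  | zero =>
    have hlevel : hT.level 0 = {T.root} := by
      ext y
      rw [hT.mem_level, T.gen_eq_zero_iff, Finset.mem_singleton]
    rw [hT.card_level_succ, hlevel, Finset.card_singleton, Finset.Icc_eq_empty_of_lt one_pos,
      Finset.prod_empty]
  | succ n ih => rw [hT.card_level_succ, ih, Finset.prod_Icc_succ_top (by omega)]; ring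

omit hT in
/-- The value of the branching function `g_k` on `(t_n, t_{n+1}]`. -/
def weight (b : ℕ → ℕ) (k n : ℕ) : ℕ := if k ≤ n then ∏ j ∈ Finset.Ioc k n, b j else 0

omit hT in
lemma weight_of_lt {k n : ℕ} (h : n < k) : weight b k n = 0 := if_neg h.not_ge

omit hT in
lemma weight_self (k : ℕ) : weight b k k = 1 := by
  rw [weight, if_pos le_rfl, Finset.Ioc_self, Finset.prod_empty]

omit hT in
lemma weight_succ {k n : ℕ} (h : k ≤ n) : weight b k (n + 1) = b (n + 1) * weight b k n := by
  rw [weight, weight, if_pos h, if_pos (by omega), Finset.prod_Ioc_succ_top (by omega), mul_comm]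

lemma weight_pos {k n : ℕ} (h : k ≤ n) : 0 < weight b k n := by
  rw [weight, if_pos h]
  exact Finset.prod_pos fun j _ => hT.b_pos j

lemma sum_level_of_eq_parent {k n : ℕ} (hkn : k ≤ n) {f : T.Vertex → ℂ}
    (hf : ∀ z, k + 1 < T.gen z → f z = f (T.parent z)) :
    ∑ z ∈ hT.level (n + 1), f z = weight b k n * ∑ z ∈ hT.level (k + 1), f z := by
  induction n, hkn using Nat.le_induction with
  | base => rw [weight_self, Nat.cast_one, one_mul]
  | succ n hkn ih =>
    rw [Finset.sum_congr rfl fun z hz => hf z (by rw [hT.mem_level.1 hz]; omega),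
      hT.sum_level_succ_comp_parent, ih, weight_succ hkn, nsmul_eq_mul, Nat.cast_mul, mul_assoc]

lemma sum_conj_amplitude_mul_amplitude (k n : ℕ) (a a' : T.Vertex → ℂ) :
    ∑ z ∈ hT.level (n + 1), conj (T.amplitude k a z) * T.amplitude k a' z
      = weight b k n * ∑ z ∈ hT.level (k + 1), conj (a z) * a' z := by
  rcases lt_or_ge n k with hnk | hkn
  · rw [weight_of_lt hnk, Nat.cast_zero, zero_mul]
    refine Finset.sum_eq_zero fun z hz => ?_
    rw [amplitude_of_le (a := a') (by rw [hT.mem_level.1 hz]; omega), mul_zero]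
  · rw [hT.sum_level_of_eq_parent hkn fun z hz => by rw [amplitude_of_lt hz, amplitude_of_lt hz]]
    congr 1
    refine Finset.sum_congr rfl fun z hz => ?_
    rw [amplitude_of_eq (hT.mem_level.1 hz), amplitude_of_eq (hT.mem_level.1 hz)]

/-- The values of `a` on the children of each vertex `y ≠ o` of generation `k` sum to zero.
For `k = 0` this is no condition. -/
def SumsToZero (k : ℕ) (a : T.Vertex → ℂ) : Prop :=
  ∀ y, T.gen y = k → y ≠ T.root → ∑ z ∈ hT.children y, a z = 0

lemma sum_conj_amplitude_mul_of_sumsToZero {k k' : ℕ} (hk : k < k') (a : T.Vertex → ℂ)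
    {a' : T.Vertex → ℂ} (ha' : hT.SumsToZero k' a') (n : ℕ) :
    ∑ z ∈ hT.level (n + 1), conj (T.amplitude k a z) * T.amplitude k' a' z = 0 := by
  rcases lt_or_ge n k' with hnk | hkn
  · refine Finset.sum_eq_zero fun z hz => ?_
    rw [amplitude_of_le (k := k') (by rw [hT.mem_level.1 hz]; omega), mul_zero]
  rw [hT.sum_level_of_eq_parent hkn fun z hz => by
    rw [amplitude_of_lt (k := k) (by omega), amplitude_of_lt (k := k') hz], hT.sum_level_succ]
  refine mul_eq_zero_of_right _ (Finset.sum_eq_zero fun y hy => ?_)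
  have hy := hT.mem_level.1 hy
  have hconst : ∀ z ∈ hT.children y, conj (T.amplitude k a z) * T.amplitude k' a' z
      = conj (T.amplitude k a y) * a' z := fun z hz => by
    have hgen := hT.gen_of_mem_children hz
    rw [amplitude_of_lt (k := k) (by omega), amplitude_of_eq (k := k') (by rw [hgen, hy]),
      (hT.mem_children.1 hz).2]
  have hroot : y ≠ T.root := fun h => by rw [h, T.gen_root] at hy; omega
  rw [Finset.sum_congr rfl hconst, ← Finset.mul_sum, ha' y hy hroot, mul_zero]

/-- Extension by zero of a function on the vertices of generation `n`. -/
def extend {n : ℕ} (a : EuclideanSpace ℂ (hT.level n)) (z : T.Vertex) : ℂ :=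
  open Classical in if h : z ∈ hT.level n then a ⟨z, h⟩ else 0

/-- The restriction of a function to the vertices of generation `n`. -/
def restrict (n : ℕ) (f : T.Vertex → ℂ) : EuclideanSpace ℂ (hT.level n) :=
  WithLp.toLp 2 fun z => f z

lemma extend_coe {n : ℕ} (a : EuclideanSpace ℂ (hT.level n)) (z : hT.level n) :
    hT.extend a z = a z := dif_pos z.2

lemma extend_restrict {n : ℕ} (f : T.Vertex → ℂ) {z : T.Vertex} (hz : z ∈ hT.level n) :
    hT.extend (hT.restrict n f) z = f z := dif_pos hz

lemma extend_add {n : ℕ} (a a' : EuclideanSpace ℂ (hT.level n)) (z : T.Vertex) :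
    hT.extend (a + a') z = hT.extend a z + hT.extend a' z := by
  unfold extend
  split_ifs
  · rfl
  · rw [add_zero]

lemma extend_smul {n : ℕ} (c : ℂ) (a : EuclideanSpace ℂ (hT.level n)) (z : T.Vertex) :
    hT.extend (c • a) z = c * hT.extend a z := by
  unfold extend
  split_ifs
  · rfl
  · rw [mul_zero]

lemma inner_eq_sum_extend {n : ℕ} (a a' : EuclideanSpace ℂ (hT.level n)) :
    ⟪a, a'⟫_ℂ = ∑ z ∈ hT.level n, conj (hT.extend a z) * hT.extend a' z := by
  rw [← Finset.sum_coe_sort, PiLp.inner_apply]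
  refine Finset.sum_congr rfl fun z _ => ?_
  rw [hT.extend_coe, hT.extend_coe, RCLike.inner_apply, mul_comm]

/-- The operator that sends a function on the vertices of generation `n + 1` to its sums over the
children of the vertices of generation `n`. -/
def childrenSum (n : ℕ) : EuclideanSpace ℂ (hT.level (n + 1)) →ₗ[ℂ] (hT.level n → ℂ) where
  toFun a y := ∑ z ∈ hT.children y, hT.extend a z
  map_add' a a' := funext fun y => by
    rw [Finset.sum_congr rfl fun z _ => hT.extend_add _ _ z, Finset.sum_add_distrib]
    rfl
  map_smul' c a := funext fun y => by
    rw [Finset.sum_congr rfl fun z _ => hT.extend_smul _ _ z, ← Finset.mul_sum]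
    rfl

lemma childrenSum_surjective (n : ℕ) : Function.Surjective (hT.childrenSum n) := by
  intro c
  refine ⟨hT.restrict (n + 1) fun z => hT.extend (WithLp.toLp 2 c) (T.parent z) / b n,
    funext fun y => ?_⟩
  have hy := hT.mem_level.1 y.2
  have hvalue : ∀ z ∈ hT.children y, hT.extend (hT.restrict (n + 1) fun z =>
      hT.extend (WithLp.toLp 2 c) (T.parent z) / b n) z = c y / b n := fun z hz => by
    rw [hT.extend_restrict _ (hT.mem_level_succ_of_mem_children hz hy), (hT.mem_children.1 hz).2,
      hT.extend_coe]
  change ∑ z ∈ hT.children y, _ = _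
  rw [Finset.sum_congr rfl hvalue, Finset.sum_const, hT.card_children, hy, nsmul_eq_mul,
    mul_div_cancel₀ _ (Nat.cast_ne_zero.2 (hT.b_pos n).ne')]

/-- The functions on the vertices of generation `k + 1` whose values on the children of each
vertex `y ≠ o` sum to zero. -/
def zeroSumSpace : (k : ℕ) → Submodule ℂ (EuclideanSpace ℂ (hT.level (k + 1)))
  | 0 => ⊤
  | k + 1 => (hT.childrenSum (k + 1)).ker

lemma mem_zeroSumSpace_iff {k : ℕ} {a : EuclideanSpace ℂ (hT.level (k + 1))} :
    a ∈ hT.zeroSumSpace k ↔ hT.SumsToZero k (hT.extend a) := by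
  cases k with
  | zero =>
    exact iff_of_true Submodule.mem_top fun y hy hroot => absurd (T.gen_eq_zero_iff.1 hy) hroot
  | succ k =>
    rw [zeroSumSpace, LinearMap.mem_ker]
    constructor
    · exact fun h y hy _ => congrFun h ⟨y, hT.mem_level.2 hy⟩
    · exact fun h => funext fun y =>
        h y (hT.mem_level.1 y.2) (T.ne_root_of_gen_eq_succ (hT.mem_level.1 y.2))

lemma finrank_zeroSumSpace_zero : Module.finrank ℂ (hT.zeroSumSpace 0) = b 0 := by
  rw [zeroSumSpace, finrank_top, finrank_euclideanSpace, Fintype.card_coe, hT.card_level,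
    Finset.Icc_eq_empty_of_lt one_pos, Finset.prod_empty, mul_one]

lemma finrank_zeroSumSpace_succ (k : ℕ) : Module.finrank ℂ (hT.zeroSumSpace (k + 1))
    = (b 0 * ∏ j ∈ Finset.Icc 1 k, b j) * (b (k + 1) - 1) := by
  have hrank := (hT.childrenSum (k + 1)).finrank_range_add_finrank_ker
  rw [LinearMap.range_eq_top.2 (hT.childrenSum_surjective _), finrank_top, finrank_euclideanSpace,
    Fintype.card_coe, Module.finrank_fintype_fun_eq_card, Fintype.card_coe,
    hT.card_level_succ (k + 1), hT.card_level] at hrank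
  rw [zeroSumSpace, Nat.mul_sub_one, mul_comm _ (b (k + 1))]
  omega

/-- An orthonormal basis of the zero sum space. -/
def basis (k : ℕ) : OrthonormalBasis (Fin (Module.finrank ℂ (hT.zeroSumSpace k))) ℂ
    (hT.zeroSumSpace k) := stdOrthonormalBasis ℂ (hT.zeroSumSpace k)

/-- The index set of the decomposition of `L²` of the tree. -/
abbrev Index : Type := Σ k : ℕ, Fin (Module.finrank ℂ (hT.zeroSumSpace k))

/-- The functions on the vertices that define the parts of the decomposition. -/
def amp (i : hT.Index) : T.Vertex → ℂ :=
  T.amplitude i.1 (hT.extend (hT.basis i.1 i.2 : EuclideanSpace ℂ (hT.level (i.1 + 1))))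

lemma sumsToZero_basis (i : hT.Index) : hT.SumsToZero i.1
    (hT.extend (hT.basis i.1 i.2 : EuclideanSpace ℂ (hT.level (i.1 + 1)))) :=
  hT.mem_zeroSumSpace_iff.1 (hT.basis i.1 i.2).2

lemma sum_conj_amp_mul_amp_self (i : hT.Index) (n : ℕ) :
    ∑ z ∈ hT.level (n + 1), conj (hT.amp i z) * hT.amp i z = weight b i.1 n := by
  have hnorm := (hT.basis i.1).inner_eq_one i.2
  rw [Submodule.coe_inner] at hnorm
  unfold amp
  rw [hT.sum_conj_amplitude_mul_amplitude, ← hT.inner_eq_sum_extend, hnorm, mul_one]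

lemma sum_conj_amp_mul_amp_of_ne {i j : hT.Index} (hij : i ≠ j) (n : ℕ) :
    ∑ z ∈ hT.level (n + 1), conj (hT.amp i z) * hT.amp j z = 0 := by
  rcases lt_trichotomy i.1 j.1 with hlt | heq | hgt
  · exact hT.sum_conj_amplitude_mul_of_sumsToZero hlt _ (hT.sumsToZero_basis j) n
  · obtain ⟨k, i⟩ := i
    obtain ⟨k', j⟩ := j
    obtain rfl : k = k' := heq
    have horth := (hT.basis k).inner_eq_zero (i := i) (j := j) fun h => hij (by rw [h])
    rw [Submodule.coe_inner] at horth
    unfold amp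
    rw [hT.sum_conj_amplitude_mul_amplitude, ← hT.inner_eq_sum_extend, horth, mul_zero]
  · have hswap : ∑ z ∈ hT.level (n + 1), conj (hT.amp j z) * hT.amp i z = 0 :=
      hT.sum_conj_amplitude_mul_of_sumsToZero hgt _ (hT.sumsToZero_basis i) n
    rw [← map_eq_zero (starRingEnd ℂ), map_sum]
    simpa only [map_mul, Complex.conj_conj, mul_comm] using hswap

lemma amp_of_le {i : hT.Index} {z : T.Vertex} (h : T.gen z ≤ i.1) : hT.amp i z = 0 :=
  amplitude_of_le h

lemma amp_of_lt {i : hT.Index} {z : T.Vertex} (h : i.1 + 1 < T.gen z) :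
    hT.amp i z = hT.amp i (T.parent z) := amplitude_of_lt h

lemma sum_children_amp {i : hT.Index} {y : T.Vertex} (hy : T.gen y = i.1) (hroot : y ≠ T.root) :
    ∑ z ∈ hT.children y, hT.amp i z = 0 := by
  rw [← hT.sumsToZero_basis i y hy hroot]
  exact Finset.sum_congr rfl fun z hz => amplitude_of_eq (by rw [hT.gen_of_mem_children hz, hy])

lemma sum_conj_mul_eq_zero_of_sumsToZero {n : ℕ} {a c : T.Vertex → ℂ} (ha : hT.SumsToZero n a)
    (hc : ∀ i : hT.Index, i.1 = n → ∑ z ∈ hT.level (n + 1), conj (hT.amp i z) * c z = 0) :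
    ∑ z ∈ hT.level (n + 1), conj (a z) * c z = 0 := by
  have hmem : hT.restrict (n + 1) a ∈ hT.zeroSumSpace n :=
    hT.mem_zeroSumSpace_iff.2 fun y hy hroot => by
      rw [← ha y hy hroot]
      exact Finset.sum_congr rfl fun z hz =>
        hT.extend_restrict a (hT.mem_level_succ_of_mem_children hz hy)
  have hbasis : ∀ j, ⟪(hT.basis n j : EuclideanSpace ℂ (hT.level (n + 1))),
      hT.restrict (n + 1) c⟫_ℂ = 0 := fun j => by
    rw [hT.inner_eq_sum_extend, ← hc ⟨n, j⟩ rfl]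
    refine Finset.sum_congr rfl fun z hz => ?_
    rw [hT.extend_restrict c hz, amp, amplitude_of_eq (hT.mem_level.1 hz)]
  have hinner : ⟪hT.restrict (n + 1) a, hT.restrict (n + 1) c⟫_ℂ = 0 := by
    have hrepr : _ = hT.restrict (n + 1) a :=
      congrArg Subtype.val ((hT.basis n).sum_repr' ⟨_, hmem⟩)
    rw [← hrepr, Submodule.coe_sum, sum_inner]
    refine Finset.sum_eq_zero fun j _ => ?_
    rw [Submodule.coe_smul, inner_smul_left, hbasis, mul_zero]
  rw [← hinner, hT.inner_eq_sum_extend]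
  exact Finset.sum_congr rfl fun z hz => by
    rw [hT.extend_restrict a hz, hT.extend_restrict c hz]

lemma eq_of_parent_eq_of_sum_conj_amp_mul {n : ℕ} {c : T.Vertex → ℂ}
    (hc : ∀ i : hT.Index, i.1 = n → ∑ z ∈ hT.level (n + 1), conj (hT.amp i z) * c z = 0)
    {z z' : T.Vertex} (hz : z ∈ hT.level (n + 1)) (hz' : z' ∈ hT.level (n + 1))
    (hparent : T.parent z = T.parent z') : c z = c z' := by
  classical
  have hroot := T.ne_root_of_gen_eq_succ (hT.mem_level.1 hz)
  have hroot' := T.ne_root_of_gen_eq_succ (hT.mem_level.1 hz')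
  have hsums : hT.SumsToZero n fun v => (if v = z then 1 else 0) - (if v = z' then 1 else 0) := by
    intro y _ _
    simp [hT.mem_children, hroot, hroot', hparent]
  have hsum := hT.sum_conj_mul_eq_zero_of_sumsToZero hsums hc
  simp only [map_sub, apply_ite (starRingEnd ℂ), map_one, map_zero, sub_mul, ite_mul, one_mul,
    zero_mul, Finset.sum_sub_distrib, Finset.sum_ite_eq', hz, hz', if_true] at hsum
  exact sub_eq_zero.1 hsum

/-- A function orthogonal to the amplitudes takes the same value on siblings, hence comes from a
function on the previous level, which is again orthogonal to the amplitudes. -/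
lemma eq_zero_of_sum_conj_amp_mul (n : ℕ) {c : T.Vertex → ℂ}
    (hc : ∀ i : hT.Index, i.1 ≤ n → ∑ z ∈ hT.level (n + 1), conj (hT.amp i z) * c z = 0) :
    ∀ z ∈ hT.level (n + 1), c z = 0 := by
  classical
  induction n generalizing c with
  | zero =>
    intro z hz
    have hsum := hT.sum_conj_mul_eq_zero_of_sumsToZero (a := Pi.single z 1)
      (fun y hy hroot => absurd (T.gen_eq_zero_iff.1 hy) hroot) fun i hi => hc i hi.le
    simpa [Pi.single_apply, apply_ite, hz] using hsum
  | succ n ih =>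
    choose child hchild_root hparent_child using hT.exists_child
    have hchild : ∀ z ∈ hT.level (n + 2), c z = c (child (T.parent z)) := fun z hz => by
      refine hT.eq_of_parent_eq_of_sum_conj_amp_mul (fun i hi => hc i hi.le) hz ?_
        (hparent_child _).symm
      rw [hT.mem_level, ← T.gen_parent (hchild_root _), hparent_child,
        hT.mem_level.1 (hT.parent_mem_level hz)]
    have hzero := ih (c := fun y => c (child y)) fun i hi => by
      have hsum := hc i (by omega)
      rw [Finset.sum_congr rfl fun z hz => by
        rw [hchild z hz, hT.amp_of_lt (i := i) (by rw [hT.mem_level.1 hz]; omega)],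
        hT.sum_level_succ_comp_parent (n + 1) fun y => conj (hT.amp i y) * c (child y)] at hsum
      exact (smul_eq_zero.1 hsum).resolve_left (hT.b_pos _).ne'
    exact fun z hz => (hchild z hz).trans (hzero _ (hT.parent_mem_level hz))

end IsRegularWith

end RootedMetricTree

/-! ### Integration on regular trees -/

/-- Lebesgue measure on the interval `(t_n, t_{n+1}]`. -/
def stepMeasure (t : ℕ → ℝ) (n : ℕ) : Measure ℝ := volume.restrict (Ioc (t n) (t (n + 1)))

instance (t : ℕ → ℝ) (n : ℕ) : IsFiniteMeasure (stepMeasure t n) :=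
  inferInstanceAs (IsFiniteMeasure (volume.restrict (Ioc (t n) (t (n + 1)))))

lemma ae_stepMeasure_mem (t : ℕ → ℝ) (n : ℕ) : ∀ᵐ s ∂stepMeasure t n, s ∈ Ioc (t n) (t (n + 1)) :=
  ae_restrict_mem measurableSet_Ioc

/-- The number `n` with `s ∈ (t_n, t_{n+1}]`. -/
def stepIndex (t : ℕ → ℝ) (s : ℝ) : ℕ := sInf {n | s ≤ t (n + 1)}

lemma stepIndex_eq {t : ℕ → ℝ} (ht : StrictMono t) {n : ℕ} {s : ℝ}
    (hs : s ∈ Ioc (t n) (t (n + 1))) : stepIndex t s = n := by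
  refine le_antisymm (Nat.sInf_le hs.2) (le_csInf ⟨n, hs.2⟩ fun j hj => ?_)
  exact Nat.lt_succ_iff.1 (ht.lt_iff_lt.1 (hs.1.trans_le hj))

namespace RootedMetricTree

instance (T : RootedMetricTree) : DiscreteMeasurableSpace T.Vertex := ⟨fun _ => trivial⟩

lemma measurableEmbedding_mk {T : RootedMetricTree} (z : T.Vertex) :
    MeasurableEmbedding (Prod.mk z : ℝ → T.Vertex × ℝ) :=
  MeasurableEmbedding.prodMk_left z MeasurableEmbedding.id

lemma measurable_comp_fst {T : RootedMetricTree} (a : T.Vertex → ℂ) :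
    Measurable fun x : T.Vertex × ℝ => a x.1 :=
  (measurable_from_top (f := a)).comp measurable_fst

namespace IsRegularWith

variable {T : RootedMetricTree} {b : ℕ → ℕ} {t : ℕ → ℝ} (hT : T.IsRegularWith b t)

include hT

lemma measure_eq_sum : T.measure = Measure.sum fun n =>
    ∑ z ∈ hT.level (n + 1), (stepMeasure t n).map (Prod.mk z) := by
  classical
  ext s hs
  rw [RootedMetricTree.measure, Measure.sum_apply _ hs, Measure.sum_apply _ hs]
  set edgeMass : T.Vertex → ℝ≥0∞ := fun z =>
    ((volume.restrict (Ioc (T.height (T.parent z)) (T.height z))).map (Prod.mk z)) s with hmass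
  have hlevel : ∀ n, (∑ z ∈ hT.level (n + 1), (stepMeasure t n).map (Prod.mk z)) s
      = ∑' z, if T.gen z = n + 1 then edgeMass z else 0 := by
    intro n
    rw [Measure.coe_finsetSum, Finset.sum_apply, tsum_eq_sum (s := hT.level (n + 1)) fun z hz =>
      if_neg fun h => hz (hT.mem_level.2 h)]
    refine Finset.sum_congr rfl fun z hz => ?_
    have hgen := hT.mem_level.1 hz
    rw [if_pos hgen, hmass, stepMeasure]
    simp only [hT.height_eq, hgen, T.gen_parent_of_gen_eq_succ hgen]
  have hvertex : ∀ z, {y : T.Vertex | y ≠ T.root}.indicator edgeMass z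
      = ∑' n, if T.gen z = n + 1 then edgeMass z else 0 := by
    intro z
    by_cases hz : z = T.root
    · rw [indicator_of_notMem (by simpa using hz), eq_comm, ENNReal.tsum_eq_zero]
      exact fun n => if_neg (by rw [hz, T.gen_root]; omega)
    · rw [indicator_of_mem (by simpa using hz), tsum_eq_single (T.gen (T.parent z)),
        if_pos (T.gen_parent hz).symm]
      exact fun n hn => if_neg fun h => hn (T.gen_parent_of_gen_eq_succ h).symm
  calc ∑' y : {y : T.Vertex // y ≠ T.root}, edgeMass y
      = ∑' z, ∑' n, if T.gen z = n + 1 then edgeMass z else 0 :=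
        (tsum_subtype {y : T.Vertex | y ≠ T.root} edgeMass).trans (tsum_congr hvertex)
    _ = _ := ENNReal.tsum_comm.trans (tsum_congr fun n => (hlevel n).symm)

lemma lintegral_measure (f : T.Vertex × ℝ → ℝ≥0∞) : ∫⁻ x, f x ∂T.measure
    = ∑' n, ∑ z ∈ hT.level (n + 1), ∫⁻ s, f (z, s) ∂stepMeasure t n := by
  rw [hT.measure_eq_sum, lintegral_sum_measure]
  refine tsum_congr fun n => ?_
  rw [lintegral_finsetSum_measure]
  exact Finset.sum_congr rfl fun z _ => (measurableEmbedding_mk z).lintegral_map f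

lemma integral_measure {f : T.Vertex × ℝ → ℂ} (hf : Integrable f T.measure) : ∫ x, f x ∂T.measure
    = ∑' n, ∫ s, ∑ z ∈ hT.level (n + 1), f (z, s) ∂stepMeasure t n := by
  rw [hT.measure_eq_sum] at hf ⊢
  rw [integral_sum_measure hf]
  refine tsum_congr fun n => ?_
  have hlevel := integrable_finsetSum_measure.1 (hf.mono_measure (Measure.le_sum _ n))
  rw [integral_finsetSum_measure hlevel, integral_finsetSum (f := fun z s => f (z, s)) _
    fun z hz => (measurableEmbedding_mk z).integrable_map_iff.1 (hlevel z hz)]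
  exact Finset.sum_congr rfl fun z _ => (measurableEmbedding_mk z).integral_map f

lemma ae_measure_iff {Q : T.Vertex × ℝ → Prop} : (∀ᵐ x ∂T.measure, Q x) ↔
    ∀ n, ∀ᵐ s ∂stepMeasure t n, ∀ z ∈ hT.level (n + 1), Q (z, s) := by
  rw [hT.measure_eq_sum, Measure.ae_sum_iff]
  refine forall_congr' fun n => ?_
  rw [ae_finsetSum_measure_iff, Filter.eventually_all_finset]
  exact forall₂_congr fun z _ => (measurableEmbedding_mk z).ae_map_iff

omit hT in
lemma weightedMeasure_eq_sum (b : ℕ → ℕ) (t : ℕ → ℝ) (k : ℕ) :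
    RegularTree.weightedMeasure b t k
      = Measure.sum fun n => (weight b k n : ℝ≥0∞) • stepMeasure t n := by
  have hdensity : RegularTree.branchingFunction b t k
      = ∑' n : ℕ, (Ioc (t (k + n)) (t (k + n + 1))).indicator
      (fun _ => ∏ j ∈ Finset.Ioc k (k + n), (b j : ℝ≥0∞)) := by
    ext s
    rw [RegularTree.branchingFunction, tsum_apply (Pi.summable.2 fun s => ENNReal.summable)]
  rw [RegularTree.weightedMeasure, hdensity, withDensity_tsum fun n =>
    measurable_const.indicator measurableSet_Ioc]
  ext s hs
  rw [Measure.sum_apply _ hs, Measure.sum_apply _ hs,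
    ← (add_right_injective k).tsum_eq (f := fun n => ((weight b k n : ℝ≥0∞) • stepMeasure t n) s)]
  · refine tsum_congr fun n => ?_
    rw [withDensity_indicator measurableSet_Ioc, withDensity_const, stepMeasure, weight,
      if_pos (by omega), Nat.cast_prod]
  · intro n hn
    have hkn : ¬ n < k := fun h => hn (by simp [weight_of_lt h])
    exact ⟨n - k, Nat.add_sub_cancel' (not_lt.1 hkn)⟩

omit hT in
lemma lintegral_weightedMeasure (k : ℕ) (f : ℝ → ℝ≥0∞) :
    ∫⁻ s, f s ∂(RegularTree.weightedMeasure b t k)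
      = ∑' n, (weight b k n : ℝ≥0∞) * ∫⁻ s, f s ∂stepMeasure t n := by
  rw [weightedMeasure_eq_sum, lintegral_sum_measure]
  exact tsum_congr fun n => by rw [lintegral_smul_measure, smul_eq_mul]

omit hT in
lemma integral_weightedMeasure {k : ℕ} {f : ℝ → ℂ}
    (hf : Integrable f (RegularTree.weightedMeasure b t k)) :
    ∫ s, f s ∂(RegularTree.weightedMeasure b t k)
      = ∑' n, (weight b k n : ℂ) * ∫ s, f s ∂stepMeasure t n := by
  rw [weightedMeasure_eq_sum] at hf ⊢
  rw [integral_sum_measure hf]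
  refine tsum_congr fun n => ?_
  rw [integral_smul_measure, ENNReal.toReal_natCast, Complex.real_smul, Complex.ofReal_natCast]

lemma ae_weightedMeasure_iff {k : ℕ} {Q : ℝ → Prop} :
    (∀ᵐ s ∂(RegularTree.weightedMeasure b t k), Q s) ↔
      ∀ n, k ≤ n → ∀ᵐ s ∂stepMeasure t n, Q s := by
  rw [weightedMeasure_eq_sum, Measure.ae_sum_iff]
  refine forall_congr' fun n => ?_
  by_cases h : k ≤ n
  · rw [Measure.ae_ennreal_smul_measure_iff (by exact_mod_cast (hT.weight_pos h).ne')]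
    simp only [h, forall_const]
  · rw [weight_of_lt (by omega), Nat.cast_zero, zero_smul]
    simp only [ae_zero, Filter.eventually_bot, h, false_implies]

/-! ### The orthogonal decomposition of `L²` of a regular tree -/

lemma sum_norm_amp_sq (i : hT.Index) (n : ℕ) :
    ∑ z ∈ hT.level (n + 1), ‖hT.amp i z‖ ^ 2 = weight b i.1 n := by
  have hsum := hT.sum_conj_amp_mul_amp_self i n
  simp only [Complex.conj_mul'] at hsum
  exact_mod_cast hsum

lemma sum_enorm_amp_sq (i : hT.Index) (n : ℕ) :
    ∑ z ∈ hT.level (n + 1), ‖hT.amp i z‖ₑ ^ 2 = weight b i.1 n := by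
  rw [← ENNReal.ofReal_natCast, ← hT.sum_norm_amp_sq i n,
    ENNReal.ofReal_sum_of_nonneg fun _ _ => by positivity]
  exact Finset.sum_congr rfl fun z _ => by rw [ENNReal.ofReal_pow (norm_nonneg _), ofReal_norm]

lemma measurePreserving_snd (i : hT.Index) :
    MeasurePreserving Prod.snd (T.measure.withDensity fun x => ‖hT.amp i x.1‖ₑ ^ 2)
      (RegularTree.weightedMeasure b t i.1) := by
  refine ⟨measurable_snd, Measure.ext fun s hs => ?_⟩
  rw [Measure.map_apply measurable_snd hs, withDensity_apply _ (measurable_snd hs),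
    ← lintegral_indicator (measurable_snd hs), hT.lintegral_measure, weightedMeasure_eq_sum,
    Measure.sum_apply _ hs]
  refine tsum_congr fun n => ?_
  rw [Measure.smul_apply, smul_eq_mul, ← hT.sum_enorm_amp_sq, Finset.sum_mul]
  refine Finset.sum_congr rfl fun z _ => ?_
  change ∫⁻ s', s.indicator (fun _ => ‖hT.amp i z‖ₑ ^ 2) s' ∂stepMeasure t n = _
  rw [lintegral_indicator hs, setLIntegral_const]

/-- The isometry that sends a function `u` of the distance from the root to the function whose
value is `amp i z * u` on the edge that terminates at `z`. -/
def embed (i : hT.Index) : Lp ℂ 2 (RegularTree.weightedMeasure b t i.1) →ₗᵢ[ℂ] Lp ℂ 2 T.measure :=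
  weightedComp (measurable_comp_fst (hT.amp i)) (hT.measurePreserving_snd i)

lemma coeFn_embed (i : hT.Index) {u : Lp ℂ 2 (RegularTree.weightedMeasure b t i.1)} {F : ℝ → ℂ}
    (hF : u =ᵐ[RegularTree.weightedMeasure b t i.1] F) :
    hT.embed i u =ᵐ[T.measure] fun x => hT.amp i x.1 * F x.2 :=
  coeFn_weightedComp _ _ hF

/-- The mean, weighted by `conj (amp i)`, of a function on the vertices of generation `n + 1`;
it is `0` for `n < i.1`. -/
def levelMean (i : hT.Index) (n : ℕ) (c : T.Vertex → ℂ) : ℂ :=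
  (weight b i.1 n : ℂ)⁻¹ * ∑ z ∈ hT.level (n + 1), conj (hT.amp i z) * c z

lemma weight_mul_levelMean (i : hT.Index) (n : ℕ) (c : T.Vertex → ℂ) :
    weight b i.1 n * hT.levelMean i n c = ∑ z ∈ hT.level (n + 1), conj (hT.amp i z) * c z := by
  rcases lt_or_ge n i.1 with hn | hn
  · rw [weight_of_lt hn, Nat.cast_zero, zero_mul, eq_comm]
    refine Finset.sum_eq_zero fun z hz => ?_
    rw [hT.amp_of_le (by rw [hT.mem_level.1 hz]; omega), map_zero, zero_mul]
  · exact mul_inv_cancel_left₀ (Nat.cast_ne_zero.2 (hT.weight_pos hn).ne') _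

lemma sum_inner_amp_mul (i : hT.Index) (n : ℕ) (x : ℂ) (c : T.Vertex → ℂ) :
    ∑ z ∈ hT.level (n + 1), ⟪hT.amp i z * x, c z⟫_ℂ
      = weight b i.1 n * ⟪x, hT.levelMean i n c⟫_ℂ := by
  rw [RCLike.inner_apply, ← mul_assoc, hT.weight_mul_levelMean, Finset.sum_mul]
  refine Finset.sum_congr rfl fun z _ => ?_
  rw [RCLike.inner_apply, map_mul]
  ring

lemma weight_mul_norm_levelMean_sq_le (i : hT.Index) (n : ℕ) (c : T.Vertex → ℂ) :
    weight b i.1 n * ‖hT.levelMean i n c‖ ^ 2 ≤ ∑ z ∈ hT.level (n + 1), ‖c z‖ ^ 2 := by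
  set w : ℝ := (weight b i.1 n : ℝ) with hw
  have hcauchySchwarz : (w * ‖hT.levelMean i n c‖) ^ 2
      ≤ w * ∑ z ∈ hT.level (n + 1), ‖c z‖ ^ 2 := by
    have hnorm : w * ‖hT.levelMean i n c‖
        = ‖∑ z ∈ hT.level (n + 1), conj (hT.amp i z) * c z‖ := by
      rw [← hT.weight_mul_levelMean, norm_mul, Complex.norm_natCast]
    rw [hnorm, hw, ← hT.sum_norm_amp_sq i n]
    refine le_trans ?_ (Finset.sum_mul_sq_le_sq_mul_sq _ _ _)
    gcongr
    refine (norm_sum_le _ _).trans_eq (Finset.sum_congr rfl fun z _ => ?_)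
    rw [norm_mul, RCLike.norm_conj]
  have hnonneg : 0 ≤ w := Nat.cast_nonneg _
  rcases hnonneg.eq_or_lt with hzero | hpos
  · rw [← hzero, zero_mul]
    positivity
  · refine le_of_mul_le_mul_left (le_trans (le_of_eq ?_) hcauchySchwarz) hpos
    ring

lemma weight_mul_enorm_levelMean_sq_le (i : hT.Index) (n : ℕ) (c : T.Vertex → ℂ) :
    weight b i.1 n * ‖hT.levelMean i n c‖ₑ ^ 2 ≤ ∑ z ∈ hT.level (n + 1), ‖c z‖ₑ ^ 2 := by
  have hle := ENNReal.ofReal_le_ofReal (hT.weight_mul_norm_levelMean_sq_le i n c)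
  rw [ENNReal.ofReal_mul (Nat.cast_nonneg _), ENNReal.ofReal_natCast,
    ENNReal.ofReal_sum_of_nonneg fun _ _ => by positivity] at hle
  simpa only [ENNReal.ofReal_pow (norm_nonneg _), ofReal_norm] using hle

/-- The weighted mean over the points of the tree at distance `s` from the root. -/
def fiberMean (i : hT.Index) (f : T.Vertex → ℝ → ℂ) (s : ℝ) : ℂ :=
  hT.levelMean i (stepIndex t s) fun z => f z s

lemma fiberMean_eq (i : hT.Index) (f : T.Vertex → ℝ → ℂ) {n : ℕ} {s : ℝ}
    (hs : s ∈ Ioc (t n) (t (n + 1))) :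
    hT.fiberMean i f s = hT.levelMean i n fun z => f z s := by
  rw [fiberMean, stepIndex_eq hT.t_strictMono hs]

lemma fiberMean_ae_eq (i : hT.Index) (f : T.Vertex → ℝ → ℂ) (n : ℕ) :
    hT.fiberMean i f =ᵐ[stepMeasure t n] fun s => hT.levelMean i n fun z => f z s := by
  filter_upwards [ae_stepMeasure_mem t n] with s hs
  exact hT.fiberMean_eq i f hs

lemma memLp_fiberMean (i : hT.Index) (f : Lp ℂ 2 T.measure) :
    MemLp (hT.fiberMean i fun z s => f (z, s)) 2 (RegularTree.weightedMeasure b t i.1) := by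
  have hf := (Lp.stronglyMeasurable f).measurable
  have hmeas : ∀ n, Measurable fun s : ℝ => hT.levelMean i n fun z => f (z, s) := fun n =>
    (Finset.measurable_fun_sum _ fun z _ =>
      (hf.comp measurable_prodMk_left).const_mul _).const_mul _
  constructor
  · rw [weightedMeasure_eq_sum, aestronglyMeasurable_sum_measure_iff]
    exact fun n => ((hmeas n).aestronglyMeasurable.congr
      (hT.fiberMean_ae_eq i _ n).symm).smul_measure _
  · have hfin := (Lp.memLp f).2
    rw [eLpNorm_lt_top_iff_lintegral_rpow_enorm_lt_top two_ne_zero ENNReal.ofNat_ne_top] at hfin ⊢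
    refine lt_of_le_of_lt ?_ hfin
    rw [lintegral_weightedMeasure, hT.lintegral_measure]
    refine ENNReal.tsum_le_tsum fun n => ?_
    simp only [ENNReal.toReal_ofNat, ENNReal.rpow_ofNat]
    rw [← lintegral_const_mul' _ _ (ENNReal.natCast_ne_top _), ← lintegral_finsetSum
      (f := fun z s => ‖f (z, s)‖ₑ ^ 2) _ fun z _ =>
        (hf.comp measurable_prodMk_left).enorm.pow_const 2]
    refine lintegral_mono_ae ?_
    filter_upwards [hT.fiberMean_ae_eq i (fun z s => f (z, s)) n] with s hs
    rw [hs]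
    exact hT.weight_mul_enorm_levelMean_sq_le i n fun z => f (z, s)

lemma coeFn_coisometry_embed (i : hT.Index) (f : Lp ℂ 2 T.measure) :
    coisometry (hT.embed i) f =ᵐ[RegularTree.weightedMeasure b t i.1]
      hT.fiberMean i fun z s => f (z, s) := by
  have hmem := hT.memLp_fiberMean i f
  suffices coisometry (hT.embed i) f = hmem.toLp by rw [this]; exact hmem.coeFn_toLp
  refine ext_inner_left ℂ fun u => ?_
  have hinner : (fun s => ⟪u s, hmem.toLp _ s⟫_ℂ) =ᵐ[RegularTree.weightedMeasure b t i.1]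
      fun s => ⟪u s, hT.fiberMean i (fun z s => f (z, s)) s⟫_ℂ := by
    filter_upwards [hmem.coeFn_toLp] with s hs
    rw [hs]
  rw [inner_coisometry_right, L2.inner_def, L2.inner_def,
    hT.integral_measure (L2.integrable_inner _ _), integral_congr_ae hinner,
    integral_weightedMeasure ((L2.integrable_inner _ _).congr hinner)]
  refine tsum_congr fun n => ?_
  rw [← integral_const_mul]
  refine integral_congr_ae ?_
  filter_upwards [hT.ae_measure_iff.1 (hT.coeFn_embed i (Filter.EventuallyEq.refl _ u)) n,
    hT.fiberMean_ae_eq i (fun z s => f (z, s)) n] with s hembed hmean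
  rw [hmean, ← hT.sum_inner_amp_mul]
  exact Finset.sum_congr rfl fun z hz => by rw [hembed z hz]

lemma orthogonalFamily_embed : OrthogonalFamily ℂ
    (fun i : hT.Index => Lp ℂ 2 (RegularTree.weightedMeasure b t i.1)) hT.embed := by
  intro i j hij u v
  rw [L2.inner_def, hT.integral_measure (L2.integrable_inner _ _)]
  refine (tsum_congr fun n => integral_eq_zero_of_ae ?_).trans tsum_zero
  filter_upwards [hT.ae_measure_iff.1 (hT.coeFn_embed i (Filter.EventuallyEq.refl _ u)) n,
    hT.ae_measure_iff.1 (hT.coeFn_embed j (Filter.EventuallyEq.refl _ v)) n] with s hu hv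
  calc ∑ z ∈ hT.level (n + 1), ⟪hT.embed i u (z, s), hT.embed j v (z, s)⟫_ℂ
      = ∑ z ∈ hT.level (n + 1), conj (hT.amp i z) * hT.amp j z * (conj (u s) * v s) :=
        Finset.sum_congr rfl fun z hz => by
          rw [hu z hz, hv z hz, RCLike.inner_apply, map_mul]
          ring
    _ = 0 := by rw [← Finset.sum_mul, hT.sum_conj_amp_mul_amp_of_ne hij, zero_mul]

lemma eq_zero_of_forall_coisometry_embed_eq_zero (f : Lp ℂ 2 T.measure)
    (h : ∀ i, coisometry (hT.embed i) f = 0) : f = 0 := by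
  have hsum : ∀ n, ∀ i : hT.Index, ∀ᵐ s ∂stepMeasure t n, i.1 ≤ n →
      ∑ z ∈ hT.level (n + 1), conj (hT.amp i z) * f (z, s) = 0 := by
    intro n i
    rw [Filter.eventually_imp_distrib_left]
    intro hi
    have hzero := hT.coeFn_coisometry_embed i f
    rw [h i] at hzero
    filter_upwards [hT.ae_weightedMeasure_iff.1 ((Lp.coeFn_zero ℂ 2 _).symm.trans hzero) n hi,
      hT.fiberMean_ae_eq i (fun z s => f (z, s)) n] with s hs hmean
    rw [← hT.weight_mul_levelMean, ← hmean, ← hs, Pi.zero_apply, mul_zero]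
  refine Lp.ext (Filter.EventuallyEq.trans ?_ (Lp.coeFn_zero ℂ 2 _).symm)
  refine hT.ae_measure_iff.2 fun n => ?_
  filter_upwards [ae_all_iff.2 (hsum n)] with s hs
  exact hT.eq_zero_of_sum_conj_amp_mul n (c := fun z => f (z, s)) hs

lemma isHilbertSum_embed : IsHilbertSum ℂ
    (fun i : hT.Index => Lp ℂ 2 (RegularTree.weightedMeasure b t i.1)) hT.embed :=
  isHilbertSum_of_forall_coisometry_eq_zero hT.orthogonalFamily_embed
    hT.eq_zero_of_forall_coisometry_embed_eq_zero

end IsRegularWith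

end RootedMetricTree

/-! ### Absolutely continuous functions -/

namespace IsPrimitiveOn

variable {a b c : ℝ} {F G F' G' : ℝ → ℂ}

lemma refl (a : ℝ) (F G : ℝ → ℂ) : IsPrimitiveOn a a F G :=
  ⟨IntervalIntegrable.refl, fun s hs => by
    rw [Icc_self, mem_singleton_iff] at hs
    rw [hs, intervalIntegral.integral_same, add_zero]⟩

lemma trans (hab : a ≤ b) (hbc : b ≤ c) (h : IsPrimitiveOn a b F G) (h' : IsPrimitiveOn b c F G) :
    IsPrimitiveOn a c F G := by
  refine ⟨h.1.trans h'.1, fun s hs => ?_⟩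
  rcases le_total s b with hsb | hsb
  · exact h.2 s ⟨hs.1, hsb⟩
  · rw [h'.2 s ⟨hsb, hs.2⟩, h.2 b ⟨hab, le_rfl⟩, add_assoc,
      intervalIntegral.integral_add_adjacent_intervals h.1]
    refine h'.1.mono_set ?_
    rw [uIcc_of_le hsb, uIcc_of_le hbc]
    exact Icc_subset_Icc_right hs.2

lemma mono {a' b' : ℝ} (h : IsPrimitiveOn a b F G) (ha : a ≤ a') (hab : a' ≤ b') (hb : b' ≤ b) :
    IsPrimitiveOn a' b' F G := by
  have hint : ∀ {x y}, a ≤ x → x ≤ y → y ≤ b → IntervalIntegrable G volume x y := by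
    intro x y hax hxy hyb
    refine h.1.mono_set ?_
    rw [uIcc_of_le hxy, uIcc_of_le (hax.trans (hxy.trans hyb))]
    exact Icc_subset_Icc hax hyb
  refine ⟨hint ha hab hb, fun s hs => ?_⟩
  rw [h.2 s ⟨ha.trans hs.1, hs.2.trans hb⟩, h.2 a' ⟨ha, hab.trans hb⟩, add_assoc,
    intervalIntegral.integral_add_adjacent_intervals (hint le_rfl ha (hab.trans hb))
      (hint ha hs.1 (hs.2.trans hb))]

lemma congr (hab : a ≤ b) (h : IsPrimitiveOn a b F G) (hF : ∀ s ∈ Icc a b, F' s = F s)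
    (hG : G' =ᵐ[volume.restrict (Ioc a b)] G) : IsPrimitiveOn a b F' G' := by
  refine ⟨h.1.congr_ae (by rw [uIoc_of_le hab]; exact hG.symm), fun s hs => ?_⟩
  rw [hF s hs, hF a (left_mem_Icc.2 hab), h.2 s hs, intervalIntegral.integral_of_le hs.1,
    intervalIntegral.integral_of_le hs.1]
  exact congrArg _ (integral_congr_ae
    (ae_restrict_of_ae_restrict_of_subset (Ioc_subset_Ioc_right hs.2) hG.symm))

lemma sum {ι : Type*} (s : Finset ι) {f g : ι → ℝ → ℂ} (e : ι → ℂ)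
    (h : ∀ i ∈ s, IsPrimitiveOn a b (f i) (g i)) :
    IsPrimitiveOn a b (fun x => ∑ i ∈ s, e i * f i x) (fun x => ∑ i ∈ s, e i * g i x) := by
  classical
  induction s using Finset.induction_on with
  | empty => simpa using IsPrimitiveOn.zero a b
  | insert i s hi ih =>
    simp only [Finset.sum_insert hi]
    exact ((h i (by simp)).smul (e i)).add (ih fun j hj => h j (by simp [hj]))

end IsPrimitiveOn

section L2

variable {X : Type*} [MeasurableSpace X] {μ ν : Measure X}

lemma integrable_of_le [IsFiniteMeasure ν] (hν : ν ≤ μ) (f : Lp ℂ 2 μ) : Integrable f ν :=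
  ((Lp.memLp f).mono_measure hν).integrable one_le_two

lemma continuous_integral_of_le [IsFiniteMeasure ν] (hν : ν ≤ μ) :
    Continuous fun f : Lp ℂ 2 μ => ∫ x, f x ∂ν := by
  set C : ℝ≥0∞ := ν univ ^ (1 / (1 : ℝ≥0∞).toReal - 1 / (2 : ℝ≥0∞).toReal)
  have hC : C ≠ ∞ := ENNReal.rpow_ne_top_of_nonneg (by norm_num) (measure_ne_top ν univ)
  refine continuous_iff_continuousAt.2 fun g =>
    tendsto_integral_of_L1' g (integrable_of_le hν g).1
      (Filter.Eventually.of_forall fun f => integrable_of_le hν f) ?_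
  have hnorm : Filter.Tendsto (fun f : Lp ℂ 2 μ => eLpNorm (⇑f - ⇑g) 2 μ * C) (𝓝 g) (𝓝 0) := by
    have hLp := (Lp.tendsto_Lp_iff_tendsto_eLpNorm' (fun f : Lp ℂ 2 μ => f) g).1 Filter.tendsto_id
    simpa only [zero_mul] using ENNReal.Tendsto.mul_const hLp (Or.inr hC)
  refine tendsto_of_tendsto_of_tendsto_of_le_of_le tendsto_const_nhds hnorm
    (fun _ => zero_le) fun f => ?_
  refine (eLpNorm_le_eLpNorm_mul_rpow_measure_univ one_le_two
    ((integrable_of_le hν f).sub (integrable_of_le hν g)).1).trans ?_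
  gcongr

lemma isClosed_setOf_ae_eq (L : Lp ℂ 2 μ → X → ℂ)
    (hL : ∀ᵐ x ∂μ, Continuous fun g => L g x) :
    IsClosed {p : Lp ℂ 2 μ × Lp ℂ 2 μ | p.1 =ᵐ[μ] L p.2} := by
  refine IsSeqClosed.isClosed fun p q hp hpq => ?_
  obtain ⟨φ, hφ, hlim⟩ := (tendstoInMeasure_of_tendsto_Lp
    ((continuous_fst.tendsto q).comp hpq)).exists_seq_tendsto_ae
  filter_upwards [hL, hlim, ae_all_iff.2 hp] with x hx hlimx hpx
  simp only [Function.comp_apply, hpx] at hlimx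
  exact tendsto_nhds_unique hlimx
    (((hx.tendsto q.2).comp ((continuous_snd.tendsto q).comp hpq)).comp hφ.tendsto_atTop)

end L2

/-! ### Closedness of the Sobolev spaces -/

namespace RootedMetricTree

variable (T : RootedMetricTree)

lemma vertex_induction {P : T.Vertex → Prop} (hroot : P T.root)
    (hstep : ∀ y, y ≠ T.root → P (T.parent y) → P y) (y : T.Vertex) : P y := by
  induction hn : T.gen y generalizing y with
  | zero => rwa [T.gen_eq_zero_iff.1 hn]
  | succ n ih =>
    exact hstep y (T.ne_root_of_gen_eq_succ hn) (ih _ (T.gen_parent_of_gen_eq_succ hn))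

lemma height_parent_lt {y : T.Vertex} (hy : y ≠ T.root) : T.height (T.parent y) < T.height y := by
  rw [T.height_parent hy]
  exact lt_add_of_pos_right _ (T.length_pos y hy)

/-- Lebesgue measure on the part of the edge that terminates at `y` up to distance `s` from the
root. -/
def edgeMeasure (y : T.Vertex) (s : ℝ) : Measure (T.Vertex × ℝ) :=
  (volume.restrict (Ioc (T.height (T.parent y)) s)).map (Prod.mk y)

instance (y : T.Vertex) (s : ℝ) : IsFiniteMeasure (T.edgeMeasure y s) :=
  inferInstanceAs (IsFiniteMeasure (Measure.map _ _))

variable {T} in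
lemma edgeMeasure_le {y : T.Vertex} (hy : y ≠ T.root) {s : ℝ} (hs : s ≤ T.height y) :
    T.edgeMeasure y s ≤ T.measure :=
  (Measure.map_mono (Measure.restrict_mono (Ioc_subset_Ioc_right hs) le_rfl)
    measurable_prodMk_left).trans (Measure.le_sum (fun y : {y : T.Vertex // y ≠ T.root} =>
      (volume.restrict (Ioc (T.height (T.parent y)) (T.height y))).map (Prod.mk y.1)) ⟨y, hy⟩)

/-- The integral of `g` over the path from the root to `y`. -/
def pathIntegral (g : T.Vertex × ℝ → ℂ) (y : T.Vertex) : ℂ :=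
  ∑ i ∈ Finset.range (T.gen y),
    ∫ x, g x ∂T.edgeMeasure (T.parent^[i] y) (T.height (T.parent^[i] y))

/-- The integral of `g` over the path from the root to a point. -/
def primitive (g : T.Vertex × ℝ → ℂ) (x : T.Vertex × ℝ) : ℂ :=
  T.pathIntegral g (T.parent x.1) + ∫ x', g x' ∂T.edgeMeasure x.1 x.2

variable {g : T.Vertex × ℝ → ℂ}

lemma pathIntegral_root : T.pathIntegral g T.root = 0 := by
  rw [pathIntegral, T.gen_root, Finset.sum_range_zero]

lemma integral_edgeMeasure (g : T.Vertex × ℝ → ℂ) {y : T.Vertex} {s : ℝ}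
    (hs : T.height (T.parent y) ≤ s) :
    ∫ x, g x ∂T.edgeMeasure y s = ∫ τ in T.height (T.parent y)..s, g (y, τ) := by
  rw [edgeMeasure, (measurableEmbedding_mk y).integral_map, intervalIntegral.integral_of_le hs]

variable {T} {y : T.Vertex}

lemma pathIntegral_eq (hy : y ≠ T.root) :
    T.pathIntegral g y = T.primitive g (y, T.height y) := by
  rw [pathIntegral, ← T.gen_parent hy, Finset.sum_range_succ']
  rfl

lemma primitive_height_parent : T.primitive g (y, T.height (T.parent y))
    = T.pathIntegral g (T.parent y) := by
  rw [primitive, T.integral_edgeMeasure g le_rfl, intervalIntegral.integral_same, add_zero]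

lemma isPrimitive_primitive (f : Lp ℂ 2 T.measure) :
    T.IsPrimitive (fun y s => T.primitive f (y, s)) fun y s => f (y, s) := by
  refine ⟨⟨T.pathIntegral f, T.pathIntegral_root, fun y hy =>
    ⟨primitive_height_parent, (pathIntegral_eq hy).symm⟩⟩, fun y hy => ⟨?_, fun s hs => ?_⟩⟩
  · rw [intervalIntegrable_iff_integrableOn_Ioc_of_le (T.height_parent_lt hy).le]
    exact (measurableEmbedding_mk y).integrable_map_iff.1
      (integrable_of_le (edgeMeasure_le hy le_rfl) f)
  · beta_reduce
    rw [primitive_height_parent, primitive, T.integral_edgeMeasure f hs.1]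

lemma ae_edge {Q : T.Vertex × ℝ → Prop} (hQ : ∀ᵐ x ∂T.measure, Q x) (hy : y ≠ T.root) :
    ∀ᵐ s ∂volume.restrict (Ioc (T.height (T.parent y)) (T.height y)), Q (y, s) :=
  (measurableEmbedding_mk y).ae_map_iff.1
    ((edgeMeasure_le hy le_rfl).absolutelyContinuous.ae_le hQ)

lemma IsPrimitive.eq_primitive {F G : T.Vertex → ℝ → ℂ} (hFG : T.IsPrimitive F G)
    (hg : ∀ᵐ x ∂T.measure, g x = G x.1 x.2) (hy : y ≠ T.root) {s : ℝ}
    (hs : s ∈ Icc (T.height (T.parent y)) (T.height y)) : F y s = T.primitive g (y, s) := by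
  obtain ⟨⟨c, hroot, hc⟩, hprim⟩ := hFG
  have hedge : ∀ y, y ≠ T.root → ∀ s ∈ Icc (T.height (T.parent y)) (T.height y),
      F y s = c (T.parent y) + ∫ x, g x ∂T.edgeMeasure y s := by
    intro y hy s hs
    have hGg := (hprim y hy).congr (T.height_parent_lt hy).le (fun _ _ => rfl) (ae_edge hg hy)
    rw [hGg.2 s hs, (hc y hy).1, T.integral_edgeMeasure g hs.1]
  have hvertex : ∀ y, c y = T.pathIntegral g y := by
    refine T.vertex_induction (hroot.trans T.pathIntegral_root.symm) fun y hy hparent => ?_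
    rw [← (hc y hy).2, hedge y hy _ (right_mem_Icc.2 (T.height_parent_lt hy).le), hparent,
      pathIntegral_eq hy, primitive]
  rw [hedge y hy s hs, hvertex, primitive]

lemma ae_mem_edge : ∀ᵐ x ∂T.measure,
    x.1 ≠ T.root ∧ x.2 ∈ Ioc (T.height (T.parent x.1)) (T.height x.1) := by
  have hmeas : MeasurableSet {x : T.Vertex × ℝ |
      x.1 ≠ T.root ∧ x.2 ∈ Ioc (T.height (T.parent x.1)) (T.height x.1)} := by
    refine (measurable_fst (MeasurableSet.of_discrete (s := {T.root}ᶜ))).inter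
      ((measurableSet_lt ?_ measurable_snd).inter (measurableSet_le measurable_snd ?_))
    · exact (Measurable.of_discrete (f := fun y => T.height (T.parent y))).comp measurable_fst
    · exact (Measurable.of_discrete (f := T.height)).comp measurable_fst
  refine (Measure.ae_sum_iff' hmeas).2 fun y => ?_
  rw [(measurableEmbedding_mk y.1).ae_map_iff]
  filter_upwards [ae_restrict_mem measurableSet_Ioc] with s hs using ⟨y.2, hs⟩

lemma mem_sobolev_iff {p : Lp ℂ 2 T.measure × Lp ℂ 2 T.measure} :
    p ∈ T.sobolev ↔ p.1 =ᵐ[T.measure] T.primitive p.2 := by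
  constructor
  · rintro ⟨F, G, hFG, hF, hG⟩
    filter_upwards [hF, ae_mem_edge] with x hx hedge
    rw [hx, hFG.eq_primitive hG hedge.1 (Ioc_subset_Icc_self hedge.2)]
  · exact fun hp => ⟨_, _, isPrimitive_primitive p.2, hp, Filter.Eventually.of_forall fun _ => rfl⟩

lemma continuous_primitive {s : ℝ} (hy : y ≠ T.root) (hs : s ≤ T.height y) :
    Continuous fun f : Lp ℂ 2 T.measure => T.primitive f (y, s) := by
  have hvertex : ∀ y, Continuous fun f : Lp ℂ 2 T.measure => T.pathIntegral f y := by
    refine T.vertex_induction ?_ fun y hy hparent => ?_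
    · simp only [T.pathIntegral_root, continuous_const]
    · simp only [pathIntegral_eq hy, primitive]
      exact hparent.add (continuous_integral_of_le (edgeMeasure_le hy le_rfl))
  exact (hvertex _).add (continuous_integral_of_le (edgeMeasure_le hy hs))

lemma isClosed_sobolev : IsClosed (T.sobolev : Set (Lp ℂ 2 T.measure × Lp ℂ 2 T.measure)) := by
  have hset : (T.sobolev : Set (Lp ℂ 2 T.measure × Lp ℂ 2 T.measure))
      = {p | p.1 =ᵐ[T.measure] T.primitive p.2} := Set.ext fun _ => mem_sobolev_iff
  rw [hset]
  refine isClosed_setOf_ae_eq (fun f => T.primitive f) ?_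
  filter_upwards [ae_mem_edge] with x hx using continuous_primitive hx.1 hx.2.2

namespace IsRegularWith

variable {b : ℕ → ℕ} {t : ℕ → ℝ} (hT : T.IsRegularWith b t)

include hT

lemma restrict_Ioc_le_weightedMeasure (k n : ℕ) :
    volume.restrict (Ioc (t k) (t n)) ≤ RegularTree.weightedMeasure b t k := by
  refine Measure.le_iff.2 fun S hS => ?_
  rw [weightedMeasure_eq_sum, Measure.sum_apply _ hS, Measure.restrict_apply hS,
    ← hT.t_strictMono.monotone.biUnion_Ico_Ioc_map_succ, inter_iUnion₂]
  calc volume (⋃ m ∈ Ico k n, S ∩ Ioc (t m) (t (m + 1)))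
      ≤ ∑ m ∈ Finset.Ico k n, volume (S ∩ Ioc (t m) (t (m + 1))) := by
        simpa only [Finset.mem_Ico, mem_Ico] using measure_biUnion_finset_le (Finset.Ico k n) _
    _ ≤ ∑ m ∈ Finset.Ico k n, ((weight b k m : ℝ≥0∞) • stepMeasure t m) S := by
        refine Finset.sum_le_sum fun m hm => ?_
        rw [Measure.smul_apply, smul_eq_mul, stepMeasure, Measure.restrict_apply hS]
        exact le_mul_of_one_le_left zero_le
          (by exact_mod_cast hT.weight_pos (Finset.mem_Ico.1 hm).1)
    _ ≤ _ := ENNReal.sum_le_tsum _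

lemma mem_weighted_sobolev_iff {k : ℕ} {p : Lp ℂ 2 (RegularTree.weightedMeasure b t k) ×
    Lp ℂ 2 (RegularTree.weightedMeasure b t k)} : p ∈ RegularTree.sobolev b t k ↔
      p.1 =ᵐ[RegularTree.weightedMeasure b t k] fun s => ∫ τ in t k..s, p.2 τ := by
  have hle : ∀ n, k ≤ n → t k ≤ t n := fun n hn => hT.t_strictMono.monotone hn
  have hint : ∀ n, k ≤ n → IntervalIntegrable p.2 volume (t k) (t n) := fun n hn =>
    (intervalIntegrable_iff_integrableOn_Ioc_of_le (hle n hn)).2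
      (integrable_of_le (hT.restrict_Ioc_le_weightedMeasure k n) p.2)
  constructor
  · rintro ⟨F, G, hstart, hFG, hF, hG⟩
    refine Filter.EventuallyEq.trans hF (hT.ae_weightedMeasure_iff.2 fun n hn => ?_)
    filter_upwards [ae_stepMeasure_mem t n] with s hs
    have hGp := (hFG (n + 1) (by omega)).congr (hle _ (by omega)) (fun _ _ => rfl)
      ((hT.restrict_Ioc_le_weightedMeasure k (n + 1)).absolutelyContinuous.ae_le hG)
    rw [hGp.2 s ⟨(hle n hn).trans hs.1.le, hs.2⟩, hstart, zero_add]
  · exact fun hp => ⟨_, p.2, intervalIntegral.integral_same, fun n hn =>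
      ⟨hint n hn, fun s _ => by rw [intervalIntegral.integral_same, zero_add]⟩, hp,
      Filter.EventuallyEq.refl _ _⟩

lemma isClosed_weighted_sobolev (k : ℕ) : IsClosed (RegularTree.sobolev b t k :
    Set (Lp ℂ 2 (RegularTree.weightedMeasure b t k) ×
      Lp ℂ 2 (RegularTree.weightedMeasure b t k))) := by
  have hset : (RegularTree.sobolev b t k : Set (Lp ℂ 2 (RegularTree.weightedMeasure b t k) ×
      Lp ℂ 2 (RegularTree.weightedMeasure b t k)))
      = {p | p.1 =ᵐ[RegularTree.weightedMeasure b t k] fun s => ∫ τ in t k..s, p.2 τ} :=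
    Set.ext fun _ => hT.mem_weighted_sobolev_iff
  rw [hset]
  refine isClosed_setOf_ae_eq (fun f s => ∫ τ in t k..s, f τ) ?_
  refine hT.ae_weightedMeasure_iff.2 fun n hn => ?_
  filter_upwards [ae_stepMeasure_mem t n] with s hs
  simp only [intervalIntegral.integral_of_le ((hT.t_strictMono.monotone hn).trans hs.1.le)]
  exact continuous_integral_of_le ((Measure.restrict_mono (Ioc_subset_Ioc_right hs.2) le_rfl).trans
    (hT.restrict_Ioc_le_weightedMeasure k (n + 1)))

end IsRegularWith

end RootedMetricTree

/-! ### The decomposition of the Sobolev space of a regular tree -/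

lemma tendsto_eLpNorm_indicator_zero {X E : Type*} [MeasurableSpace X] {μ : Measure X}
    [NormedAddCommGroup E] {p : ℝ≥0∞} (hp0 : p ≠ 0) (hp : p ≠ ⊤) {f : X → E} (hf : MemLp f p μ)
    {S : ℕ → Set X} (hS : ∀ k, MeasurableSet (S k))
    (hlim : ∀ᵐ x ∂μ, ∀ᶠ k in Filter.atTop, x ∉ S k) :
    Filter.Tendsto (fun k => eLpNorm ((S k).indicator f) p μ) Filter.atTop (𝓝 0) := by
  have hpos : 0 < p.toReal := ENNReal.toReal_pos hp0 hp
  have htend : Filter.Tendsto (fun k => ∫⁻ x, ‖(S k).indicator f x‖ₑ ^ p.toReal ∂μ)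
      Filter.atTop (𝓝 (∫⁻ _, 0 ∂μ)) := by
    refine tendsto_lintegral_of_dominated_convergence' (fun x => ‖f x‖ₑ ^ p.toReal)
      (fun k => (hf.1.indicator (hS k)).enorm.pow_const _) (fun k => ?_)
      (lintegral_rpow_enorm_lt_top_of_eLpNorm_lt_top hp0 hp hf.2).ne ?_
    · exact .of_forall fun x => ENNReal.rpow_le_rpow (enorm_indicator_le_enorm_self f x) hpos.le
    · filter_upwards [hlim] with x hx
      refine tendsto_const_nhds.congr' ?_
      filter_upwards [hx] with k hk
      rw [indicator_of_notMem hk, enorm_zero, ENNReal.zero_rpow_of_pos hpos]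
  simp only [eLpNorm_eq_lintegral_rpow_enorm_toReal hp0 hp]
  simpa only [lintegral_zero, ENNReal.zero_rpow_of_pos (one_div_pos.2 hpos)] using
    htend.ennrpow_const (1 / p.toReal)

namespace RootedMetricTree

namespace IsRegularWith

variable {T : RootedMetricTree} {b : ℕ → ℕ} {t : ℕ → ℝ} (hT : T.IsRegularWith b t)

include hT

lemma t_le {m n : ℕ} (h : m ≤ n) : t m ≤ t n := hT.t_strictMono.monotone h

lemma height_of_gen_eq {y : T.Vertex} {n : ℕ} (hy : T.gen y = n) : T.height y = t n := by
  rw [hT.height_eq, hy]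

lemma embed_mem_sobolev (i : hT.Index) {p : Lp ℂ 2 (RegularTree.weightedMeasure b t i.1) ×
    Lp ℂ 2 (RegularTree.weightedMeasure b t i.1)} (hp : p ∈ RegularTree.sobolev b t i.1) :
    (hT.embed i p.1, hT.embed i p.2) ∈ T.sobolev := by
  obtain ⟨F, G, hstart, hFG, hF, hG⟩ := hp
  refine ⟨fun z s => hT.amp i z * F s, fun z s => hT.amp i z * G s,
    ⟨⟨fun y => hT.amp i y * F (T.height y), ?_, fun y hy => ⟨?_, rfl⟩⟩, fun y hy => ?_⟩,
    hT.coeFn_embed i hF, hT.coeFn_embed i hG⟩ <;> beta_reduce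
  · rw [hT.amp_of_le (T.gen_root.trans_le (Nat.zero_le _)), zero_mul]
  · have hgen := T.gen_parent hy
    rcases lt_trichotomy (T.gen (T.parent y)) i.1 with hlt | heq | hgt
    · rw [hT.amp_of_le (by omega), hT.amp_of_le (by omega)]
    · rw [hT.height_of_gen_eq heq, hstart, mul_zero, mul_zero]
    · rw [hT.amp_of_lt (by omega)]
  · have hgen := T.gen_parent hy
    rw [hT.height_of_gen_eq rfl, hT.height_of_gen_eq hgen.symm]
    by_cases hle : i.1 ≤ T.gen (T.parent y)
    · exact ((hFG _ (by omega)).mono (hT.t_le hle) (hT.t_le (Nat.le_succ _)) le_rfl).smul _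
    · simpa only [hT.amp_of_le (show T.gen y ≤ i.1 by omega), zero_mul]
        using IsPrimitiveOn.zero _ _

lemma levelMean_of_lt (i : hT.Index) {n : ℕ} (hn : n < i.1) (c : T.Vertex → ℂ) :
    hT.levelMean i n c = 0 := by
  rw [levelMean, weight_of_lt hn, Nat.cast_zero, inv_zero, zero_mul]

lemma levelMean_congr (i : hT.Index) {n : ℕ} {c c' : T.Vertex → ℂ}
    (h : ∀ z ∈ hT.level (n + 1), c z = c' z) : hT.levelMean i n c = hT.levelMean i n c' := by
  rw [levelMean, levelMean, Finset.sum_congr rfl fun z hz => by rw [h z hz]]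

lemma levelMean_self_comp_parent (i : hT.Index) {c : T.Vertex → ℂ} (hc : c T.root = 0) :
    hT.levelMean i i.1 (fun z => c (T.parent z)) = 0 := by
  rw [levelMean, hT.sum_level_succ, Finset.sum_eq_zero, mul_zero]
  intro y hy
  rw [Finset.sum_congr rfl fun z hz => by rw [(hT.mem_children.1 hz).2], ← Finset.sum_mul]
  by_cases hroot : y = T.root
  · rw [hroot, hc, mul_zero]
  · rw [← map_sum, hT.sum_children_amp (hT.mem_level.1 hy) hroot, map_zero, zero_mul]

lemma levelMean_succ_comp_parent (i : hT.Index) {n : ℕ} (hn : i.1 ≤ n) (c : T.Vertex → ℂ) :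
    hT.levelMean i (n + 1) (fun z => c (T.parent z)) = hT.levelMean i n c := by
  have hamp : ∀ z ∈ hT.level (n + 1 + 1), conj (hT.amp i z) * c (T.parent z)
      = conj (hT.amp i (T.parent z)) * c (T.parent z) := fun z hz => by
    rw [hT.amp_of_lt (by rw [hT.mem_level.1 hz]; omega)]
  have hb : (b (n + 1) : ℂ) ≠ 0 := Nat.cast_ne_zero.2 (hT.b_pos _).ne'
  rw [levelMean, levelMean, Finset.sum_congr rfl hamp,
    hT.sum_level_succ_comp_parent (n + 1) fun y => conj (hT.amp i y) * c y, weight_succ hn,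
    nsmul_eq_mul, Nat.cast_mul, mul_inv_rev, mul_assoc, inv_mul_cancel_left₀ hb]

variable {F G : T.Vertex → ℝ → ℂ}

lemma exists_vertex_values (hFG : T.IsPrimitive F G) : ∃ c : T.Vertex → ℂ, c T.root = 0 ∧
    ∀ n, ∀ z ∈ hT.level (n + 1), F z (t n) = c (T.parent z) ∧ F z (t (n + 1)) = c z := by
  obtain ⟨⟨c, hroot, hc⟩, -⟩ := hFG
  refine ⟨c, hroot, fun n z hz => ?_⟩
  have hgen := hT.mem_level.1 hz
  rw [← hT.height_of_gen_eq hgen, ← hT.height_of_gen_eq (T.gen_parent_of_gen_eq_succ hgen)]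
  exact hc z (T.ne_root_of_gen_eq_succ hgen)

lemma fiberMean_start (i : hT.Index) (hFG : T.IsPrimitive F G) :
    hT.fiberMean i F (t i.1) = 0 := by
  obtain ⟨c, hroot, hc⟩ := hT.exists_vertex_values hFG
  cases hi : i.1 with
  | zero =>
    have hindex : stepIndex t (t 0) = i.1 := by
      rw [hi, stepIndex, Nat.sInf_eq_zero]
      exact Or.inl (hT.t_le (Nat.zero_le _))
    rw [fiberMean, hindex, hT.levelMean_congr i fun z hz => ?_,
      hT.levelMean_self_comp_parent i hroot]
    exact hi ▸ (hc i.1 z hz).1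
  | succ k =>
    rw [hT.fiberMean_eq i F ⟨hT.t_strictMono (Nat.lt_succ_self k), le_rfl⟩,
      hT.levelMean_of_lt i (by omega)]

lemma fiberMean_of_mem_Icc (i : hT.Index) (hFG : T.IsPrimitive F G) {n : ℕ} (hn : i.1 ≤ n)
    {s : ℝ} (hs : s ∈ Icc (t n) (t (n + 1))) :
    hT.fiberMean i F s = hT.levelMean i n fun z => F z s := by
  rcases hs.1.eq_or_lt with rfl | hlt
  · obtain ⟨c, hroot, hc⟩ := hT.exists_vertex_values hFG
    rw [hT.levelMean_congr i fun z hz => (hc n z hz).1]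
    rcases hn.eq_or_lt with rfl | hlt
    · rw [hT.fiberMean_start i hFG, hT.levelMean_self_comp_parent i hroot]
    · obtain ⟨m, rfl⟩ := Nat.exists_eq_succ_of_ne_zero (Nat.ne_zero_of_lt hlt)
      rw [hT.fiberMean_eq i F ⟨hT.t_strictMono (Nat.lt_succ_self m), le_rfl⟩,
        hT.levelMean_succ_comp_parent i (by omega), hT.levelMean_congr i fun z hz => (hc m z hz).2]
  · exact hT.fiberMean_eq i F ⟨hlt, hs.2⟩

lemma isPrimitiveOn_fiberMean (i : hT.Index) (hFG : T.IsPrimitive F G) {n : ℕ} (hn : i.1 ≤ n) :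
    IsPrimitiveOn (t i.1) (t n) (hT.fiberMean i F) (hT.fiberMean i G) := by
  induction n, hn using Nat.le_induction with
  | base => exact IsPrimitiveOn.refl _ _ _
  | succ n hn ih =>
    have hstep : t n ≤ t (n + 1) := hT.t_le (Nat.le_succ n)
    refine ih.trans (hT.t_le hn) hstep (((IsPrimitiveOn.sum (hT.level (n + 1)) (f := F) (g := G)
      (fun z => conj (hT.amp i z)) fun z hz => ?_).smul (weight b i.1 n : ℂ)⁻¹).congr hstep
      (fun s hs => hT.fiberMean_of_mem_Icc i hFG hn hs) (hT.fiberMean_ae_eq i G n))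
    have hgen := hT.mem_level.1 hz
    rw [← hT.height_of_gen_eq hgen, ← hT.height_of_gen_eq (T.gen_parent_of_gen_eq_succ hgen)]
    exact hFG.2 z (T.ne_root_of_gen_eq_succ hgen)

lemma coisometry_embed_ae_eq (i : hT.Index) {f : Lp ℂ 2 T.measure}
    (hf : ∀ᵐ x ∂T.measure, f x = F x.1 x.2) :
    coisometry (hT.embed i) f =ᵐ[RegularTree.weightedMeasure b t i.1] hT.fiberMean i F := by
  refine (hT.coeFn_coisometry_embed i f).trans (hT.ae_weightedMeasure_iff.2 fun n _ => ?_)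
  filter_upwards [hT.ae_measure_iff.1 hf n, ae_stepMeasure_mem t n] with s hfF hs
  rw [hT.fiberMean_eq i _ hs, hT.fiberMean_eq i _ hs, hT.levelMean_congr i hfF]

lemma coisometry_embed_mem_sobolev (i : hT.Index) {p : Lp ℂ 2 T.measure × Lp ℂ 2 T.measure}
    (hp : p ∈ T.sobolev) : (coisometry (hT.embed i) p.1, coisometry (hT.embed i) p.2)
      ∈ RegularTree.sobolev b t i.1 := by
  obtain ⟨F, G, hFG, hF, hG⟩ := hp
  exact ⟨hT.fiberMean i F, hT.fiberMean i G, hT.fiberMean_start i hFG,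
    fun n hn => hT.isPrimitiveOn_fiberMean i hFG hn, hT.coisometry_embed_ae_eq i hF,
    hT.coisometry_embed_ae_eq i hG⟩

/-! ### Extension by zero -/

omit hT in
lemma weight_zero_mul {k n : ℕ} (h : k ≤ n) : weight b 0 n = weight b 0 k * weight b k n := by
  induction n, h using Nat.le_induction with
  | base => rw [weight_self, mul_one]
  | succ n hn ih => rw [weight_succ (Nat.zero_le n), weight_succ hn, ih, mul_left_comm]

/-- The function `(b_1 ⋯ b_k)^{-1/2}` on `(t_k, ∞)`, continued by zero. Since
`g_0 = b_1 ⋯ b_k g_k` on `(t_k, R)`, multiplication by it makes the extension by zero isometric. -/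
def extensionFactor (b : ℕ → ℕ) (t : ℕ → ℝ) (k : ℕ) : ℝ → ℂ :=
  (Ioi (t k)).indicator fun _ => ((√(weight b 0 k : ℝ))⁻¹ : ℝ)

omit hT in
lemma measurable_extensionFactor (b : ℕ → ℕ) (t : ℕ → ℝ) (k : ℕ) :
    Measurable (extensionFactor b t k) := measurable_const.indicator measurableSet_Ioi

omit hT in
lemma extensionFactor_of_le (b : ℕ → ℕ) {t : ℕ → ℝ} {k : ℕ} {s : ℝ} (hs : s ≤ t k) :
    extensionFactor b t k s = 0 := indicator_of_notMem (notMem_Ioi.2 hs) _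

omit hT in
lemma extensionFactor_of_lt (b : ℕ → ℕ) {t : ℕ → ℝ} {k : ℕ} {s : ℝ} (hs : t k < s) :
    extensionFactor b t k s = ((√(weight b 0 k : ℝ))⁻¹ : ℝ) := indicator_of_mem (mem_Ioi.2 hs) _

lemma weight_zero_mul_enorm_extensionFactor_sq (k : ℕ) {n : ℕ} {s : ℝ}
    (hs : s ∈ Ioc (t n) (t (n + 1))) :
    (weight b 0 n : ℝ≥0∞) * ‖extensionFactor b t k s‖ₑ ^ 2 = weight b k n := by
  rcases lt_or_ge n k with hlt | hge
  · rw [weight_of_lt hlt, extensionFactor_of_le b (hs.2.trans (hT.t_le hlt)), enorm_zero,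
      zero_pow two_ne_zero, mul_zero, Nat.cast_zero]
  · have hpos : (0 : ℝ) < weight b 0 k := Nat.cast_pos.2 (hT.weight_pos (Nat.zero_le k))
    have hnorm : ‖extensionFactor b t k s‖ ^ 2 = (weight b 0 k : ℝ)⁻¹ := by
      rw [extensionFactor_of_lt b ((hT.t_le hge).trans_lt hs.1), Complex.norm_real,
        Real.norm_eq_abs, sq_abs, inv_pow, Real.sq_sqrt hpos.le]
    rw [← ofReal_norm, ← ENNReal.ofReal_pow (norm_nonneg _), hnorm, ← ENNReal.ofReal_natCast,
      ← ENNReal.ofReal_mul (Nat.cast_nonneg _), weight_zero_mul hge, Nat.cast_mul,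
      mul_right_comm, mul_inv_cancel₀ hpos.ne', one_mul, ENNReal.ofReal_natCast]

lemma measurePreserving_id_extensionFactor (k : ℕ) : MeasurePreserving id
    ((RegularTree.weightedMeasure b t 0).withDensity fun s => ‖extensionFactor b t k s‖ₑ ^ 2)
    (RegularTree.weightedMeasure b t k) := by
  refine ⟨measurable_id, ?_⟩
  rw [Measure.map_id]
  have hmeas := (measurable_extensionFactor b t k).enorm.pow_const 2
  ext S hS
  rw [withDensity_apply _ hS, ← lintegral_indicator hS, lintegral_weightedMeasure,
    weightedMeasure_eq_sum b t k, Measure.sum_apply _ hS]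
  refine tsum_congr fun n => ?_
  rw [lintegral_indicator hS, ← lintegral_const_mul _ hmeas, Measure.smul_apply, smul_eq_mul,
    ← setLIntegral_const]
  refine lintegral_congr_ae (ae_restrict_of_ae ?_)
  filter_upwards [ae_stepMeasure_mem t n] with s hs
  exact hT.weight_zero_mul_enorm_extensionFactor_sq k hs

/-- Extension by zero, up to a constant factor, as an isometry of `L²((t_k, R), g_k)` into
`L²((t_0, R), g_0)`. -/
def extension (k : ℕ) : Lp ℂ 2 (RegularTree.weightedMeasure b t k) →ₗᵢ[ℂ]
    Lp ℂ 2 (RegularTree.weightedMeasure b t 0) :=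
  weightedComp (measurable_extensionFactor b t k) (hT.measurePreserving_id_extensionFactor k)

lemma coeFn_extension (k : ℕ) {u : Lp ℂ 2 (RegularTree.weightedMeasure b t k)} {F : ℝ → ℂ}
    (hF : u =ᵐ[RegularTree.weightedMeasure b t k] F) :
    hT.extension k u =ᵐ[RegularTree.weightedMeasure b t 0]
      fun s => extensionFactor b t k s * F s :=
  coeFn_weightedComp _ _ hF

lemma isPrimitiveOn_extensionFactor_mul {k : ℕ} {F G : ℝ → ℂ} (hstart : F (t k) = 0)
    (hFG : ∀ n, k ≤ n → IsPrimitiveOn (t k) (t n) F G) (n : ℕ) : IsPrimitiveOn (t 0) (t n)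
      (fun s => extensionFactor b t k s * F s) fun s => extensionFactor b t k s * G s := by
  have hzero : ∀ {s}, t 0 ≤ s → s ≤ t k → IsPrimitiveOn (t 0) s
      (fun s => extensionFactor b t k s * F s) fun s => extensionFactor b t k s * G s := by
    intro s hs hsk
    refine (IsPrimitiveOn.zero (t 0) s).congr hs (fun x hx => ?_) ?_
    · rw [extensionFactor_of_le b (hx.2.trans hsk), zero_mul]
    · filter_upwards [ae_restrict_mem measurableSet_Ioc] with x hx
      rw [extensionFactor_of_le b (hx.2.trans hsk), zero_mul]
  rcases le_total n k with hn | hn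
  · exact hzero (hT.t_le (Nat.zero_le n)) (hT.t_le hn)
  · refine (hzero (hT.t_le (Nat.zero_le k)) le_rfl).trans (hT.t_le (Nat.zero_le k)) (hT.t_le hn)
      (((hFG n hn).smul ((√(weight b 0 k : ℝ))⁻¹ : ℝ)).congr (hT.t_le hn) (fun x hx => ?_) ?_)
    · rcases hx.1.eq_or_lt with rfl | hlt
      · rw [hstart, mul_zero, mul_zero]
      · rw [extensionFactor_of_lt b hlt]
    · filter_upwards [ae_restrict_mem measurableSet_Ioc] with x hx
      rw [extensionFactor_of_lt b hx.1]

lemma extension_mem_sobolev (k : ℕ) {p : Lp ℂ 2 (RegularTree.weightedMeasure b t k) ×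
    Lp ℂ 2 (RegularTree.weightedMeasure b t k)} (hp : p ∈ RegularTree.sobolev b t k) :
    (hT.extension k p.1, hT.extension k p.2) ∈ RegularTree.sobolev b t 0 := by
  obtain ⟨F, G, hstart, hFG, hF, hG⟩ := hp
  have hprim := hT.isPrimitiveOn_extensionFactor_mul hstart hFG
  refine ⟨_, _, ?_, fun n _ => hprim n, hT.coeFn_extension k hF, hT.coeFn_extension k hG⟩
  rw [extensionFactor_of_le b (hT.t_le (Nat.zero_le k)), zero_mul]

lemma coisometry_extension_congr (k : ℕ) {f g : Lp ℂ 2 (RegularTree.weightedMeasure b t 0)}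
    (hfg : ∀ᵐ s ∂(RegularTree.weightedMeasure b t 0), t k < s → f s = g s) :
    coisometry (hT.extension k) f = coisometry (hT.extension k) g := by
  refine ext_inner_left ℂ fun u => ?_
  rw [inner_coisometry_right, inner_coisometry_right, L2.inner_def, L2.inner_def]
  refine integral_congr_ae ?_
  filter_upwards [hT.coeFn_extension k (Filter.EventuallyEq.refl _ u), hfg] with s hu hs
  rcases le_or_gt s (t k) with hle | hlt
  · rw [hu, extensionFactor_of_le b hle, zero_mul, inner_zero_left, inner_zero_left]
  · rw [hs hlt]

lemma tendsto_eLpNorm_indicator_Ioi (f : Lp ℂ 2 (RegularTree.weightedMeasure b t 0)) :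
    Filter.Tendsto (fun k => eLpNorm ((Ioi (t k)).indicator f) 2
      (RegularTree.weightedMeasure b t 0)) Filter.atTop (𝓝 0) := by
  refine tendsto_eLpNorm_indicator_zero two_ne_zero ENNReal.ofNat_ne_top (Lp.memLp f)
    (fun k => measurableSet_Ioi) (hT.ae_weightedMeasure_iff.2 fun n _ => ?_)
  filter_upwards [ae_stepMeasure_mem t n] with s hs
  filter_upwards [Filter.eventually_ge_atTop (n + 1)] with k hk
  exact notMem_Ioi.2 (hs.2.trans (hT.t_le hk))

lemma tendsto_norm_coisometry_extension (f : Lp ℂ 2 (RegularTree.weightedMeasure b t 0)) :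
    Filter.Tendsto (fun k => ‖coisometry (hT.extension k) f‖) Filter.atTop (𝓝 0) := by
  have hmem : ∀ k, MemLp ((Ioi (t k)).indicator f) 2 (RegularTree.weightedMeasure b t 0) := fun k =>
    (Lp.memLp f).indicator measurableSet_Ioi
  have htail : Filter.Tendsto (fun k => ‖(hmem k).toLp‖) Filter.atTop (𝓝 0) := by
    simpa only [Lp.norm_toLp, ENNReal.toReal_zero, Function.comp_def] using
      (ENNReal.tendsto_toReal ENNReal.zero_ne_top).comp (hT.tendsto_eLpNorm_indicator_Ioi f)
  refine squeeze_zero (fun _ => norm_nonneg _) (fun k => ?_) htail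
  have hcongr : coisometry (hT.extension k) f = coisometry (hT.extension k) (hmem k).toLp := by
    refine hT.coisometry_extension_congr k ?_
    filter_upwards [(hmem k).coeFn_toLp] with s hs hlt
    rw [hs, indicator_of_mem (mem_Ioi.2 hlt)]
  rw [hcongr]
  exact ((coisometry (hT.extension k)).le_of_opNorm_le (norm_coisometry_le_one _) _).trans_eq
    (one_mul _)

end IsRegularWith

end RootedMetricTree

/-! ### The decomposition of the Schrödinger operator -/

namespace RootedMetricTree

lemma measurable_radial (T : RootedMetricTree) {V : ℝ → ℝ} (hV : Measurable V) :
    Measurable fun x : T.Vertex × ℝ => V x.2 := hV.comp measurable_snd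

instance completeSpace_formSpace (T : RootedMetricTree) {q : T.Vertex × ℝ → ℝ} (hq : Measurable q)
    (m : ℝ) : CompleteSpace (formSpace T.sobolev hq m) :=
  (isClosed_formSpace T.isClosed_sobolev hq m).completeSpace_coe

namespace IsRegularWith

variable {T : RootedMetricTree} {b : ℕ → ℕ} {t : ℕ → ℝ} (hT : T.IsRegularWith b t)

include hT

lemma completeSpace_weighted_formSpace {q : ℝ → ℝ} (hq : Measurable q) (m : ℝ) (k : ℕ) :
    CompleteSpace (formSpace (RegularTree.sobolev b t k) hq m) :=
  (isClosed_formSpace (hT.isClosed_weighted_sobolev k) hq m).completeSpace_coe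

lemma mem_Icc_of_mem_Ioc {n : ℕ} {s : ℝ} (hs : s ∈ Ioc (t n) (t (n + 1))) :
    s ∈ Icc 0 (t (n + 1)) :=
  ⟨hT.t_zero.symm.trans_le ((hT.t_le (Nat.zero_le n)).trans hs.1.le), hs.2⟩

variable {V : ℝ → ℝ} (hV : Measurable V) {m : ℝ}

lemma isResolventAt_schrodinger (hm : ∀ n, ∀ s ∈ Icc 0 (t n), 1 ≤ V s + m) :
    IsResolventAt (formEmbedding T.sobolev (T.measurable_radial hV) m ∘L
      (formEmbedding T.sobolev (T.measurable_radial hV) m).adjoint) m (T.schrodinger V hV) := by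
  refine isResolventAt_formOperator (T.measurable_radial hV) (hT.ae_measure_iff.2 fun n => ?_)
  filter_upwards [ae_stepMeasure_mem t n] with s hs z _
  exact hm (n + 1) s (hT.mem_Icc_of_mem_Ioc hs)

lemma isResolventAt_weighted_schrodinger (hm : ∀ n, ∀ s ∈ Icc 0 (t n), 1 ≤ V s + m) (k : ℕ)
    [CompleteSpace (formSpace (RegularTree.sobolev b t k) hV m)] :
    IsResolventAt (formEmbedding (RegularTree.sobolev b t k) hV m ∘L
      (formEmbedding (RegularTree.sobolev b t k) hV m).adjoint) m
      (RegularTree.schrodinger b t k V hV) := by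
  refine isResolventAt_formOperator hV (hT.ae_weightedMeasure_iff.2 fun n _ => ?_)
  filter_upwards [ae_stepMeasure_mem t n] with s hs
  exact hm (n + 1) s (hT.mem_Icc_of_mem_Ioc hs)

variable (m) in
lemma embed_formMul (i : hT.Index) (u : Lp ℂ 2 (RegularTree.weightedMeasure b t i.1)) :
    hT.embed i (formMul _ hV m u)
      = formMul T.measure (T.measurable_radial hV) m (hT.embed i u) :=
  weightedComp_formMul _ _ hV m u

variable (m) in
/-- The isometry of form domains induced by `embed`. -/
def formEmbed (i : hT.Index) : ↥(formSpace (RegularTree.sobolev b t i.1) hV m) →ₗᵢ[ℂ]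
    ↥(formSpace T.sobolev (T.measurable_radial hV) m) :=
  formTransport (hT.embed i) (hT.embed_formMul hV m i) fun _ => hT.embed_mem_sobolev i

set_option synthInstance.maxHeartbeats 40000 in
-- The coercion to functions of the maps out of `formSpace` is found slowly for a dependent index.
lemma formEmbedding_formEmbed (i : hT.Index)
    (κ : formSpace (RegularTree.sobolev b t i.1) hV m) :
    formEmbedding T.sobolev (T.measurable_radial hV) m (hT.formEmbed hV m i κ)
      = hT.embed i (formEmbedding (RegularTree.sobolev b t i.1) hV m κ) :=
  formEmbedding_formTransport _ _ κ

variable (m) in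
lemma isHilbertSum_formEmbed
    [∀ k, CompleteSpace (formSpace (RegularTree.sobolev b t k) hV m)] :
    IsHilbertSum ℂ (fun i : hT.Index => ↥(formSpace (RegularTree.sobolev b t i.1) hV m))
      (hT.formEmbed hV m) :=
  isHilbertSum_formTransport (hT.embed_formMul hV m) (fun i _ => hT.embed_mem_sobolev i)
    (fun i _ => hT.coisometry_embed_mem_sobolev i) hT.isHilbertSum_embed

variable (m) in
/-- The isometry of form domains induced by `extension`. -/
def formExtension (k : ℕ) : ↥(formSpace (RegularTree.sobolev b t k) hV m) →ₗᵢ[ℂ]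
    ↥(formSpace (RegularTree.sobolev b t 0) hV m) :=
  formTransport (hT.extension k) (weightedComp_formMul _ _ hV m) fun _ => hT.extension_mem_sobolev k

lemma formEmbedding_formExtension (k : ℕ) (κ : formSpace (RegularTree.sobolev b t k) hV m) :
    formEmbedding (RegularTree.sobolev b t 0) hV m (hT.formExtension hV m k κ)
      = hT.extension k (formEmbedding (RegularTree.sobolev b t k) hV m κ) :=
  formEmbedding_formTransport _ _ κ

lemma isCompactOperator_weighted_zero
    (h : IsCompactOperator (formEmbedding T.sobolev (T.measurable_radial hV) m)) :
    IsCompactOperator (formEmbedding (RegularTree.sobolev b t 0) hV m) :=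
  isCompactOperator_compression (hT.formEmbedding_formEmbed hV
    ⟨0, ⟨0, hT.finrank_zeroSumSpace_zero ▸ hT.b_pos 0⟩⟩) h

lemma isCompactOperator_weighted
    (h : IsCompactOperator (formEmbedding (RegularTree.sobolev b t 0) hV m)) (k : ℕ) :
    IsCompactOperator (formEmbedding (RegularTree.sobolev b t k) hV m) :=
  isCompactOperator_compression (hT.formEmbedding_formExtension hV k) h

lemma tendsto_norm_formEmbedding
    (h : IsCompactOperator (formEmbedding (RegularTree.sobolev b t 0) hV m)) :
    Filter.Tendsto (fun k => ‖formEmbedding (RegularTree.sobolev b t k) hV m‖) Filter.atTop (𝓝 0) :=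
  squeeze_zero (fun _ => ContinuousLinearMap.opNorm_nonneg _)
    (fun k => norm_le_norm_coisometry_comp (hT.formEmbedding_formExtension hV k))
    (tendsto_norm_comp_of_isCompactOperator (fun k => norm_coisometry_le_one (hT.extension k))
      hT.tendsto_norm_coisometry_extension h)

lemma isCompactOperator_of_weighted_zero
    (h : IsCompactOperator (formEmbedding (RegularTree.sobolev b t 0) hV m)) :
    IsCompactOperator (formEmbedding T.sobolev (T.measurable_radial hV) m) := by
  have := hT.completeSpace_weighted_formSpace hV m
  refine isCompactOperator_of_intertwine hT.isHilbertSum_embed (hT.isHilbertSum_formEmbed hV m)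
    (hT.formEmbedding_formEmbed hV) (fun i => hT.isCompactOperator_weighted hV h i.1) fun ε hε => ?_
  obtain ⟨N, hN⟩ := Filter.eventually_atTop.1
    ((hT.tendsto_norm_formEmbedding hV h).eventually_lt_const hε)
  refine ((Finset.range N).sigma fun _ => Finset.univ).finite_toSet.subset fun i hi => ?_
  have hiN : i.1 < N := lt_of_not_ge fun hle => lt_asymm (hN i.1 hle) hi
  simpa using hiN

lemma hasDiscreteSpectrum_iff (hm : ∀ n, ∀ s ∈ Icc 0 (t n), 1 ≤ V s + m) :
    HasDiscreteSpectrum (T.schrodinger V hV) ↔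
      IsCompactOperator (formEmbedding T.sobolev (T.measurable_radial hV) m) :=
  (hT.isResolventAt_schrodinger hV hm).hasDiscreteSpectrum_iff

lemma hasDiscreteSpectrum_weighted_iff (hm : ∀ n, ∀ s ∈ Icc 0 (t n), 1 ≤ V s + m) (k : ℕ) :
    HasDiscreteSpectrum (RegularTree.schrodinger b t k V hV) ↔
      IsCompactOperator (formEmbedding (RegularTree.sobolev b t k) hV m) := by
  have := hT.completeSpace_weighted_formSpace hV m k
  exact (hT.isResolventAt_weighted_schrodinger hV hm k).hasDiscreteSpectrum_iff

lemma eigenvalueCount_eq_tsum (hm : ∀ n, ∀ s ∈ Icc 0 (t n), 1 ≤ V s + m) (r : ℝ) :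
    eigenvalueCount (T.schrodinger V hV) r
      = ∑' k, (Module.finrank ℂ (hT.zeroSumSpace k) : ℕ∞) *
          eigenvalueCount (RegularTree.schrodinger b t k V hV) r := by
  have := hT.completeSpace_weighted_formSpace hV m
  have hadjoint := adjoint_intertwine hT.orthogonalFamily_embed (hT.isHilbertSum_formEmbed hV m)
    (hT.formEmbedding_formEmbed hV)
  have hindex := _root_.eigenvalueCount_eq_tsum hT.isHilbertSum_embed (fun i u =>
      (congrArg _ (hadjoint i u)).trans (hT.formEmbedding_formEmbed hV i _))
    (hT.isResolventAt_schrodinger hV hm)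
    (fun i => hT.isResolventAt_weighted_schrodinger hV hm i.1) r
  refine hindex.trans ((Summable.tsum_sigma' (fun _ => summable_enat _) (summable_enat _)).trans
    (tsum_congr fun k => (tsum_fintype _).trans ?_))
  change ∑ _ : Fin _, eigenvalueCount (RegularTree.schrodinger b t k V hV) r = _
  rw [Fin.sum_const, nsmul_eq_mul]

end IsRegularWith

end RootedMetricTree

theorem theorem5p1_general (T : RootedMetricTree) (hbranch : ∀ y, 0 < T.branching y)
    (b : ℕ → ℕ) (hb : ∀ y, T.branching y = b (T.gen y))
    (t : ℕ → ℝ) (ht : ∀ y, T.height y = t (T.gen y))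
    (V : ℝ → ℝ) (hV : Measurable V)
    (hVbelow : ∃ c : ℝ, ∀ n, ∀ s ∈ Icc 0 (t n), c ≤ V s) :
    (HasDiscreteSpectrum (T.schrodinger V hV) ↔
      HasDiscreteSpectrum (RegularTree.schrodinger b t 0 V hV)) ∧
    (HasDiscreteSpectrum (T.schrodinger V hV) →
      (∀ k, HasDiscreteSpectrum (RegularTree.schrodinger b t k V hV)) ∧
      ∀ r : ℝ,
        eigenvalueCount (T.schrodinger V hV) r ≠ ⊤ ∧
        eigenvalueCount (T.schrodinger V hV) r =
          b 0 * eigenvalueCount (RegularTree.schrodinger b t 0 V hV) r +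
            ∑' i : ℕ, (((b 0 * ∏ j ∈ Finset.Icc 1 i, b j) * (b (i + 1) - 1) : ℕ) : ℕ∞) *
              eigenvalueCount (RegularTree.schrodinger b t (i + 1) V hV) r) := by
  have hT : T.IsRegularWith b t := ⟨hbranch, hb, ht⟩
  obtain ⟨c, hc⟩ := hVbelow
  have hm : ∀ n, ∀ s ∈ Icc 0 (t n), 1 ≤ V s + (1 - c) := fun n s hs => by linarith [hc n s hs]
  simp only [hT.hasDiscreteSpectrum_iff hV hm, hT.hasDiscreteSpectrum_weighted_iff hV hm]
  have hzero := hT.isCompactOperator_weighted_zero hV (m := 1 - c)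
  refine ⟨⟨hzero, hT.isCompactOperator_of_weighted_zero hV⟩, fun h =>
    ⟨hT.isCompactOperator_weighted hV (hzero h), fun r =>
      ⟨(hT.isResolventAt_schrodinger hV hm).eigenvalueCount_ne_top h r, ?_⟩⟩⟩
  rw [hT.eigenvalueCount_eq_tsum hV hm, tsum_eq_zero_add' (summable_enat _),
    hT.finrank_zeroSumSpace_zero]
  simp only [hT.finrank_zeroSumSpace_succ]

end

/-- `N(r; A_V) = N(r; A_{V,0}) + ∑_{k ≥ 1} b_1 ⋯ b_{k-1} (b_k - 1) N(r; A_{V,k})`; the sum is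
indexed by `i = k - 1`. -/
theorem theorem5p1 (T : RootedMetricTree)
    (hroot : T.branching T.root = 1)
    (hbranch : ∀ y, y ≠ T.root → 1 < T.branching y)
    (hreg : T.IsRegular)
    (b : ℕ → ℕ) (hb : ∀ y, T.branching y = b (T.gen y))
    (t : ℕ → ℝ) (ht : ∀ y, T.height y = t (T.gen y))
    (V : ℝ → ℝ) (hV : Measurable V)
    (hVbelow : ∃ c : ℝ, ∀ n, ∀ s ∈ Set.Icc 0 (t n), c ≤ V s) :
    (HasDiscreteSpectrum (T.schrodinger V hV) ↔
      HasDiscreteSpectrum (RegularTree.schrodinger b t 0 V hV)) ∧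
    (HasDiscreteSpectrum (T.schrodinger V hV) →
      (∀ k, HasDiscreteSpectrum (RegularTree.schrodinger b t k V hV)) ∧
      ∀ r : ℝ,
        eigenvalueCount (T.schrodinger V hV) r ≠ ⊤ ∧
        eigenvalueCount (T.schrodinger V hV) r =
          eigenvalueCount (RegularTree.schrodinger b t 0 V hV) r +
            ∑' i : ℕ, (((∏ j ∈ Finset.Icc 1 i, b j) * (b (i + 1) - 1) : ℕ) : ℕ∞) *
              eigenvalueCount (RegularTree.schrodinger b t (i + 1) V hV) r) := by
  have hpos : ∀ y, 0 < T.branching y := fun y => by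
    rcases eq_or_ne y T.root with rfl | hy
    · exact hroot ▸ one_pos
    · exact one_pos.trans (hbranch y hy)
  have hb_zero : b 0 = 1 := by rw [← T.gen_root, ← hb, hroot]
  simpa only [hb_zero, Nat.cast_one, one_mul] using theorem5p1_general T hpos b hb t ht V hV hVbelow
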